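/- Fix a relational schema with finitely many relation names $R$, each with a set of attributes, a primary key $K_R$, and a set of fixable attributes disjoint from $K_R$; attributes that are not fixable are rigid. The domain consists of the integers and of non-numerical constants (finite binary words). An instance is a finite set $D$ of database tuples whose fixable attributes take integer values, and $D\models\mathcal K$ means that two tuples of one relation with the same key value are equal. A one-database-atom denial (1AD) is a sentence $\forall\bar x\,\neg(A\wedge B)$, where $A$ is a database atom and $B$ is a conjunction of built-in atoms $x\,\theta\,c$ with $c$ a constant and $\theta\in\{=,\neq,<,>,\leq,\geq\}$, or $x=y$, or $x\neq y$, all of whose variables occur in $A$; order comparisons are those of $\mathbb Z$ and are false when a non-numerical constant is involved. Let $IC$ be a finite set of 1ADs. A fix of an instance $D\models\mathcal K$ is an instance $D'\models\mathcal K\cup IC$ that has the same values as $D$ in all rigid attributes (so the tuples of $D$ and $D'$ correspond to each other through their key values). An LS-fix of $D$ is a fix $D'$ that minimizes, among all fixes of $D$, the square distance $$\Delta(D,D')=\sum_{R}\ \sum_{\bar k}\ \sum_{A}\bigl(\pi_A(\bar t(\bar k,R,D))-\pi_A(\bar t(\bar k,R,D'))\bigr)^2,$$ where $\bar k$ ranges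 over the key values of $R$ in $D$, $A$ over the fixable attributes of $R$, $\bar t(\bar k,R,D)$ is the tuple of $R$ in $D$ with key value $\bar k$, and $\pi_A$ is the projection on attribute $A$. Let $Q(\bar x)$ be a (non-aggregate) conjunctive query: a conjunction of database atoms and of built-in atoms $x\,\theta\,c$ as above, in which every free variable and every variable of a built-in atom occurs in some database atom, and whose remaining variables are existentially quantified. The join graph of $Q$ has the database atoms of $Q$ as vertices, an arc from $L$ to $L'\neq L$ if some variable occurs at a non-key position of $L$ and also occurs in $L'$, and a self-loop at $L$ if some variable occurs at a non-key position of $L$ and at least twice in $L$. The query $Q$ is in $\mathcal C_{Tree}$ if (i) no relation name occurs twice in $Q$; (ii) its join graph is a forest, i.e. it has no directed cycles (self-loops included) and no vertex has two parents; and (iii) every non-key to key join is full: if $L\neq L'$ and some variable occurs at a non-key position of $L$ and at a key position of $L'$, then every variable at a key position of $L'$ occurs at a non-key position of $L$. **Theorem.** For every fixed schema, every fixed finite set $IC$ of 1ADs and every fixed query $Q(\bar x)\in\mathcal C_{Tree}$, consistent query answering under LS-fixes is in PTIME in data complexity, with numbers written in binary: each of the following decision problems on inputs $(D,\bar c)$,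 where $D$ is a finite set of database tuples and $\bar c$ is a tuple of constants of the length of $\bar x$, is decided by a deterministic (multi-stack) Turing machine in time polynomial in the length of the input. 1. (Skeptical semantics) $D$ is an instance with $D\models\mathcal K$, and $D'\models Q(\bar c)$ for every LS-fix $D'$ of $D$ with respect to $IC$. 2. (Brave semantics) $D$ is an instance with $D\models\mathcal K$, and $D'\models Q(\bar c)$ for some LS-fix $D'$ of $D$ with respect to $IC$. -/

import Mathlib

namespace LSFix

/-! ### Schemas and instances -/

/-- Constants of the domain: the integers, together with non-numerical constants, which are
finite words over a binary alphabet. -/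
inductive Const where
  | num (z : ℤ)
  | sym (w : List Bool)
deriving DecidableEq

/-- The integer value of a numerical constant (only used for numerical constants). -/
def Const.val : Const → ℤ
  | .num z => z
  | .sym _ => 0

/-- A relational schema: finitely many relation names, each with an arity, a primary key and a set
of fixable attributes. Attributes are argument positions; key attributes are not fixable. -/
structure Schema where
  Rel : Type
  [relFintype : Fintype Rel]
  [relDecEq : DecidableEq Rel]
  arity : Rel → ℕ
  key : (R : Rel) → Finset (Fin (arity R))
  fixable : (R : Rel) → Finset (Fin (arity R))
  key_disjoint_fixable : ∀ R, Disjoint (key R) (fixable R)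

attribute [instance] Schema.relFintype Schema.relDecEq

variable {S : Schema}

/-- Tuples of constants of the arity of `R`. -/
abbrev Tuple (S : Schema) (R : S.Rel) : Type := Fin (S.arity R) → Const

/-- Database tuples `R(c₁, …, cₙ)`. -/
abbrev Fact (S : Schema) : Type := (R : S.Rel) × Tuple S R

/-- A finite collection of database tuples. -/
abbrev Instance (S : Schema) : Type := Finset (Fact S)

/-- The relation `R` of the instance `D`. -/
noncomputable def tuples (D : Instance S) (R : S.Rel) : Finset (Tuple S R) :=
  D.preimage (Sigma.mk R) sigma_mk_injective.injOn

/-- The key value of a tuple. -/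
def keyOf {R : S.Rel} (t : Tuple S R) : {i // i ∈ S.key R} → Const := fun i => t i

/-- `D ⊨ 𝒦`: two tuples of the same relation with the same key value are equal. -/
def SatisfiesKeys (D : Instance S) : Prop :=
  ∀ R, ∀ t ∈ tuples D R, ∀ t' ∈ tuples D R, keyOf t = keyOf t' → t = t'

/-- The fixable attributes take integer values. -/
def WellTyped (D : Instance S) : Prop :=
  ∀ R, ∀ t ∈ tuples D R, ∀ i ∈ S.fixable R, ∃ z : ℤ, t i = .num z

/-! ### Square distance -/

/-- The set `val(K_R)` of key values of relation `R` in `D`. -/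
noncomputable def keyVals (D : Instance S) (R : S.Rel) : Finset ({i // i ∈ S.key R} → Const) :=
  (tuples D R).image keyOf

open Classical in
/-- The tuple of relation `R` in `D` with key value `k` (with a default value if there is none). -/
noncomputable def tupleAt (D : Instance S) (R : S.Rel) (k : {i // i ∈ S.key R} → Const) :
    Tuple S R :=
  if h : ∃ t ∈ tuples D R, keyOf t = k then h.choose else fun _ => .num 0

/-- The square distance `Δ(D, D')`, for instances with the same key values; all weights are `1`. -/
noncomputable def sqDist (D D' : Instance S) : ℤ :=
  ∑ R : S.Rel, ∑ k ∈ keyVals D R, ∑ i ∈ S.fixable R,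
    ((tupleAt D R k i).val - (tupleAt D' R k i).val) ^ 2

/-! ### Built-in atoms and one database atom denials -/

/-- Comparison predicates. -/
inductive CmpOp where
  | eq | ne | lt | gt | le | ge

/-- Truth of `a θ b`. The order comparisons are those of the integers and hold between integers
only. -/
def CmpOp.Holds : CmpOp → Const → Const → Prop
  | .eq, a, b => a = b
  | .ne, a, b => a ≠ b
  | .lt, .num m, .num n => m < n
  | .gt, .num m, .num n => m > n
  | .le, .num m, .num n => m ≤ n
  | .ge, .num m, .num n => m ≥ n
  | _, _, _ => False

/-- A built-in atom `x θ c` with a variable `x` and a constant `c`. -/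
structure Comparison where
  x : ℕ
  op : CmpOp
  c : Const

/-- Truth of `x θ c` under an assignment of constants to the variables. -/
def Comparison.Holds (a : Comparison) (ν : ℕ → Const) : Prop := a.op.Holds (ν a.x) a.c

/-- Built-in atoms of (extended) linear denials: `x θ c`, `x = y` and `x ≠ y`. -/
inductive BuiltIn where
  | cmp (a : Comparison)
  | eq (x y : ℕ)
  | ne (x y : ℕ)

/-- Truth of a built-in atom under an assignment. -/
def BuiltIn.Holds (ν : ℕ → Const) : BuiltIn → Prop
  | .cmp a => a.Holds ν
  | .eq x y => ν x = ν y
  | .ne x y => ν x ≠ ν y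

/-- The variables of a built-in atom. -/
def BuiltIn.vars : BuiltIn → Set ℕ
  | .cmp a => {a.x}
  | .eq x y => {x, y}
  | .ne x y => {x, y}

/-- Terms: variables and constants. -/
inductive Term where
  | var (x : ℕ)
  | const (c : Const)

/-- The value of a term under an assignment. -/
def Term.eval (ν : ℕ → Const) : Term → Const
  | .var x => ν x
  | .const c => c

/-- Database atoms. -/
structure Atom (S : Schema) where
  rel : S.Rel
  args : Fin (S.arity rel) → Term

/-- The database tuple obtained from an atom under an assignment. -/
def Atom.ground (L : Atom S) (ν : ℕ → Const) : Fact S := ⟨L.rel, fun i => (L.args i).eval ν⟩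

/-- The variables that occur in the atom. -/
def Atom.vars (L : Atom S) : Set ℕ := {w | ∃ i, L.args i = .var w}

/-- The variables that occur at the position of a key attribute. -/
def Atom.keyVars (L : Atom S) : Set ℕ := {w | ∃ i ∈ S.key L.rel, L.args i = .var w}

/-- The variables that occur at the position of a non-key attribute. -/
def Atom.nonKeyVars (L : Atom S) : Set ℕ := {w | ∃ i ∉ S.key L.rel, L.args i = .var w}

/-- One database atom denials `∀ x̄ ¬ (A ∧ B)`, with a database atom `A` and a conjunction `B` of
built-in atoms whose variables occur in `A`. -/
structure OneAtomDenial (S : Schema) where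
  atom : Atom S
  builtIns : List BuiltIn
  safe : ∀ b ∈ builtIns, b.vars ⊆ atom.vars

/-- `D` satisfies the denial. -/
def OneAtomDenial.Sat (ic : OneAtomDenial S) (D : Instance S) : Prop :=
  ∀ ν : ℕ → Const, ¬ (ic.atom.ground ν ∈ D ∧ ∀ b ∈ ic.builtIns, b.Holds ν)

/-! ### Fixes and least squares fixes -/

/-- The two tuples have the same values in the rigid attributes. -/
def RigidEq {R : S.Rel} (t t' : Tuple S R) : Prop := ∀ i ∉ S.fixable R, t i = t' i

/-- `D'` is a fix for `D` with respect to `IC`. -/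
structure IsFix (IC : Finset (OneAtomDenial S)) (D D' : Instance S) : Prop where
  wellTyped : WellTyped D'
  rigid : ∀ R, ∀ t ∈ tuples D R, ∃ t' ∈ tuples D' R, RigidEq t t'
  rigid' : ∀ R, ∀ t' ∈ tuples D' R, ∃ t ∈ tuples D R, RigidEq t t'
  keys : SatisfiesKeys D'
  denials : ∀ ic ∈ IC, ic.Sat D'

/-- `D'` is a least squares fix for `D` with respect to `IC`. -/
structure IsLSFix (IC : Finset (OneAtomDenial S)) (D D' : Instance S) : Prop where
  isFix : IsFix IC D D'
  minimal : ∀ D'', IsFix IC D D'' → sqDist D D' ≤ sqDist D D''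

/-! ### Conjunctive queries and the class `C_Tree` -/

/-- Conjunctive queries `q(x₁, …, xₘ) ← A₁, …, Aₙ, B` with database atoms `Aᵢ` and a conjunction
`B` of built-in atoms `x θ c`; the variables of the head and of `B` occur in the `Aᵢ`. -/
structure Query (S : Schema) where
  numFree : ℕ
  head : Fin numFree → ℕ
  atoms : List (Atom S)
  builtIns : List Comparison
  head_safe : ∀ i, ∃ L ∈ atoms, head i ∈ L.vars
  builtIns_safe : ∀ a ∈ builtIns, ∃ L ∈ atoms, a.x ∈ L.vars

namespace Query

/-- `D ⊨ Q(c̄)`. -/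
def Sat (Q : Query S) (D : Instance S) (c : Fin Q.numFree → Const) : Prop :=
  ∃ ν : ℕ → Const, (∀ i, ν (Q.head i) = c i) ∧ (∀ L ∈ Q.atoms, L.ground ν ∈ D) ∧
    ∀ a ∈ Q.builtIns, a.Holds ν

/-- No relation symbol is repeated. -/
def NoRepeatedRel (Q : Query S) : Prop := (Q.atoms.map Atom.rel).Nodup

/-- The arcs of the join graph: from `L` to `L' ≠ L` if some variable occurs at a non-key position
of `L` and occurs in `L'`; a self-loop at `L` if some variable occurs at a non-key position of `L`
and at least twice in `L`. -/
def JoinArc (Q : Query S) (L L' : Atom S) : Prop :=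
  L ∈ Q.atoms ∧ L' ∈ Q.atoms ∧
    ((L ≠ L' ∧ ∃ w, w ∈ L.nonKeyVars ∧ w ∈ L'.vars) ∨
     (L = L' ∧ ∃ w, ∃ i j, i ∉ S.key L.rel ∧ i ≠ j ∧ L.args i = .var w ∧ L.args j = .var w))

/-- The join graph is a (directed) forest: it has no directed cycles, self-loops included, and no
vertex has two parents. -/
def IsForest (Q : Query S) : Prop :=
  (∀ L, ¬ Relation.TransGen Q.JoinArc L L) ∧
    ∀ L₁ L₂ L, Q.JoinArc L₁ L → Q.JoinArc L₂ L → L₁ = L₂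

/-- Every non-key to key join is full: if a variable at a non-key position of `L` occurs in the key
of `L' ≠ L`, then so do all variables in the key of `L'`. -/
def FullJoins (Q : Query S) : Prop :=
  ∀ L ∈ Q.atoms, ∀ L' ∈ Q.atoms, L ≠ L' →
    (∃ w, w ∈ L.nonKeyVars ∧ w ∈ L'.keyVars) → L'.keyVars ⊆ L.nonKeyVars

/-- The class `C_Tree`. -/
structure InCTree (Q : Query S) : Prop where
  noRepeatedRel : Q.NoRepeatedRel
  forest : Q.IsForest
  full : Q.FullJoins

end Query

/-! ### Consistent query answering -/

inductive Semantics where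
  | skeptical
  | brave

/-- `c̄` is a consistent answer to `Q` in `D` with respect to `IC`. -/
def ConsistentAnswer (Q : Query S) (IC : Finset (OneAtomDenial S)) (D : Instance S)
    (c : Fin Q.numFree → Const) : Semantics → Prop
  | .skeptical => ∀ D', IsLSFix IC D D' → Q.Sat D' c
  | .brave => ∃ D', IsLSFix IC D D' ∧ Q.Sat D' c

/-- Inputs of the decision problem: a list of database tuples that presents an instance, and a
tuple of constants. -/
abbrev Input (Q : Query S) : Type := List (Fact S) × (Fin Q.numFree → Const)

/-- The decision problem of consistent query answering, for instances that satisfy the key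
constraints. -/
def CQA (Q : Query S) (IC : Finset (OneAtomDenial S)) (𝒮 : Semantics) : Set (Input Q) :=
  {p | WellTyped p.1.toFinset ∧ SatisfiesKeys p.1.toFinset ∧
    ConsistentAnswer Q IC p.1.toFinset p.2 𝒮}

/-! ### Encoding of inputs and polynomial time -/

/-- The input alphabet: a letter for each relation name, marking the start of a database tuple,
letters that mark the start of an integer (with its sign), of a non-numerical constant, and of the
candidate answer, and the bits. -/
inductive Letter (S : Schema) where
  | rel (R : S.Rel)
  | int (negative : Bool)
  | sym
  | answer
  | bit (b : Bool)

/-- Integers are given by sign and binary representation of the absolute value. -/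
def encodeConst : Const → List (Letter S)
  | .num z => .int (decide (z < 0)) :: z.natAbs.bits.map .bit
  | .sym w => .sym :: w.map .bit

def encodeTuple {n : ℕ} (t : Fin n → Const) : List (Letter S) :=
  (List.ofFn t).flatMap encodeConst

def encodeFact (f : Fact S) : List (Letter S) := .rel f.1 :: encodeTuple f.2

def encodeInput (Q : Query S) (p : Input Q) : List (Letter S) :=
  p.1.flatMap encodeFact ++ .answer :: encodeTuple p.2

/-- The decision problem `P`, whose inputs are presented as words by `enc`, is decided by a
multi-stack Turing machine in time polynomial in the length of the word. -/
def InPTIME {α Γ : Type} (enc : α → List Γ) (P : Set α) : Prop :=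
  ∃ f : α → Bool, (∀ a, f a = true ↔ a ∈ P) ∧
    Nonempty (Turing.TM2ComputableInPolyTime enc (fun b : Bool => [b]) f)

end LSFix

/-!
Denials concern single database tuples and the square distance is a sum over them, so a least
squares fix is nothing but an independent choice, for each database tuple, of an optimal
replacement (`isLSFix_iff`, where the key constraints are used). The denials cannot distinguish
two integers that are on the same side of all the constants that occur in them, as long as
equalities are respected. Hence a value of an optimal replacement is an original value of the
tuple, or close to a constant of the denials, or close to the average of the original values of
the positions at which it is placed: otherwise all its occurrences could be moved to an unused
value nearer to the average (`IsOptFix.value`). This leaves a number of candidates that depends on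
the schema and on the denials only, and they are computed by arithmetic on the original values
(`exists_candidates`).

For the brave semantics, no relation name is repeated in the query, so the atoms are matched by
different database tuples whose replacements can be chosen freely. It suffices to try all choices
of a database tuple and of one of its optimal replacements for each atom (`brave_iff`).

For the skeptical semantics, call a database tuple good for an atom `L` of the query if each of
its optimal replacements matches `L` and assigns to the keys of the children of `L` in the join
graph values that occur as keys of good tuples for these children. As joins from non-key positions
are full, the key of a child is determined by the parent. As the join graph is a forest, the
recursion terminates, and no variable occurs at non-key positions of two atoms. The answer holds
in all least squares fixes if and only if, unless there is no such fix, there are good tuples for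
all atoms with compatible keys (`skeptical_iff`): given a fix, the tuples and the variables are
chosen from the roots to the leaves of the forest; conversely, in a fix where each tuple that is
not good is replaced by a counterexample only good tuples contribute to an answer.

Polynomial time is established by closure properties. Programs with loops on stacks are compiled
to stack machines with the same number of steps (`Run.stepsTo`). They operate on binary trees, and
`PTF f` says that the function `f` between types with a representation by trees is computed by
such a program in polynomial time. This class contains the binary arithmetic of integers, and is
closed under composition, iteration as long as the results stay of polynomial size, and
quantification over lists and over a fixed number of cases; a decoder that reads the input from the right makes the connection with words
(`inPTIME_of_ptf`).
-/

namespace LSFix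

open Turing

/-! ### Structured stack programs and their compilation to Turing machines -/

/-- The stacks of the programs: input and output, the main data stack, and three auxiliary
stacks. -/
inductive Stk where
  | inp | out | main | aux | cnt | loop
deriving DecidableEq

instance : Fintype Stk :=
  ⟨{.inp, .out, .main, .aux, .cnt, .loop}, fun k => by cases k <;> decide⟩

/-- The alphabets of the stacks: input letters, output bits, and `Option Bool` for the others, where
`none` serves as a bottom marker. -/
abbrev Alph (A : Type) : Stk → Type
  | .inp => A
  | .out => Bool
  | _ => Option Bool

/-- The contents of all stacks. -/
abbrev Store (A : Type) : Type := ∀ k, List (Alph A k)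

/-- Structured programs on stacks. Tests inspect the top of a stack. -/
inductive Prog (A : Type) where
  | push (k : Stk) (a : Alph A k)
  | pop (k : Stk)
  | seq (p q : Prog A)
  | ite (k : Stk) (c : Option (Alph A k) → Bool) (p q : Prog A)
  | loop (k : Stk) (c : Option (Alph A k) → Bool) (p : Prog A)

variable {A : Type}

/-- `Run p s s' t`: the program `p`, started in the store `s`, stops in the store `s'` after exactly
`t` machine steps. -/
inductive Run : Prog A → Store A → Store A → ℕ → Prop
  | push (k a s) : Run (.push k a) s (Function.update s k (a :: s k)) 1
  | pop (k s) : Run (.pop k) s (Function.update s k (s k).tail) 1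
  | seq {p q s s' s'' t t'} : Run p s s' t → Run q s' s'' t' → Run (.seq p q) s s'' (t + t')
  | iteTrue {k c p q s s' t} : c (s k).head? = true → Run p s s' t →
      Run (.ite k c p q) s s' (1 + t)
  | iteFalse {k c p q s s' t} : c (s k).head? = false → Run q s s' t →
      Run (.ite k c p q) s s' (1 + t)
  | loopFalse {k c p s} : c (s k).head? = false → Run (.loop k c p) s s 1
  | loopTrue {k c p s s' s'' t t'} : c (s k).head? = true → Run p s s' t →
      Run (.loop k c p) s' s'' t' → Run (.loop k c p) s s'' (1 + t + t')

namespace Prog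

/-- The program points of a program. -/
def Lab : Prog A → Type
  | push _ _ => Unit
  | pop _ => Unit
  | seq p q => Lab p ⊕ Lab q
  | ite _ _ p q => Option (Lab p ⊕ Lab q)
  | loop _ _ p => Option (Lab p)

instance finite_lab : (p : Prog A) → Finite (Lab p)
  | push _ _ => inferInstanceAs (Finite Unit)
  | pop _ => inferInstanceAs (Finite Unit)
  | seq p q => have := finite_lab p; have := finite_lab q; inferInstanceAs (Finite (Lab p ⊕ Lab q))
  | ite _ _ p q =>
    have := finite_lab p; have := finite_lab q
    inferInstanceAs (Finite (Option (Lab p ⊕ Lab q)))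
  | loop _ _ p => have := finite_lab p; inferInstanceAs (Finite (Option (Lab p)))

/-- The program point at which the execution starts. -/
def entry : (p : Prog A) → Lab p
  | push _ _ => ()
  | pop _ => ()
  | seq p _ => Sum.inl (entry p)
  | ite _ _ _ _ => none
  | loop _ _ _ => none

/-- Stack machine code of a program inside a machine with labels `Λ`, where `ι` embeds the program
points and `e` is the label at which the execution continues after the program. -/
def code {Λ : Type} : (p : Prog A) → (Lab p → Λ) → Λ → Lab p → TM2.Stmt (Alph A) Λ Bool
  | push k a, _, e, _ => .push k (fun _ => a) (.goto fun _ => e)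
  | pop k, _, e, _ => .pop k (fun v _ => v) (.goto fun _ => e)
  | seq p q, ι, e, l => match l with
    | Sum.inl l => code p (fun x => ι (Sum.inl x)) (ι (Sum.inr (entry q))) l
    | Sum.inr l => code q (fun x => ι (Sum.inr x)) e l
  | ite k c p q, ι, e, l => match l with
    | none => .peek k (fun _ o => c o) (.goto fun v =>
        bif v then ι (some (Sum.inl (entry p))) else ι (some (Sum.inr (entry q))))
    | some (Sum.inl l) => code p (fun x => ι (some (Sum.inl x))) e l
    | some (Sum.inr l) => code q (fun x => ι (some (Sum.inr x))) e l
  | loop k c p, ι, e, l => match l with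
    | none => .peek k (fun _ o => c o) (.goto fun v => bif v then ι (some (entry p)) else e)
    | some l => code p (fun x => ι (some x)) (ι none) l

end Prog

/-- The machine `M` gets from one configuration to the other in exactly `t` steps. -/
def StepsTo {Λ : Type} (M : Λ → TM2.Stmt (Alph A) Λ Bool) (c c' : TM2.Cfg (Alph A) Λ Bool)
    (t : ℕ) : Prop :=
  (flip bind (TM2.step M))^[t] (some c) = some c'

theorem StepsTo.trans {Λ : Type} {M : Λ → TM2.Stmt (Alph A) Λ Bool}
    {c c' c'' : TM2.Cfg (Alph A) Λ Bool} {t t' : ℕ} (h : StepsTo M c c' t)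
    (h' : StepsTo M c' c'' t') : StepsTo M c c'' (t + t') := by
  unfold StepsTo at *
  rw [add_comm, Function.iterate_add_apply, h, h']

theorem StepsTo.one {Λ : Type} {M : Λ → TM2.Stmt (Alph A) Λ Bool}
    {c c' : TM2.Cfg (Alph A) Λ Bool} (h : TM2.step M c = some c') : StepsTo M c c' 1 := h

/-- The compiled code simulates the program in the same number of steps. -/
theorem Run.stepsTo {p : Prog A} {s s' : Store A} {t : ℕ} (h : Run p s s' t) :
    ∀ {Λ : Type} (M : Λ → TM2.Stmt (Alph A) Λ Bool) (ι : p.Lab → Λ) (e : Λ),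
      (∀ l, M (ι l) = p.code ι e l) → ∀ v, ∃ v',
        StepsTo M ⟨some (ι p.entry), v, s⟩ ⟨some e, v', s'⟩ t := by
  induction h with
  | push k a s =>
    intro Λ M ι e hM v
    exact ⟨v, .one (by rw [TM2.step, hM]; rfl)⟩
  | pop k s =>
    intro Λ M ι e hM v
    exact ⟨v, .one (by rw [TM2.step, hM]; rfl)⟩
  | seq _ _ ih₁ ih₂ =>
    intro Λ M ι e hM v
    obtain ⟨v₁, h₁⟩ := ih₁ M (fun x => ι (Sum.inl x)) _ (fun l => hM (Sum.inl l)) v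
    obtain ⟨v₂, h₂⟩ := ih₂ M (fun x => ι (Sum.inr x)) _ (fun l => hM (Sum.inr l)) v₁
    exact ⟨v₂, h₁.trans h₂⟩
  | iteTrue hc _ ih =>
    intro Λ M ι e hM v
    obtain ⟨v₁, h₁⟩ := ih M (fun x => ι (some (Sum.inl x))) e (fun l => hM (some (Sum.inl l))) true
    exact ⟨v₁, StepsTo.trans (.one (by
      rw [TM2.step, hM]; simp [Prog.code, Prog.entry, hc])) h₁⟩
  | iteFalse hc _ ih =>
    intro Λ M ι e hM v
    obtain ⟨v₁, h₁⟩ := ih M (fun x => ι (some (Sum.inr x))) e (fun l => hM (some (Sum.inr l))) false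
    exact ⟨v₁, StepsTo.trans (.one (by
      rw [TM2.step, hM]; simp [Prog.code, Prog.entry, hc])) h₁⟩
  | loopFalse hc =>
    intro Λ M ι e hM v
    exact ⟨false, .one (by rw [TM2.step, hM]; simp [Prog.code, Prog.entry, hc])⟩
  | loopTrue hc _ _ ih₁ ih₂ =>
    intro Λ M ι e hM v
    obtain ⟨v₁, h₁⟩ := ih₁ M (fun x => ι (some x)) _ (fun l => hM (some l)) true
    obtain ⟨v₂, h₂⟩ := ih₂ M ι e hM v₁
    exact ⟨v₂, StepsTo.trans (StepsTo.trans (.one (by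
      rw [TM2.step, hM]; simp [Prog.code, Prog.entry, hc])) h₁) h₂⟩

/-- Each step pushes at most one symbol. -/
theorem Run.length_le {p : Prog A} {s s' : Store A} {t : ℕ} (h : Run p s s' t) (k : Stk) :
    (s' k).length ≤ (s k).length + t := by
  induction h with
  | push j a s =>
    by_cases hk : k = j
    · subst hk; simp
    · simp [Function.update_of_ne hk]
  | pop j s =>
    by_cases hk : k = j
    · subst hk; simp; omega
    · simp [Function.update_of_ne hk]
  | _ => omega

/-- The stack machine of a program: after the program it halts in its initial state. -/
noncomputable def Prog.machine [Fintype A] (p : Prog A) : FinTM2 where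
  K := Stk
  k₀ := .inp
  k₁ := .out
  Γ := Alph A
  Λ := Option p.Lab
  main := some p.entry
  ΛFin := Fintype.ofFinite _
  σ := Bool
  initialState := false
  Γk₀Fin := inferInstanceAs (Fintype A)
  m
    | none => .load (fun _ => false) .halt
    | some l => p.code some none l

/-- The store with the given input and output, all other stacks being empty. -/
def ioStore (i : List A) (o : List Bool) : Store A
  | .inp => i
  | .out => o
  | .main | .aux | .cnt | .loop => []

/-- A program that decides a set of words in polynomial time yields a Turing machine that does. -/
theorem inPTIME_of_prog {α : Type} [Fintype A] (enc : α → List A) (P : Set α) (p : Prog A)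
    (b : Polynomial ℕ) (f : α → Bool) (hf : ∀ a, f a = true ↔ a ∈ P)
    (h : ∀ a, ∃ t ≤ b.eval (enc a).length,
      Run p (ioStore (enc a) []) (ioStore [] [f a]) t) : InPTIME enc P := by
  classical
  refine ⟨f, hf, ⟨{
    tm := p.machine
    inputAlphabet := Equiv.refl _
    outputAlphabet := Equiv.refl _
    time := b + 1
    outputsFun := fun a => ?_ }⟩⟩
  have h₀ : ∃ t ≤ b.eval (enc a).length, StepsTo p.machine.m
      ⟨some (some p.entry), false, ioStore (enc a) []⟩ ⟨none, false, ioStore [] [f a]⟩ (t + 1) := by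
    obtain ⟨t, ht, hr⟩ := h a
    obtain ⟨v, hv⟩ := hr.stepsTo p.machine.m some none (fun l => rfl) false
    exact ⟨t, ht, hv.trans (.one rfl)⟩
  have hi : initList p.machine (List.map (Equiv.refl A).invFun (enc a)) =
      ⟨some (some p.entry), false, ioStore (enc a) []⟩ := by
    unfold initList
    congr 1
    funext k
    cases k
    · exact (List.map_id _)
    all_goals rfl
  have ho : haltList p.machine (List.map (Equiv.refl Bool).invFun [f a]) =
      ⟨none, false, ioStore [] [f a]⟩ := by
    unfold haltList
    congr 1
    funext k
    cases k <;> rfl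
  refine ⟨⟨h₀.choose + 1, ?_⟩, ?_⟩
  · have := h₀.choose_spec.2
    unfold StepsTo at this
    refine Eq.trans ?_ (this.trans ?_)
    · exact congrArg _ (congrArg some hi)
    · exact congrArg some ho.symm
  · simpa using h₀.choose_spec.1

end LSFix

namespace LSFix

/-! ### Binary trees on the main stack -/

/-- Binary trees, the universal data type of the programs. -/
inductive T where
  | nil
  | node (x y : T)
deriving DecidableEq

/-- Polish notation of a tree. -/
def T.word : T → List Bool
  | .nil => [false]
  | .node x y => true :: (x.word ++ y.word)

/-- The tree as it is kept on a stack. -/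
def T.cells (x : T) : List (Option Bool) := x.word.map some

/-- The number of nodes and leaves. -/
def T.size : T → ℕ
  | .nil => 1
  | .node x y => x.size + y.size + 1

@[simp] theorem T.size_nil : T.nil.size = 1 := rfl

@[simp] theorem T.size_node (x y : T) : (T.node x y).size = x.size + y.size + 1 := rfl

@[simp] theorem T.cells_nil : T.nil.cells = [some false] := rfl

@[simp] theorem T.cells_node (x y : T) :
    (T.node x y).cells = some true :: (x.cells ++ y.cells) := by
  simp [T.cells, T.word]

@[simp] theorem T.length_word (x : T) : x.word.length = x.size := by
  induction x with
  | nil => rfl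
  | node x y hx hy => simp [T.word, hx, hy]

@[simp] theorem T.length_cells (x : T) : x.cells.length = x.size := by
  simp [T.cells]

theorem T.size_pos (x : T) : 0 < x.size := by cases x <;> simp

theorem polynomial_eval_mono (b : Polynomial ℕ) : Monotone fun n : ℕ => b.eval n := by
  intro m n h
  induction b using Polynomial.induction_on' with
  | add p q hp hq => simpa using add_le_add hp hq
  | monomial k a => simpa using Nat.mul_le_mul_left _ (Nat.pow_le_pow_left h k)

variable {A : Type}

/-- A store, given by the contents of its stacks. -/
def st (i : List A) (o : List Bool) (m x c l : List (Option Bool)) : Store A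
  | .inp => i
  | .out => o
  | .main => m
  | .aux => x
  | .cnt => c
  | .loop => l

section st

variable (i : List A) (o : List Bool) (m x c l : List (Option Bool))

@[simp] theorem update_st_inp (y) :
    Function.update (st i o m x c l) .inp y = st y o m x c l := by
  funext k; cases k <;> rfl

@[simp] theorem update_st_out (y) :
    Function.update (st i o m x c l) .out y = st i y m x c l := by
  funext k; cases k <;> rfl

@[simp] theorem update_st_main (y) :
    Function.update (st i o m x c l) .main y = st i o y x c l := by
  funext k; cases k <;> rfl

@[simp] theorem update_st_aux (y) :
    Function.update (st i o m x c l) .aux y = st i o m y c l := by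
  funext k; cases k <;> rfl

@[simp] theorem update_st_cnt (y) :
    Function.update (st i o m x c l) .cnt y = st i o m x y l := by
  funext k; cases k <;> rfl

@[simp] theorem update_st_loop (y) :
    Function.update (st i o m x c l) .loop y = st i o m x c y := by
  funext k; cases k <;> rfl

end st

/-- Execution in at most `n` steps. -/
def RunLe (p : Prog A) (s s' : Store A) (n : ℕ) : Prop := ∃ t ≤ n, Run p s s' t

namespace RunLe

theorem mono {p : Prog A} {s s' : Store A} {n n' : ℕ} (h : RunLe p s s' n) (hn : n ≤ n') :
    RunLe p s s' n' :=
  h.imp fun _ ht => ⟨ht.1.trans hn, ht.2⟩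

theorem push {s s' : Store A} (k a) (h : Function.update s k (a :: s k) = s') :
    RunLe (.push k a) s s' 1 := ⟨1, le_rfl, h ▸ .push k a s⟩

theorem pop {s s' : Store A} (k) (h : Function.update s k (s k).tail = s') :
    RunLe (.pop k) s s' 1 := ⟨1, le_rfl, h ▸ .pop k s⟩

theorem seq {p q : Prog A} {s s' s'' : Store A} {n n' : ℕ} (h : RunLe p s s' n)
    (h' : RunLe q s' s'' n') : RunLe (.seq p q) s s'' (n + n') := by
  obtain ⟨t, ht, h⟩ := h
  obtain ⟨t', ht', h'⟩ := h'
  exact ⟨t + t', by omega, .seq h h'⟩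

theorem iteTrue {k c} {p q : Prog A} {s s' : Store A} {n : ℕ} (hc : c (s k).head? = true)
    (h : RunLe p s s' n) : RunLe (.ite k c p q) s s' (1 + n) := by
  obtain ⟨t, ht, h⟩ := h
  exact ⟨1 + t, by omega, .iteTrue hc h⟩

theorem iteFalse {k c} {p q : Prog A} {s s' : Store A} {n : ℕ} (hc : c (s k).head? = false)
    (h : RunLe q s s' n) : RunLe (.ite k c p q) s s' (1 + n) := by
  obtain ⟨t, ht, h⟩ := h
  exact ⟨1 + t, by omega, .iteFalse hc h⟩

theorem loopFalse {k c} {p : Prog A} {s : Store A} (hc : c (s k).head? = false) :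
    RunLe (.loop k c p) s s 1 := ⟨1, le_rfl, .loopFalse hc⟩

theorem loopTrue {k c} {p : Prog A} {s s' s'' : Store A} {n n' : ℕ}
    (hc : c (s k).head? = true) (h : RunLe p s s' n) (h' : RunLe (.loop k c p) s' s'' n') :
    RunLe (.loop k c p) s s'' (1 + n + n') := by
  obtain ⟨t, ht, h⟩ := h
  obtain ⟨t', ht', h'⟩ := h'
  exact ⟨1 + t + t', by omega, .loopTrue hc h h'⟩

end RunLe

section st

variable {i : List A} {o : List Bool} {m x c l : List (Option Bool)}

theorem runLe_push_main (b) :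
    RunLe (.push .main b) (st i o m x c l) (st i o (b :: m) x c l) 1 :=
  RunLe.push _ _ (update_st_main ..)

theorem runLe_push_aux (b) :
    RunLe (.push .aux b) (st i o m x c l) (st i o m (b :: x) c l) 1 :=
  RunLe.push _ _ (update_st_aux ..)

theorem runLe_push_cnt (b) :
    RunLe (.push .cnt b) (st i o m x c l) (st i o m x (b :: c) l) 1 :=
  RunLe.push _ _ (update_st_cnt ..)

theorem runLe_push_loop (b) :
    RunLe (.push .loop b) (st i o m x c l) (st i o m x c (b :: l)) 1 :=
  RunLe.push _ _ (update_st_loop ..)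

theorem runLe_pop_main {b} :
    RunLe (.pop .main) (st i o (b :: m) x c l) (st i o m x c l) 1 :=
  RunLe.pop _ (update_st_main ..)

theorem runLe_pop_aux {b} :
    RunLe (.pop .aux) (st i o m (b :: x) c l) (st i o m x c l) 1 :=
  RunLe.pop _ (update_st_aux ..)

theorem runLe_pop_cnt {b} :
    RunLe (.pop .cnt) (st i o m x (b :: c) l) (st i o m x c l) 1 :=
  RunLe.pop _ (update_st_cnt ..)

theorem runLe_pop_loop {b} :
    RunLe (.pop .loop) (st i o m x c (b :: l)) (st i o m x c l) 1 :=
  RunLe.pop _ (update_st_loop ..)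

end st

namespace Prog

/-- One step of `mv`: the next symbol of the tree on top of the main stack is moved to the stack
`aux`, and the number of pending subtrees on the stack `cnt` is adjusted. -/
def mvStep : Prog A :=
  .seq (.ite .main (fun o => o = some (some true))
    (.seq (.push .aux (some true)) (.push .cnt (some true)))
    (.seq (.push .aux (some false)) (.pop .cnt))) (.pop .main)

/-- Moves the tree on top of the main stack to the stack `aux`, in reverse. -/
def mv : Prog A :=
  .seq (.push .cnt (some true)) (.loop .cnt (fun o => o.isSome) mvStep)

/-- Empties the stack `aux` while running `p` for each symbol `true` and `q` for each symbol
`false`. -/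
def drain (p q : Prog A) : Prog A :=
  .loop .aux (fun o => o.isSome)
    (.seq (.ite .aux (fun o => o = some (some true)) p q) (.pop .aux))

/-- Empties the stack `aux`. -/
def clear : Prog A := .loop .aux (fun o => o.isSome) (.pop .aux)

/-- Removes the tree on top of the main stack. -/
def discard : Prog A := .seq mv clear

/-- Copies the tree on top of the main stack to the stack `loop`, above a marker. -/
def save : Prog A :=
  .seq mv (.seq (.push .loop none) (drain
    (.seq (.push .main (some true)) (.push .loop (some true)))
    (.seq (.push .main (some false)) (.push .loop (some false)))))

/-- Moves the tree on top of the main stack to the stack `loop`, above a marker. -/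
def stash : Prog A :=
  .seq mv (.seq (.push .loop none) (drain (.push .loop (some true)) (.push .loop (some false))))

/-- Moves the tree on top of the stack `loop` to the main stack, and removes the marker. -/
def restore : Prog A :=
  .seq (.loop .loop (fun o => o = some (some true) ∨ o = some (some false))
      (.seq (.ite .loop (fun o => o = some (some true))
        (.push .aux (some true)) (.push .aux (some false))) (.pop .loop)))
    (.seq (.pop .loop) (drain (.push .main (some true)) (.push .main (some false))))

/-- Pushes a fixed tree on the main stack. -/
def pushTree : T → Prog A
  | .nil => .push .main (some false)
  | .node x y => .seq (pushTree y) (.seq (pushTree x) (.push .main (some true)))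

end Prog

section programs

open Prog

variable {i : List A} {o : List Bool} {l : List (Option Bool)}

theorem runLe_mv_loop (x : T) : ∀ {r a c s n},
    RunLe (.loop .cnt (fun o => o.isSome) mvStep) (st i o r (x.cells.reverse ++ a) c l) s n →
    RunLe (.loop .cnt (fun o => o.isSome) mvStep) (st i o (x.cells ++ r) a (some true :: c) l) s
      (n + 5 * x.size) := by
  induction x with
  | nil =>
    intro r a c s n h
    exact RunLe.mono (RunLe.loopTrue rfl (RunLe.seq (RunLe.iteFalse (by simp [st])
      (RunLe.seq (runLe_push_aux _) runLe_pop_cnt)) runLe_pop_main) h) (by simp; omega)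
  | node x y hx hy =>
    intro r a c s n h
    rw [T.cells_node, List.cons_append, List.append_assoc]
    exact RunLe.mono (RunLe.loopTrue rfl (RunLe.seq (RunLe.iteTrue (by simp [st])
      (RunLe.seq (runLe_push_aux _) (runLe_push_cnt _))) runLe_pop_main)
        (hx (hy (n := n) (by simpa using h)))) (by simp; omega)

theorem runLe_mv (x : T) (r) :
    RunLe mv (st i o (x.cells ++ r) [] [] l) (st i o r x.cells.reverse [] l)
      (5 * x.size + 2) := by
  have h : RunLe (.loop .cnt (fun o => o.isSome) mvStep)
      (st i o r (x.cells.reverse ++ []) [] l) (st i o r x.cells.reverse [] l) 1 := by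
    simpa using RunLe.loopFalse (k := .cnt) rfl
  exact RunLe.mono (RunLe.seq (runLe_push_cnt _) (runLe_mv_loop x h)) (by omega)

theorem runLe_drain_main (w : List Bool) : ∀ r,
    RunLe (drain (.push .main (some true)) (.push .main (some false)))
      (st i o r (w.map some) [] l) (st i o (w.reverse.map some ++ r) [] [] l)
      (4 * w.length + 1) := by
  induction w with
  | nil => intro r; exact RunLe.loopFalse rfl
  | cons b w ih =>
    intro r
    rw [show (b :: w).reverse.map some ++ r = w.reverse.map some ++ (some b :: r) by simp]
    refine RunLe.mono (RunLe.loopTrue rfl (RunLe.seq (n := 2) ?_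
      (runLe_pop_aux (b := some b))) (ih _)) (by simp; omega)
    cases b
    · exact RunLe.iteFalse (by simp [st]) (runLe_push_main _)
    · exact RunLe.iteTrue (by simp [st]) (runLe_push_main _)

theorem runLe_drain_loop (w : List Bool) : ∀ r l,
    RunLe (drain (.push .loop (some true)) (.push .loop (some false)))
      (st i o r (w.map some) [] l) (st i o r [] [] (w.reverse.map some ++ l))
      (4 * w.length + 1) := by
  induction w with
  | nil => intro r l; exact RunLe.loopFalse rfl
  | cons b w ih =>
    intro r l
    rw [show (b :: w).reverse.map some ++ l = w.reverse.map some ++ (some b :: l) by simp]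
    refine RunLe.mono (RunLe.loopTrue rfl (RunLe.seq (n := 2) ?_
      (runLe_pop_aux (b := some b))) (ih _ _)) (by simp; omega)
    cases b
    · exact RunLe.iteFalse (by simp [st]) (runLe_push_loop _)
    · exact RunLe.iteTrue (by simp [st]) (runLe_push_loop _)

theorem runLe_drain_both (w : List Bool) : ∀ r l,
    RunLe (drain (.seq (.push .main (some true)) (.push .loop (some true)))
      (.seq (.push .main (some false)) (.push .loop (some false))))
      (st i o r (w.map some) [] l)
      (st i o (w.reverse.map some ++ r) [] [] (w.reverse.map some ++ l))
      (5 * w.length + 1) := by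
  induction w with
  | nil => intro r l; exact RunLe.loopFalse rfl
  | cons b w ih =>
    intro r l
    rw [show (b :: w).reverse.map some ++ r = w.reverse.map some ++ (some b :: r) by simp,
      show (b :: w).reverse.map some ++ l = w.reverse.map some ++ (some b :: l) by simp]
    refine RunLe.mono (RunLe.loopTrue rfl (RunLe.seq (n := 3) ?_
      (runLe_pop_aux (b := some b))) (ih _ _)) (by simp; omega)
    cases b
    · exact RunLe.iteFalse (by simp [st]) (RunLe.seq (runLe_push_main _) (runLe_push_loop _))
    · exact RunLe.iteTrue (by simp [st]) (RunLe.seq (runLe_push_main _) (runLe_push_loop _))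

theorem runLe_clear (w : List (Option Bool)) (r) :
    RunLe clear (st i o r w [] l) (st i o r [] [] l) (2 * w.length + 1) := by
  induction w with
  | nil => exact RunLe.loopFalse rfl
  | cons b w ih => exact RunLe.mono (RunLe.loopTrue rfl runLe_pop_aux ih) (by simp; omega)

theorem runLe_discard (x : T) (r) :
    RunLe discard (st i o (x.cells ++ r) [] [] l) (st i o r [] [] l) (7 * x.size + 3) :=
  RunLe.mono (RunLe.seq (runLe_mv x r) (runLe_clear _ _)) (by simp; omega)

theorem runLe_save (x : T) (r) :
    RunLe save (st i o (x.cells ++ r) [] [] l)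
      (st i o (x.cells ++ r) [] [] (x.cells ++ none :: l)) (10 * x.size + 4) := by
  refine RunLe.mono (RunLe.seq (runLe_mv x r) (RunLe.seq (runLe_push_loop _)
    (n' := 5 * x.size + 1) ?_)) (by omega)
  have h := runLe_drain_both (i := i) (o := o) x.word.reverse r (none :: l)
  simpa [T.cells] using h

theorem runLe_stash (x : T) (r) :
    RunLe stash (st i o (x.cells ++ r) [] [] l)
      (st i o r [] [] (x.cells ++ none :: l)) (9 * x.size + 4) := by
  refine RunLe.mono (RunLe.seq (runLe_mv x r) (RunLe.seq (runLe_push_loop _)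
    (n' := 4 * x.size + 1) ?_)) (by omega)
  have h := runLe_drain_loop (i := i) (o := o) x.word.reverse r (none :: l)
  simpa [T.cells] using h

theorem runLe_restore_loop (w : List Bool) (r) : ∀ a,
    RunLe (.loop .loop (fun o => o = some (some true) ∨ o = some (some false))
      (.seq (.ite .loop (fun o => o = some (some true))
        (.push .aux (some true)) (.push .aux (some false))) (.pop .loop)))
      (st i o r a [] (w.map some ++ none :: l)) (st i o r (w.reverse.map some ++ a) [] (none :: l))
      (4 * w.length + 1) := by
  induction w with
  | nil => intro a; exact RunLe.loopFalse (by simp [st])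
  | cons b w ih =>
    intro a
    rw [show (b :: w).reverse.map some ++ a = w.reverse.map some ++ (some b :: a) by simp]
    refine RunLe.mono (RunLe.loopTrue (by cases b <;> simp [st]) (RunLe.seq (n := 2) ?_
      (runLe_pop_loop (b := some b))) (ih _)) (by simp; omega)
    cases b
    · exact RunLe.iteFalse (by simp [st]) (runLe_push_aux _)
    · exact RunLe.iteTrue (by simp [st]) (runLe_push_aux _)

theorem runLe_restore (x : T) (r) :
    RunLe restore (st i o r [] [] (x.cells ++ none :: l))
      (st i o (x.cells ++ r) [] [] l) (8 * x.size + 3) := by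
  have h := runLe_restore_loop (i := i) (o := o) (l := l) x.word r []
  have h' := runLe_drain_main (i := i) (o := o) (l := l) x.word.reverse r
  simp only [List.append_nil, List.reverse_reverse, List.length_reverse, T.length_word] at h h'
  exact RunLe.mono (RunLe.seq h (RunLe.seq runLe_pop_loop h')) (by omega)

theorem runLe_pushTree (x : T) : ∀ r,
    RunLe (pushTree x) (st i o r [] [] l) (st i o (x.cells ++ r) [] [] l) x.size := by
  induction x with
  | nil => intro r; exact RunLe.push _ _ (update_st_main ..)
  | node x y hx hy =>
    intro r
    rw [T.cells_node, List.cons_append, List.append_assoc]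
    exact RunLe.mono (RunLe.seq (hy r) (RunLe.seq (hx _) (runLe_push_main _))) (by simp; omega)

end programs

/-! ### Polynomial time transformations of trees -/

/-- A program that replaces the tree `u a` on top of the main stack by `v a`, in time
polynomial in the size of `u a`, for all `a`. The stacks `aux` and `cnt` are empty before and after
the execution, and the stack `loop` is left as it was. -/
def PT {α : Type} (u v : α → T) : Prop :=
  ∀ A : Type, ∃ (p : Prog A) (b : Polynomial ℕ), ∀ a i o r l,
    RunLe p (st i o ((u a).cells ++ r) [] [] l) (st i o ((v a).cells ++ r) [] [] l)
      (b.eval (u a).size)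

namespace PT

variable {α β : Type} {u v w : α → T}

theorem size_le (h : PT u v) : ∃ b : Polynomial ℕ, ∀ a, (v a).size ≤ b.eval (u a).size := by
  obtain ⟨p, b, h⟩ := h Unit
  refine ⟨Polynomial.X + b, fun a => ?_⟩
  obtain ⟨t, ht, hr⟩ := h a [] [] [] []
  have := hr.length_le .main
  simp only [st, List.append_nil, T.length_cells] at this
  simp only [Polynomial.eval_add, Polynomial.eval_X]
  omega

theorem refl (u : α → T) : PT u u := by
  intro A
  refine ⟨.seq (.push .loop none) (.pop .loop), 2, fun a i o r l => ?_⟩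
  exact RunLe.mono (RunLe.seq (runLe_push_loop _)
    runLe_pop_loop) (by simp)

theorem trans (h : PT u v) (h' : PT v w) : PT u w := by
  obtain ⟨c, hc⟩ := h.size_le
  intro A
  obtain ⟨p, b, hp⟩ := h A
  obtain ⟨q, b', hq⟩ := h' A
  refine ⟨.seq p q, b + b'.comp c, fun a i o r l => ?_⟩
  refine RunLe.mono (RunLe.seq (hp a i o r l) (hq a i o r l)) ?_
  simpa using polynomial_eval_mono b' (hc a)

theorem comap (h : PT u v) (f : β → α) : PT (fun b => u (f b)) (fun b => v (f b)) := by
  intro A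
  obtain ⟨p, b, hp⟩ := h A
  exact ⟨p, b, fun a => hp (f a)⟩

theorem const (u : α → T) (x : T) : PT u fun _ => x := by
  intro A
  refine ⟨.seq .discard (.pushTree x), 7 * Polynomial.X + Polynomial.C (3 + x.size),
    fun a i o r l => ?_⟩
  exact RunLe.mono (RunLe.seq (runLe_discard _ _) (runLe_pushTree _ _)) (by
    simp; omega)

theorem node (hv : PT u v) (hw : PT u w) : PT u fun a => .node (v a) (w a) := by
  intro A
  obtain ⟨p, b, hp⟩ := hv A
  obtain ⟨q, b', hq⟩ := hw A
  refine ⟨.seq .save (.seq q (.seq .restore (.seq p (.push .main (some true))))),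
    10 * Polynomial.X + 4 + (b' + (8 * Polynomial.X + 3 + (b + 1))), fun a i o r l => ?_⟩
  rw [T.cells_node, List.cons_append, List.append_assoc]
  exact RunLe.mono (RunLe.seq (runLe_save _ _) (RunLe.seq (hq a ..) (RunLe.seq
    (runLe_restore _ _) (RunLe.seq (hp a ..) (runLe_push_main _))))) (by simp)

theorem fst (v w : α → T) : PT (fun a => .node (v a) (w a)) v := by
  intro A
  refine ⟨.seq (.pop .main) (.seq .stash (.seq .discard .restore)),
    24 * Polynomial.X + 11, fun a i o r l => ?_⟩
  rw [T.cells_node, List.cons_append, List.append_assoc]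
  exact RunLe.mono (RunLe.seq runLe_pop_main (RunLe.seq (runLe_stash _ _)
    (RunLe.seq (runLe_discard _ _) (runLe_restore _ _)))) (by simp; omega)

theorem snd (v w : α → T) : PT (fun a => .node (v a) (w a)) w := by
  intro A
  refine ⟨.seq (.pop .main) .discard, 7 * Polynomial.X + 4, fun a i o r l => ?_⟩
  rw [T.cells_node, List.cons_append, List.append_assoc]
  exact RunLe.mono (RunLe.seq runLe_pop_main (runLe_discard _ _)) (by simp; omega)

/-- Case distinction on whether a computed tree is `nil`. -/
theorem cases {c : α → T} (hc : PT u c)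
    (h₀ : PT (fun a : {a // c a = .nil} => u a) (fun a => v a))
    (h₁ : PT (fun a : {a // c a ≠ .nil} => u a) (fun a => v a)) : PT u v := by
  obtain ⟨d, hd⟩ := hc.size_le
  intro A
  obtain ⟨pc, bc, hc⟩ := hc A
  obtain ⟨p, b, hp⟩ := h₀ A
  obtain ⟨q, b', hq⟩ := h₁ A
  refine ⟨.seq .save (.seq pc (.ite .main (fun o => o = some (some false))
    (.seq (.pop .main) (.seq .restore p)) (.seq .discard (.seq .restore q)))),
    10 * Polynomial.X + 4 + (bc + (1 + (7 * d + 3 + (8 * Polynomial.X + 3 + (b + b'))))),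
    fun a i o r l => ?_⟩
  refine RunLe.mono (RunLe.seq (runLe_save _ _) (RunLe.seq (hc a ..)
    (n' := 1 + ((7 * (c a).size + 3) + ((8 * (u a).size + 3) +
      (b.eval (u a).size + b'.eval (u a).size)))) ?_)) ?_
  · by_cases h : c a = .nil
    · rw [h, T.cells_nil, List.singleton_append]
      refine RunLe.iteTrue (by simp [st]) (RunLe.mono (RunLe.seq runLe_pop_main (RunLe.seq
        (runLe_restore _ _) (hp ⟨a, h⟩ ..))) ?_)
      dsimp only; simp only [T.size_nil]; omega
    · refine RunLe.iteFalse ?_ (RunLe.mono (RunLe.seq (runLe_discard _ _) (RunLe.seq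
        (runLe_restore _ _) (hq ⟨a, h⟩ ..))) ?_)
      · obtain ⟨x, y, hxy⟩ : ∃ x y, c a = .node x y := by
          cases hca : c a
          · exact absurd hca h
          · exact ⟨_, _, rfl⟩
        simp [st, hxy]
      · dsimp only; omega
  · have := hd a
    simp only [Polynomial.eval_add, Polynomial.eval_mul, Polynomial.eval_X,
      Polynomial.eval_ofNat, Polynomial.eval_one]
    omega

/-- Bounded iteration: `f` is iterated as often as the size of a computed tree says, provided that
all intermediate results are of polynomial size. -/
theorem iterate {e : β → T} {f : β → β} {g : α → β} {c : α → T}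
    (hf : PT e fun b => e (f b)) (hg : PT u fun a => e (g a)) (hc : PT u c)
    (B : Polynomial ℕ) (hB : ∀ a, ∀ k ≤ (c a).size, (e (f^[k] (g a))).size ≤ B.eval (u a).size) :
    PT u fun a => e (f^[(c a).size] (g a)) := by
  obtain ⟨d, hd⟩ := hc.size_le
  intro A
  obtain ⟨pc, bc, hc⟩ := hc A
  obtain ⟨p, b, hp⟩ := hf A
  obtain ⟨q, b', hq⟩ := hg A
  refine ⟨.seq .save (.seq q (.seq .restore (.seq pc (.seq .stash (.seq
    (.loop .loop (fun o => o = some (some true) ∨ o = some (some false)) (.seq (.pop .loop) p))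
      (.pop .loop)))))),
    10 * Polynomial.X + 4 + (b' + (8 * Polynomial.X + 3 + (bc + (9 * d + 4 +
      ((d * (2 + b.comp B) + 1) + 1))))), fun a i o r l => ?_⟩
  have key : ∀ w : List Bool, ∀ k, k + w.length ≤ (c a).size →
      RunLe (.loop .loop (fun o => o = some (some true) ∨ o = some (some false))
        (.seq (.pop .loop) p))
      (st i o ((e (f^[k] (g a))).cells ++ r) [] [] (w.map some ++ none :: l))
      (st i o ((e (f^[k + w.length] (g a))).cells ++ r) [] [] (none :: l))
      (w.length * (2 + b.eval (B.eval (u a).size)) + 1) := by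
    intro w
    induction w with
    | nil => intro k hk; exact RunLe.mono (RunLe.loopFalse (by simp [st])) (by simp)
    | cons x w ih =>
      intro k hk
      have h := ih (k + 1) (by simp at hk; omega)
      have h' := hp (f^[k] (g a)) i o r (w.map some ++ none :: l)
      dsimp only at h'
      rw [← Function.iterate_succ_apply' f] at h'
      have hb := polynomial_eval_mono b (hB a k (by omega))
      have := RunLe.loopTrue (k := .loop)
        (c := fun o => o = some (some true) ∨ o = some (some false))
        (s := st i o ((e (f^[k] (g a))).cells ++ r) [] [] ((x :: w).map some ++ none :: l))
        (by cases x <;> simp [st])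
        (RunLe.seq runLe_pop_loop h') h
      have e1 : k + 1 + w.length = k + (x :: w).length := by simp; omega
      rw [e1] at this
      refine this.mono ?_
      simp only [List.length_cons, Nat.add_mul, Nat.one_mul] at hb ⊢
      omega
  have h := key (c a).word 0 (by simp)
  simp only [zero_add, T.length_word] at h
  refine RunLe.mono (RunLe.seq (runLe_save _ _) (RunLe.seq (hq a ..) (RunLe.seq
    (runLe_restore _ _) (RunLe.seq (hc a ..) (RunLe.seq (runLe_stash _ _)
      (RunLe.seq h runLe_pop_loop)))))) ?_
  have h₁ := hd a
  have h₂ := Nat.mul_le_mul_right (2 + b.eval (B.eval (u a).size)) h₁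
  simp only [Polynomial.eval_add, Polynomial.eval_mul, Polynomial.eval_X, Polynomial.eval_comp,
    Polynomial.eval_ofNat, Polynomial.eval_one]
  omega

end PT

end LSFix

namespace LSFix

/-! ### Polynomial time functions on represented types -/

/-- A representation of the elements of a type by binary trees. -/
class TreeRep (α : Type) where
  enc : α → T
  inj : Function.Injective enc

open TreeRep

/-- The size of the representation of an element. -/
abbrev sz {α : Type} [TreeRep α] (a : α) : ℕ := (enc a).size

instance : TreeRep T := ⟨id, Function.injective_id⟩

open Classical in
/-- Propositions are represented by truth values, so that polynomial time predicates are polynomial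
time functions. -/
noncomputable instance : TreeRep Prop where
  enc p := if p then .node .nil .nil else .nil
  inj p q h := by
    by_cases hp : p <;> by_cases hq : q <;> simp_all

instance : TreeRep Bool where
  enc b := bif b then .node .nil .nil else .nil
  inj p q h := by cases p <;> cases q <;> simp_all

instance {α β : Type} [TreeRep α] [TreeRep β] : TreeRep (α × β) where
  enc x := .node (enc x.1) (enc x.2)
  inj x y h := by
    simp only [T.node.injEq] at h
    exact Prod.ext (inj h.1) (inj h.2)

instance {α : Type} [TreeRep α] (p : α → Prop) : TreeRep (Subtype p) where
  enc x := enc x.1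
  inj := inj.comp Subtype.val_injective

/-- Lists are represented as nested pairs. -/
def encList {α : Type} [TreeRep α] : List α → T
  | [] => .nil
  | a :: l => .node (enc a) (encList l)

instance {α : Type} [TreeRep α] : TreeRep (List α) where
  enc := encList
  inj l l' h := by
    induction l generalizing l' with
    | nil => cases l' <;> simp_all [encList]
    | cons a l ih =>
      cases l' with
      | nil => simp [encList] at h
      | cons b l' =>
        simp only [encList, T.node.injEq] at h
        rw [inj h.1, ih l' h.2]

instance {α : Type} [TreeRep α] {n : ℕ} : TreeRep (Fin n → α) where
  enc t := enc (List.ofFn t)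
  inj := inj.comp List.ofFn_injective

theorem enc_nil {α : Type} [TreeRep α] : enc ([] : List α) = .nil := rfl

theorem enc_cons {α : Type} [TreeRep α] (a : α) (l : List α) :
    enc (a :: l) = .node (enc a) (enc l) := rfl

theorem enc_true : enc True = .node .nil .nil := if_pos trivial

theorem enc_false : enc False = .nil := if_neg not_false

theorem enc_eq_nil_iff (p : Prop) : enc p = .nil ↔ ¬ p := by
  rw [← enc_false, inj.eq_iff, eq_iff_iff, iff_false]

theorem enc_fin_zero {α : Type} [TreeRep α] (t : Fin 0 → α) : enc t = .nil := by
  show enc (List.ofFn t) = _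
  rw [List.ofFn_zero, enc_nil]

theorem enc_fin_succ {α : Type} [TreeRep α] {n : ℕ} (t : Fin (n + 1) → α) :
    enc t = .node (enc (t 0)) (enc (Fin.tail t)) := by
  show enc (List.ofFn t) = _
  rw [List.ofFn_succ, enc_cons]
  rfl

variable {α β γ σ : Type} [TreeRep α] [TreeRep β] [TreeRep γ] [TreeRep σ]

/-- Functions between represented types that are computable in polynomial time. -/
@[fun_prop]
def PTF (f : α → β) : Prop := PT enc fun a => enc (f a)

/-- Case distinction at the level of trees, where the components of a node are available in the
second case. -/
theorem PT.split {α : Type} {u v c : α → T} (hc : PT u c)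
    (h₀ : PT (fun a : {a // c a = .nil} => u a) (fun a => v a))
    (h₁ : ∀ x y : {a // c a ≠ .nil} → T, (∀ a : {a // c a ≠ .nil}, c a = .node (x a) (y a)) →
      PT (fun a : {a // c a ≠ .nil} => u a) x → PT (fun a : {a // c a ≠ .nil} => u a) y →
      PT (fun a : {a // c a ≠ .nil} => u a) (fun a => v a)) : PT u v := by
  refine .cases hc h₀ ?_
  have h : ∀ a : {a // c a ≠ .nil}, ∃ x y, c a = .node x y := by
    rintro ⟨a, ha⟩
    cases hca : c a
    · exact absurd hca ha
    · exact ⟨_, _, rfl⟩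
  choose x y hxy using h
  have hc' : PT (fun a : {a // c a ≠ .nil} => u a) fun a => .node (x a) (y a) := by
    simpa only [← hxy] using hc.comap Subtype.val
  exact h₁ x y hxy (hc'.trans (.fst x y)) (hc'.trans (.snd x y))

namespace PTF

@[fun_prop]
theorem id : PTF fun a : α => a := PT.refl _

@[fun_prop]
theorem const (b : β) : PTF fun _ : α => b := PT.const _ _

@[fun_prop]
theorem comp {f : β → γ} {g : α → β} (hf : PTF f) (hg : PTF g) : PTF fun a => f (g a) :=
  PT.trans hg (PT.comap hf g)

@[fun_prop]
theorem prodMk {f : α → β} {g : α → γ} (hf : PTF f) (hg : PTF g) : PTF fun a => (f a, g a) :=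
  PT.node hf hg

@[fun_prop]
theorem fst {f : α → β × γ} (hf : PTF f) : PTF fun a => (f a).1 :=
  PT.trans hf (PT.fst _ fun a => enc (f a).2)

@[fun_prop]
theorem snd {f : α → β × γ} (hf : PTF f) : PTF fun a => (f a).2 :=
  PT.trans hf (PT.snd (fun a => enc (f a).1) _)

@[fun_prop]
theorem cons {f : α → β} {g : α → List β} (hf : PTF f) (hg : PTF g) : PTF fun a => f a :: g a :=
  PT.node hf hg

@[fun_prop]
theorem subtypeVal (p : α → Prop) : PTF fun a : Subtype p => (a : α) := PT.refl _

theorem size_le {f : α → β} (hf : PTF f) : ∃ b : Polynomial ℕ, ∀ a, sz (f a) ≤ b.eval (sz a) :=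
  PT.size_le hf

/-- Functions that agree on the level of representations. -/
theorem of_enc_eq {f : α → β} {g : α → γ} (hf : PTF f) (h : ∀ a, enc (g a) = enc (f a)) :
    PTF g := by
  unfold PTF
  rw [show (fun a => enc (g a)) = fun a => enc (f a) from funext h]
  exact hf

/-- Case distinction where the function has to be computed in each case only for the arguments of
this case. -/
theorem ite_subtype {P : α → Prop} {f : α → β} (hP : PTF P)
    (h : PTF fun a : {a // P a} => f a) (h' : PTF fun a : {a // ¬ P a} => f a) : PTF f := by
  refine PT.cases hP ?_ ?_
  · exact PT.comap (β := {a // enc (P a) = .nil}) h' fun a => ⟨a.1, (enc_eq_nil_iff _).1 a.2⟩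
  · exact PT.comap (β := {a // enc (P a) ≠ .nil}) h
      fun a => ⟨a.1, not_not.1 fun ha => a.2 ((enc_eq_nil_iff _).2 ha)⟩

@[fun_prop]
theorem ite {P : α → Prop} [∀ a, Decidable (P a)] {f g : α → β} (hP : PTF P) (hf : PTF f)
    (hg : PTF g) : PTF fun a => if P a then f a else g a := by
  refine ite_subtype hP ?_ ?_
  · have : PTF fun a : {a // P a} => f a := hf.comp (subtypeVal P)
    refine of_enc_eq this fun a => ?_
    rw [if_pos a.2]
  · have : PTF fun a : {a // ¬ P a} => g a := hg.comp (subtypeVal _)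
    refine of_enc_eq this fun a => ?_
    rw [if_neg a.2]

theorem congr {f g : α → β} (hf : PTF f) (h : ∀ a, g a = f a) : PTF g := by
  rwa [funext h]

open Classical in
@[fun_prop]
theorem and {P Q : α → Prop} (hP : PTF P) (hQ : PTF Q) : PTF fun a => P a ∧ Q a :=
  (ite hP hQ (const False)).congr fun a => by by_cases h : P a <;> simp [h]

open Classical in
@[fun_prop]
theorem or {P Q : α → Prop} (hP : PTF P) (hQ : PTF Q) : PTF fun a => P a ∨ Q a :=
  (ite hP (const True) hQ).congr fun a => by by_cases h : P a <;> simp [h]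

open Classical in
@[fun_prop]
theorem not {P : α → Prop} (hP : PTF P) : PTF fun a => ¬ P a :=
  (ite hP (const False) (const True)).congr fun a => by by_cases h : P a <;> simp [h]

@[fun_prop]
theorem imp {P Q : α → Prop} (hP : PTF P) (hQ : PTF Q) : PTF fun a => P a → Q a :=
  (or (not hP) hQ).congr fun a => by rw [imp_iff_not_or]

@[fun_prop]
theorem toBool {P : α → Prop} [∀ a, Decidable (P a)] (hP : PTF P) :
    PTF fun a => decide (P a) := by
  refine of_enc_eq hP fun a => ?_
  by_cases h : P a
  · simp only [h, decide_true, enc_true]; rfl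
  · simp only [h, decide_false, enc_false]; rfl

theorem tree_cases {t : α → T} {f f₀ : α → β} {f₁ : α × T × T → β} (ht : PTF t) (h₀ : PTF f₀)
    (h₁ : PTF f₁) (e₀ : ∀ a, t a = .nil → f a = f₀ a)
    (e₁ : ∀ a x y, t a = .node x y → f a = f₁ (a, x, y)) : PTF f := by
  refine PT.split (c := t) ht ?_ ?_
  · have := h₀.comp (subtypeVal fun a => t a = .nil)
    exact this.of_enc_eq (g := fun a : {a // t a = .nil} => f a) fun a => by rw [e₀ _ a.2]
  · intro x y hxy hx hy
    have : PTF fun a : {a // t a ≠ .nil} => f₁ (a.1, x a, y a) :=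
      h₁.comp (prodMk (subtypeVal _) (prodMk (β := T) hx hy))
    exact this.of_enc_eq (g := fun a : {a // t a ≠ .nil} => f a) fun a => by rw [e₁ _ _ _ (hxy a)]

theorem list_cases {l : α → List γ} {f f₀ : α → β} {f₁ : α × γ × List γ → β} (hl : PTF l)
    (h₀ : PTF f₀) (h₁ : PTF f₁) (e₀ : ∀ a, l a = [] → f a = f₀ a)
    (e₁ : ∀ a b l', l a = b :: l' → f a = f₁ (a, b, l')) : PTF f := by
  refine PT.split (c := fun a => enc (l a)) hl ?_ ?_
  · have h := h₀.comp (subtypeVal fun a => enc (l a) = .nil)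
    exact h.of_enc_eq (g := fun a : {a // enc (l a) = .nil} => f a) fun a => by
      rw [e₀ _ (inj a.2)]
  · intro x y hxy hx hy
    have h : ∀ a : {a // enc (l a) ≠ .nil}, ∃ b l', l a = b :: l' := by
      rintro ⟨a, ha⟩
      cases hl : l a
      · exact absurd (by simp only [hl]; rfl) ha
      · exact ⟨_, _, rfl⟩
    choose b l' hbl using h
    have hb : PTF b := by
      have e : ∀ a, enc (b a) = x a := fun a => by
        have := hxy a
        rw [hbl a, enc_cons, T.node.injEq] at this
        exact this.1
      exact of_enc_eq (f := x) (g := b) hx e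
    have hl' : PTF l' := by
      have e : ∀ a, enc (l' a) = y a := fun a => by
        have := hxy a
        rw [hbl a, enc_cons, T.node.injEq] at this
        exact this.2
      exact of_enc_eq (f := y) (g := l') hy e
    have : PTF fun a : {a // enc (l a) ≠ .nil} => f₁ (a.1, b a, l' a) :=
      h₁.comp (prodMk (subtypeVal _) (prodMk hb hl'))
    exact this.of_enc_eq (g := fun a : {a // enc (l a) ≠ .nil} => f a) fun a => by
      rw [e₁ _ _ _ (hbl a)]

theorem iterate {f : β → β} {g : α → β} {c : α → γ} (hf : PTF f) (hg : PTF g) (hc : PTF c)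
    (B : Polynomial ℕ) (hB : ∀ a, ∀ k ≤ sz (c a), sz (f^[k] (g a)) ≤ B.eval (sz a)) :
    PTF fun a => f^[sz (c a)] (g a) :=
  PT.iterate hf hg hc B hB

end PTF

/-! ### Lists -/

theorem sz_prod (a : α) (b : β) : sz (a, b) = sz a + sz b + 1 := rfl

theorem sz_cons (a : α) (l : List α) : sz (a :: l) = sz a + sz l + 1 := rfl

theorem sz_nil : sz ([] : List α) = 1 := rfl

theorem sz_prop_le (p : Prop) : sz p ≤ 3 := by
  by_cases h : p <;> simp [sz, h, enc_true, enc_false]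

theorem length_le_sz (l : List α) : l.length ≤ sz l := by
  induction l with
  | nil => exact Nat.zero_le _
  | cons a l ih => rw [sz_cons]; simp; omega

theorem sz_drop_le (l : List α) (k : ℕ) : sz (l.drop k) ≤ sz l := by
  induction l generalizing k with
  | nil => simp
  | cons a l ih =>
    cases k with
    | zero => simp
    | succ k => rw [List.drop_succ_cons, sz_cons]; exact (ih k).trans (by omega)

namespace PTF

/-- One step of a fold over a list, with a parameter. -/
def foldStep (h : α × σ × β → σ) : α × List β × σ → α × List β × σ
  | (a, [], s) => (a, [], s)
  | (a, b :: l, s) => (a, l, h (a, s, b))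

omit [TreeRep α] [TreeRep β] [TreeRep σ] in
theorem iterate_foldStep (h : α × σ × β → σ) (a : α) (k : ℕ) : ∀ (l : List β) (s : σ),
    (foldStep h)^[k] (a, l, s) = (a, l.drop k, (l.take k).foldl (fun s b => h (a, s, b)) s) := by
  induction k with
  | zero => intro l s; simp
  | succ k ih =>
    intro l s
    rw [Function.iterate_succ_apply]
    cases l with
    | nil => rw [foldStep, ih]; simp
    | cons b l => rw [foldStep, ih]; simp

/-- Folds over lists, provided that all intermediate results are of polynomial size. -/
theorem foldl {h : α × σ × β → σ} {l : α → List β} {s : α → σ} (hh : PTF h) (hl : PTF l)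
    (hs : PTF s) (B : Polynomial ℕ)
    (hB : ∀ a k, sz (((l a).take k).foldl (fun s b => h (a, s, b)) (s a)) ≤ B.eval (sz a)) :
    PTF fun a => (l a).foldl (fun s b => h (a, s, b)) (s a) := by
  have hstep : PTF (foldStep h) := by
    refine list_cases (l := fun x => x.2.1) (f₀ := fun x => x)
      (f₁ := fun x : (α × List β × σ) × β × List β => (x.1.1, x.2.2, h (x.1.1, x.1.2.2, x.2.1)))
      (by fun_prop) (by fun_prop) (by fun_prop) ?_ ?_
    · rintro ⟨a, l, s⟩ rfl; rfl
    · rintro ⟨a, l, s⟩ b l' rfl; rfl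
  obtain ⟨d, hd⟩ := hl.size_le
  have := iterate (g := fun a => (a, l a, s a)) (c := l) hstep (by fun_prop) hl
    (Polynomial.X + d + B + 2) (by
      intro a k hk
      rw [iterate_foldStep, sz_prod, sz_prod]
      have h₁ := sz_drop_le (l a) k
      have h₂ := hd a
      have h₃ := hB a k
      simp only [Polynomial.eval_add, Polynomial.eval_X, Polynomial.eval_ofNat]
      omega)
  refine (snd (snd this)).congr fun a => ?_
  rw [iterate_foldStep, List.take_of_length_le (length_le_sz _)]

theorem exists_mem {l : α → List β} {P : α → β → Prop} (hl : PTF l)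
    (hP : PTF fun x : α × β => P x.1 x.2) : PTF fun a => ∃ b ∈ l a, P a b := by
  have := foldl (h := fun x : α × Prop × β => x.2.1 ∨ P x.1 x.2.2) (l := l) (s := fun _ => False)
    (or (by fun_prop) (hP.comp (g := fun x : α × Prop × β => (x.1, x.2.2)) (by fun_prop)))
    hl (by fun_prop) 3
    (fun a k => (sz_prop_le _).trans (by simp))
  refine this.congr fun a => ?_
  have key : ∀ (l : List β) (p : Prop),
      l.foldl (fun s b => s ∨ P a b) p = (p ∨ ∃ b ∈ l, P a b) := by
    intro l
    induction l with
    | nil => simp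
    | cons b l ih => intro p; simp [ih, or_assoc]
  rw [key]
  simp

theorem forall_mem {l : α → List β} {P : α → β → Prop} (hl : PTF l)
    (hP : PTF fun x : α × β => P x.1 x.2) : PTF fun a => ∀ b ∈ l a, P a b :=
  (not (exists_mem hl (P := fun a b => ¬ P a b) (not hP))).congr fun a => by
    simp

omit [TreeRep α] in
theorem foldl_reverse (l m : List α) : l.foldl (fun s b => b :: s) m = l.reverse ++ m := by
  induction l generalizing m with
  | nil => rfl
  | cons a l ih => simp [ih]

theorem sz_append_le (l m : List α) : sz (l ++ m) + 1 = sz l + sz m := by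
  induction l with
  | nil => simp [sz_nil]; omega
  | cons a l ih => rw [List.cons_append, sz_cons, sz_cons]; omega

theorem sz_reverse (l : List α) : sz l.reverse = sz l := by
  induction l with
  | nil => rfl
  | cons a l ih =>
    have := sz_append_le l.reverse [a]
    rw [List.reverse_cons, sz_cons]
    rw [sz_cons, sz_nil] at this
    omega

theorem sz_take_le (l : List α) (k : ℕ) : sz (l.take k) ≤ sz l := by
  have := sz_append_le (l.take k) (l.drop k)
  rw [List.take_append_drop] at this
  have : 0 < sz (l.drop k) := T.size_pos _
  omega

@[fun_prop]
theorem reverse {l : α → List β} (hl : PTF l) : PTF fun a => (l a).reverse := by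
  have := foldl (α := List β) (h := fun x : List β × List β × β => x.2.2 :: x.2.1)
    (l := fun l => l) (s := fun _ => []) (by fun_prop) (by fun_prop) (by fun_prop) Polynomial.X
    (fun l k => by
      rw [foldl_reverse, List.append_nil, sz_reverse, Polynomial.eval_X]
      exact sz_take_le l k)
  refine (this.comp hl).congr fun a => ?_
  rw [foldl_reverse, List.append_nil]

/-! ### Equality -/

/-- One step of the comparison of two trees. The state is a truth value and a list of pairs that
still have to be compared. -/
def eqStep : Prop × List (T × T) → Prop × List (T × T)
  | (p, []) => (p, [])
  | (p, (.nil, .nil) :: w) => (p, w)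
  | (p, (.node a b, .node c d) :: w) => (p, (a, c) :: (b, d) :: w)
  | (_, (.nil, .node _ _) :: w) => (False, w)
  | (_, (.node _ _, .nil) :: w) => (False, w)

theorem eqStep_ptf : PTF eqStep := by
  refine list_cases (l := fun x => x.2) (f₀ := fun x => x)
    (f₁ := fun x : (Prop × List (T × T)) × (T × T) × List (T × T) =>
      eqStep (x.1.1, x.2.1 :: x.2.2))
    (by fun_prop) (by fun_prop) ?_ ?_ ?_
  rotate_left
  · rintro ⟨p, w⟩ rfl; rfl
  · rintro ⟨p, w⟩ b l rfl; rfl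
  · refine tree_cases (t := fun x => x.2.1.1)
      (f₀ := fun x => eqStep (x.1.1, (.nil, x.2.1.2) :: x.2.2))
      (f₁ := fun x => eqStep (x.1.1.1, (.node x.2.1 x.2.2, x.1.2.1.2) :: x.1.2.2))
      (by fun_prop) ?_ ?_ ?_ ?_
    rotate_left 2
    · rintro ⟨p, ⟨a, b⟩, w⟩ rfl; rfl
    · rintro ⟨p, ⟨a, b⟩, w⟩ x y rfl; rfl
    · refine tree_cases (t := fun x => x.2.1.2) (f₀ := fun x => (x.1.1, x.2.2))
        (f₁ := fun x => (False, x.1.2.2)) (by fun_prop) (by fun_prop) (by fun_prop) ?_ ?_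
      · rintro ⟨p, ⟨a, b⟩, w⟩ rfl; rfl
      · rintro ⟨p, ⟨a, b⟩, w⟩ x y rfl; rfl
    · refine tree_cases (t := fun x => x.1.2.1.2) (f₀ := fun x => (False, x.1.2.2))
        (f₁ := fun x => (x.1.1.1.1, (x.1.2.1, x.2.1) :: (x.1.2.2, x.2.2) :: x.1.1.2.2))
        (by fun_prop) (by fun_prop) (by fun_prop) ?_ ?_
      · rintro ⟨⟨p, ⟨a, b⟩, w⟩, c, d⟩ rfl; rfl
      · rintro ⟨⟨p, ⟨a, b⟩, w⟩, c, d⟩ x y rfl; rfl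

theorem sz_eqStep_le (x : Prop × List (T × T)) : sz (eqStep x).2 ≤ sz x.2 := by
  rcases x with ⟨p, _ | ⟨⟨_ | ⟨a, b⟩, _ | ⟨c, d⟩⟩, w⟩⟩ <;>
    simp only [eqStep, sz_cons, sz_prod, sz_nil] <;> simp [sz, enc] <;> omega

/-- The sum of the sizes of the first components bounds the number of steps that are needed. -/
theorem iterate_eqStep (n : ℕ) : ∀ (p : Prop) (w : List (T × T)),
    (w.map fun x => x.1.size).sum ≤ n →
    (eqStep^[n] (p, w)).1 = (p ∧ ∀ x ∈ w, x.1 = x.2) := by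
  induction n with
  | zero =>
    intro p w h
    cases w with
    | nil => simp
    | cons x w =>
      have := x.1.size_pos
      simp at h; omega
  | succ n ih =>
    intro p w h
    rw [Function.iterate_succ_apply]
    rcases w with _ | ⟨⟨_ | ⟨a, b⟩, _ | ⟨c, d⟩⟩, w⟩ <;> rw [eqStep, ih] <;>
      simp at h ⊢ <;> try omega
    simp [and_assoc]

@[fun_prop]
theorem eq {f g : α → β} (hf : PTF f) (hg : PTF g) : PTF fun a => f a = g a := by
  have h := iterate (α := T × T) (f := eqStep) (g := fun x => (True, [x])) (c := fun x => x)
    eqStep_ptf (by fun_prop) (by fun_prop) (Polynomial.X + 6) (by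
      intro x k hk
      have h : ∀ k, sz (eqStep^[k] (True, [x])).2 ≤ sz [x] := by
        intro k
        induction k with
        | zero => exact le_rfl
        | succ k ih => rw [Function.iterate_succ_apply']; exact (sz_eqStep_le _).trans ih
      have h₁ := h k
      have h₂ := sz_prop_le (eqStep^[k] (True, [x])).1
      have h₃ := sz_prod (eqStep^[k] (True, [x])).1 (eqStep^[k] (True, [x])).2
      rw [sz_cons, sz_nil] at h₁
      rw [Prod.mk.eta] at h₃
      simp only [Polynomial.eval_add, Polynomial.eval_X, Polynomial.eval_ofNat]
      omega)
  have h' : PTF fun x : T × T => x.1 = x.2 := by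
    refine (fst h).congr fun x => ?_
    rw [iterate_eqStep]
    · simp
    · simp [sz_prod x.1 x.2]
      show _ ≤ (T.node x.1 x.2).size
      simp; omega
  have hf' : PTF fun a => enc (f a) := hf
  have hg' : PTF fun a => enc (g a) := hg
  refine (h'.comp (prodMk hf' hg')).congr fun a => ?_
  simp [inj.eq_iff]

/-! ### Finite types and tuples of fixed length -/

/-- Case distinction on the value of a function to a finite type. -/
theorem finCases {X : Type} [Finite X] [TreeRep X] {g : α → X} {F : X → α → β} (hg : PTF g)
    (hF : ∀ x, PTF (F x)) : PTF fun a => F (g a) a := by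
  classical
  by_cases hX : Nonempty X
  · have key : ∀ s : Finset X, ∃ h : α → β, PTF h ∧ ∀ a, g a ∈ s → h a = F (g a) a := by
      intro s
      induction s using Finset.induction_on with
      | empty => exact ⟨F hX.some, hF _, fun a ha => absurd ha (Finset.notMem_empty _)⟩
      | insert x s _ ih =>
        obtain ⟨h, hh, e⟩ := ih
        refine ⟨fun a => if g a = x then F x a else h a, by have := hF x; fun_prop,
          fun a ha => ?_⟩
        by_cases hx : g a = x
        · simp only [hx, if_true]
        · simp only [hx, if_false]
          exact e a (Finset.mem_of_mem_insert_of_ne ha hx)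
    have := Fintype.ofFinite X
    obtain ⟨h, hh, e⟩ := key Finset.univ
    exact hh.congr fun a => (e a (Finset.mem_univ _)).symm
  · have : IsEmpty α := ⟨fun a => hX ⟨g a⟩⟩
    intro A
    obtain ⟨p, b, _⟩ := PT.refl (fun _ : Unit => T.nil) A
    exact ⟨p, b, fun a => isEmptyElim a⟩

theorem exists_finite {X : Type} [Finite X] {P : X → α → Prop} (h : ∀ x, PTF (P x)) :
    PTF fun a => ∃ x, P x a := by
  classical
  have := Fintype.ofFinite X
  have key : ∀ s : Finset X, PTF fun a => ∃ x ∈ s, P x a := by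
    intro s
    induction s using Finset.induction_on with
    | empty => exact (const False).congr fun a => by simp
    | insert x s _ ih => exact (or (h x) ih).congr fun a => by simp
  exact (key Finset.univ).congr fun a => by simp

theorem forall_finite {X : Type} [Finite X] {P : X → α → Prop} (h : ∀ x, PTF (P x)) :
    PTF fun a => ∀ x, P x a :=
  (not (exists_finite fun x => not (h x))).congr fun a => by simp

@[fun_prop]
theorem pi {n : ℕ} {f : α → Fin n → β} (h : ∀ i, PTF fun a => f a i) : PTF f := by
  induction n with
  | zero => exact (const (fun i => i.elim0)).congr fun a => funext fun i => i.elim0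
  | succ n ih =>
    have : PTF fun a => (Fin.tail (f a) : Fin n → β) := ih fun i => h i.succ
    have := PT.node (h 0) this
    unfold PTF
    simpa only [enc_fin_succ] using this

@[fun_prop]
theorem apply {n : ℕ} (i : Fin n) : PTF fun t : Fin n → α => t i := by
  induction n with
  | zero => exact i.elim0
  | succ n ih =>
    have h : PT (fun t : Fin (n + 1) → α => enc t)
        fun t => .node (enc (t 0)) (enc (Fin.tail t : Fin n → α)) := by
      simpa only [enc_fin_succ] using PT.refl (fun t : Fin (n + 1) → α => enc t)
    cases i using Fin.cases with
    | zero => exact h.trans (.fst _ fun t : Fin (n + 1) → α => enc (Fin.tail t : Fin n → α))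
    | succ i =>
      have h' : PTF fun t : Fin (n + 1) → α => (Fin.tail t : Fin n → α) :=
        h.trans (.snd (fun t : Fin (n + 1) → α => enc (t 0)) _)
      exact (ih i).comp h'

theorem finCons {n : ℕ} {f : α → β} {g : α → Fin n → β} (hf : PTF f) (hg : PTF g) :
    PTF fun a => (Fin.cons (f a) (g a) : Fin (n + 1) → β) := by
  have := PT.node hf hg
  unfold PTF
  simpa only [enc_fin_succ, Fin.cons_zero, Fin.tail_cons] using this

/-- Quantification over tuples of fixed length with entries in a list. -/
theorem exists_tuple_mem {l : α → List β} (hl : PTF l) : ∀ {n : ℕ} {P : α → (Fin n → β) → Prop},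
    (PTF fun x : α × (Fin n → β) => P x.1 x.2) →
    PTF fun a => ∃ t : Fin n → β, (∀ i, t i ∈ l a) ∧ P a t := by
  intro n
  induction n generalizing α with
  | zero =>
    intro P hP
    have h : PTF fun a => P a (fun i => i.elim0) :=
      hP.comp (g := fun a => (a, (fun i => i.elim0 : Fin 0 → β)))
        (prodMk id (const _))
    refine h.congr fun a => ?_
    rw [eq_iff_iff]
    constructor
    · rintro ⟨t, _, ht⟩
      rwa [Subsingleton.elim t fun i => i.elim0] at ht
    · exact fun h => ⟨_, fun i => i.elim0, h⟩
  | succ n ih =>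
    intro P hP
    have h₁ : PTF fun y : (α × β) × (Fin n → β) =>
        P y.1.1 (Fin.cons y.1.2 y.2) :=
      hP.comp (g := fun y : (α × β) × (Fin n → β) => (y.1.1, Fin.cons y.1.2 y.2))
        (prodMk (by fun_prop) (finCons (f := fun y : (α × β) × (Fin n → β) => y.1.2)
          (g := fun y : (α × β) × (Fin n → β) => y.2) (by fun_prop) (by fun_prop)))
    have h₂ := ih (l := fun x : α × β => l x.1) (by fun_prop)
      (P := fun x t => P x.1 (Fin.cons x.2 t)) h₁
    refine (exists_mem (P := fun a b => ∃ t : Fin n → β, (∀ i, t i ∈ l a) ∧ P a (Fin.cons b t))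
      hl h₂).congr fun a => ?_
    rw [eq_iff_iff]
    constructor
    · rintro ⟨t, ht, h⟩
      exact ⟨t 0, ht 0, Fin.tail t, fun i => ht i.succ, by rwa [Fin.cons_self_tail]⟩
    · rintro ⟨b, hb, t, ht, h⟩
      refine ⟨Fin.cons b t, fun i => ?_, h⟩
      cases i using Fin.cases with
      | zero => exact hb
      | succ i => exact ht i

end PTF

end LSFix

namespace LSFix

open TreeRep

/-! ### Arithmetic -/

/-- The natural number with the given bits, the most significant bit first. -/
def msb (o : List Bool) : ℕ := o.foldl (fun n b => Nat.bit b n) 0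

theorem msb_append_singleton (o : List Bool) (b : Bool) : msb (o ++ [b]) = Nat.bit b (msb o) := by
  simp [msb]

theorem msb_reverse_bits (n : ℕ) : msb n.bits.reverse = n := by
  induction n using Nat.binaryRec' with
  | zero => simp [msb]
  | bit b n h ih => rw [Nat.bits_append_bit n b h, List.reverse_cons, msb_append_singleton, ih]

theorem msb_cons (b : Bool) (o : List Bool) : msb (b :: o) = b.toNat * 2 ^ o.length + msb o := by
  have key : ∀ (o : List Bool) (n : ℕ),
      o.foldl (fun n b => Nat.bit b n) n = n * 2 ^ o.length + msb o := by
    intro o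
    induction o with
    | nil => intro n; simp [msb]
    | cons b o ih =>
      intro n
      rw [msb, List.foldl_cons, List.foldl_cons, ih, ih, Nat.bit_val, Nat.bit_val,
        List.length_cons, pow_succ]
      ring
  rw [msb, List.foldl_cons, key, Nat.bit_val]
  simp

theorem msb_lt (o : List Bool) : msb o < 2 ^ o.length := by
  induction o with
  | nil => simp [msb]
  | cons b o ih =>
    rw [msb_cons, List.length_cons, pow_succ]
    have : b.toNat ≤ 1 := Bool.toNat_le b
    nlinarith [Nat.one_le_two_pow (n := o.length)]

/-- Natural numbers are represented by their bits, the least significant bit first. -/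
instance : TreeRep ℕ where
  enc n := enc n.bits
  inj m n h := by
    have h : m.bits = n.bits := inj h
    rw [← msb_reverse_bits m, h, msb_reverse_bits]

theorem sz_bool_le (b : Bool) : sz b ≤ 3 := by cases b <;> simp [sz, enc]

theorem sz_bits_le (l : List Bool) : sz l ≤ 1 + 4 * l.length := by
  induction l with
  | nil => simp [sz_nil]
  | cons b l ih =>
    have := sz_bool_le b
    rw [sz_cons, List.length_cons]; omega

theorem size_le_sz (n : ℕ) : n.size ≤ sz n := by
  rw [← Nat.size_eq_bits_len]
  exact length_le_sz n.bits

theorem lt_two_pow_sz (n : ℕ) : n < 2 ^ sz n := Nat.size_le.1 (size_le_sz n)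

theorem sz_le_of_lt {n k : ℕ} (h : n < 2 ^ k) : sz n ≤ 1 + 4 * k := by
  have h₁ := sz_bits_le n.bits
  rw [Nat.size_eq_bits_len] at h₁
  have h₂ := Nat.size_le.2 h
  exact h₁.trans (by omega)

theorem sz_le_of_le {m n : ℕ} (h : m ≤ n) : sz m ≤ 1 + 4 * sz n :=
  sz_le_of_lt (h.trans_lt (lt_two_pow_sz n))

namespace PTF

variable {α β γ : Type} [TreeRep α] [TreeRep β] [TreeRep γ]

theorem bool₂ (F : Bool → Bool → Bool) {f g : α → Bool} (hf : PTF f) (hg : PTF g) :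
    PTF fun a => F (f a) (g a) :=
  finCases (F := fun x a => F x (g a)) hf fun _ => finCases (F := fun y _ => F _ y) hg
    fun _ => const _

@[fun_prop]
theorem boolAnd {f g : α → Bool} (hf : PTF f) (hg : PTF g) : PTF fun a => f a && g a :=
  bool₂ _ hf hg

@[fun_prop]
theorem boolOr {f g : α → Bool} (hf : PTF f) (hg : PTF g) : PTF fun a => f a || g a :=
  bool₂ _ hf hg

@[fun_prop]
theorem boolXor {f g : α → Bool} (hf : PTF f) (hg : PTF g) : PTF fun a => f a ^^ g a :=
  bool₂ _ hf hg

@[fun_prop]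
theorem tail {l : α → List β} (hl : PTF l) : PTF fun a => (l a).tail :=
  list_cases hl (const []) (f₁ := fun x : α × β × List β => x.2.2) (by fun_prop)
    (fun a h => by rw [h]; rfl) (fun a b l h => by rw [h]; rfl)

theorem headD {l : α → List β} {d : β} (hl : PTF l) : PTF fun a => (l a).headD d :=
  list_cases hl (const d) (f₁ := fun x : α × β × List β => x.2.1) (by fun_prop)
    (fun a h => by rw [h]; rfl) (fun a b l h => by rw [h]; rfl)

@[fun_prop]
theorem bits {f : α → ℕ} (hf : PTF f) : PTF fun a => (f a).bits := hf

@[fun_prop]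
theorem div2 {f : α → ℕ} (hf : PTF f) : PTF fun a => (f a).div2 := by
  have : PTF fun a => (f a).bits.tail := by fun_prop
  refine of_enc_eq this fun a => ?_
  rw [← Nat.div2_bits_eq_tail]; rfl

@[fun_prop]
theorem bodd {f : α → ℕ} (hf : PTF f) : PTF fun a => (f a).bodd := by
  refine (headD (bits hf) (d := false)).congr fun a => ?_
  rw [Nat.bodd_eq_bits_head]
  cases (f a).bits <;> rfl

@[fun_prop]
theorem bit {f : α → Bool} {g : α → ℕ} (hf : PTF f) (hg : PTF g) :
    PTF fun a => Nat.bit (f a) (g a) := by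
  have : PTF fun a => if g a = 0 ∧ f a = false then [] else f a :: (g a).bits := by fun_prop
  refine of_enc_eq this fun a => ?_
  show enc (Nat.bit (f a) (g a)).bits = _
  congr 1
  by_cases h : g a = 0 ∧ f a = false
  · rw [if_pos h, h.1, h.2]; simp
  · rw [if_neg h, Nat.bits_append_bit]
    intro h0
    by_contra h1
    exact h ⟨h0, by simpa using h1⟩

@[fun_prop]
theorem msb {l : α → List Bool} (hl : PTF l) : PTF fun a => msb (l a) := by
  have := foldl (α := List Bool) (h := fun x : List Bool × ℕ × Bool => Nat.bit x.2.2 x.2.1)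
    (l := fun l => l) (s := fun _ => 0) (by fun_prop) (by fun_prop) (by fun_prop)
    (1 + 4 * Polynomial.X)
    (fun l k => by
      refine (sz_le_of_lt (msb_lt (l.take k))).trans ?_
      have := length_le_sz l
      simp; omega)
  exact this.comp hl

end PTF

/-- One step of the serial addition (`sub = false`) or subtraction (`sub = true`) of two natural
numbers: the state consists of the remaining parts of the numbers, the carry or borrow, and the
bits of the result that are known. -/
def addStep (sub : Bool) (x : ℕ × ℕ × Bool × List Bool) : ℕ × ℕ × Bool × List Bool :=
  let a := x.1.bodd ^^ sub
  let b := x.2.1.bodd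
  let c := x.2.2.1
  (x.1.div2, x.2.1.div2, (a && b) || (a && c) || (b && c), (x.1.bodd ^^ b ^^ c) :: x.2.2.2)

theorem addStep_ptf (sub : Bool) : PTF (addStep sub) := by
  unfold addStep
  fun_prop

/-- The state of the serial addition or subtraction of `a` and `b` after `k` steps. -/
def addIter (sub : Bool) (a b k : ℕ) : ℕ × ℕ × Bool × List Bool :=
  (addStep sub)^[k] (a, b, false, [])

/-- The invariant of the serial algorithm: the sum or difference of the remaining parts and the
carry or borrow, shifted by the number of steps, and the known bits add up to the result. -/
theorem addIter_spec (sub : Bool) (a b k : ℕ) :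
    (addIter sub a b k).1 = a / 2 ^ k ∧ (addIter sub a b k).2.1 = b / 2 ^ k ∧
    (addIter sub a b k).2.2.2.length = k ∧
    (a + (bif sub then -1 else 1) * b : ℤ) =
      ((addIter sub a b k).1 + (bif sub then -1 else 1) * (addIter sub a b k).2.1 +
        (bif sub then -1 else 1) * (addIter sub a b k).2.2.1.toNat) * 2 ^ k +
        msb (addIter sub a b k).2.2.2 := by
  induction k with
  | zero => simp [addIter, msb]
  | succ k ih =>
    obtain ⟨h₁, h₂, h₃, h₄⟩ := ih
    rw [addIter, Function.iterate_succ_apply', ← addIter]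
    generalize addIter sub a b k = x at *
    obtain ⟨m, n, c, o⟩ := x
    dsimp only [addStep] at *
    refine ⟨?_, ?_, by simp [h₃], ?_⟩
    · rw [Nat.div2_val, h₁, Nat.div_div_eq_div_mul, pow_succ]
    · rw [Nat.div2_val, h₂, Nat.div_div_eq_div_mul, pow_succ]
    · have hm : (m : ℤ) = m.bodd.toNat + 2 * m.div2 := by exact_mod_cast (Nat.bodd_add_div2 m).symm
      have hn : (n : ℤ) = n.bodd.toNat + 2 * n.div2 := by exact_mod_cast (Nat.bodd_add_div2 n).symm
      rw [h₄, msb_cons, h₃, pow_succ, hm, hn]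
      push_cast
      generalize m.bodd = p
      generalize n.bodd = q
      cases sub <;> cases p <;> cases q <;> cases c <;> simp <;> ring

theorem addIter_final (sub : Bool) {a b k : ℕ} (ha : a < 2 ^ k) (hb : b < 2 ^ k) :
    (a + (bif sub then -1 else 1) * b : ℤ) =
      (bif sub then -1 else 1) * (addIter sub a b k).2.2.1.toNat * 2 ^ k +
        msb (addIter sub a b k).2.2.2 ∧ msb (addIter sub a b k).2.2.2 < 2 ^ k := by
  obtain ⟨h₁, h₂, h₃, h₄⟩ := addIter_spec sub a b k
  rw [h₁, h₂, Nat.div_eq_of_lt ha, Nat.div_eq_of_lt hb] at h₄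
  refine ⟨by rw [h₄]; simp, ?_⟩
  have := msb_lt (addIter sub a b k).2.2.2
  rwa [h₃] at this

theorem addIter_ptf (sub : Bool) : PTF fun x : ℕ × ℕ => addIter sub x.1 x.2 (sz x) := by
  refine PTF.iterate (g := fun x : ℕ × ℕ => (x.1, x.2, false, [])) (c := fun x => x)
    (addStep_ptf sub) (by fun_prop) (by fun_prop) (12 * Polynomial.X + 12) ?_
  rintro ⟨a, b⟩ k hk
  obtain ⟨h₁, h₂, h₃, -⟩ := addIter_spec sub a b k
  change sz (addIter sub a b k) ≤ _
  generalize addIter sub a b k = x at *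
  obtain ⟨m, n, c, o⟩ := x
  dsimp only at h₁ h₂ h₃
  have e₁ := sz_le_of_le (h₁.le.trans (Nat.div_le_self _ _))
  have e₂ := sz_le_of_le (h₂.le.trans (Nat.div_le_self _ _))
  have e₃ := sz_bits_le o
  have e₄ := sz_bool_le c
  have e₅ := sz_prod a b
  rw [sz_prod, sz_prod, sz_prod]
  simp only [Polynomial.eval_add, Polynomial.eval_mul, Polynomial.eval_X, Polynomial.eval_ofNat]
  omega

theorem lt_two_pow_sz_prod (a b : ℕ) : a + b < 2 ^ sz (a, b) := by
  have ha := lt_two_pow_sz a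
  have hb := lt_two_pow_sz b
  have h₁ : 2 ^ sz a ≤ 2 ^ (sz a + sz b) := Nat.pow_le_pow_right (by simp) (by omega)
  have h₂ : 2 ^ sz b ≤ 2 ^ (sz a + sz b) := Nat.pow_le_pow_right (by simp) (by omega)
  rw [sz_prod, pow_succ]
  omega

theorem msb_addIter_add (a b : ℕ) : msb (addIter false a b (sz (a, b))).2.2.2 = a + b := by
  have hk := lt_two_pow_sz_prod a b
  obtain ⟨h, -⟩ := addIter_final false (a := a) (b := b) (k := sz (a, b)) (by omega) (by omega)
  generalize addIter false a b (sz (a, b)) = x at *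
  have hk' : (a + b : ℤ) < 2 ^ sz (a, b) := by exact_mod_cast hk
  cases hc : x.2.2.1 <;> simp [hc] at h <;> omega

theorem carry_addIter_sub (a b : ℕ) :
    (addIter true a b (sz (a, b))).2.2.1 = true ↔ a < b := by
  have hk := lt_two_pow_sz_prod a b
  obtain ⟨h, h'⟩ := addIter_final true (a := a) (b := b) (k := sz (a, b)) (by omega) (by omega)
  generalize addIter true a b (sz (a, b)) = x at *
  have h'' : (msb x.2.2.2 : ℤ) < 2 ^ sz (a, b) := by exact_mod_cast h'
  cases hc : x.2.2.1 <;> simp [hc] at h ⊢ <;> omega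

theorem msb_addIter_sub {a b : ℕ} (hab : b ≤ a) :
    msb (addIter true a b (sz (a, b))).2.2.2 = a - b := by
  have hk := lt_two_pow_sz_prod a b
  obtain ⟨h, h'⟩ := addIter_final true (a := a) (b := b) (k := sz (a, b)) (by omega) (by omega)
  have hc := (carry_addIter_sub a b).not.2 (by omega)
  generalize addIter true a b (sz (a, b)) = x at *
  simp [hc] at h
  omega

/-- Schoolbook multiplication, the least significant bit of one factor first. -/
theorem foldl_mul (l : List Bool) : ∀ y s : ℕ,
    l.foldl (fun s b => (Nat.bit false s.1, if b = true then s.2 + s.1 else s.2)) (y, s) =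
      (y * 2 ^ l.length, s + y * msb l.reverse) := by
  induction l with
  | nil => intro y s; simp [msb]
  | cons b l ih =>
    intro y s
    rw [List.foldl_cons, ih, List.reverse_cons, msb_append_singleton, Nat.bit_val, Nat.bit_val,
      List.length_cons, pow_succ]
    cases b <;> simp <;> constructor <;> ring

/-- One step of the division by `m`: the next bit of the dividend is appended to the remainder. -/
def divStep (m : ℕ) (s : ℕ × ℕ) (b : Bool) : ℕ × ℕ :=
  if m ≤ Nat.bit b s.2 then (Nat.bit true s.1, Nat.bit b s.2 - m) else
    (Nat.bit false s.1, Nat.bit b s.2)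

/-- The invariant of the long division, for the bits of the dividend that have been processed. -/
theorem foldl_divStep (m : ℕ) (l : List Bool) :
    (l.foldl (divStep m) (0, 0)).1 * m + (l.foldl (divStep m) (0, 0)).2 = msb l ∧
      (0 < m → (l.foldl (divStep m) (0, 0)).2 < m) ∧
      (l.foldl (divStep m) (0, 0)).1 < 2 ^ l.length := by
  induction l using List.reverseRecOn with
  | nil => simp [msb]
  | append_singleton l b ih =>
    obtain ⟨h₁, h₂, h₃⟩ := ih
    rw [List.foldl_append, List.foldl_cons, List.foldl_nil, msb_append_singleton]
    generalize l.foldl (divStep m) (0, 0) = s at *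
    obtain ⟨q, r⟩ := s
    dsimp only at h₁ h₂ h₃
    have hl : (l ++ [b]).length = l.length + 1 := by simp
    rw [← h₁, hl, pow_succ]
    have hb : b.toNat ≤ 1 := Bool.toNat_le b
    by_cases h : m ≤ Nat.bit b r
    · simp only [divStep, h, if_true]
      simp only [Nat.bit_val, Bool.toNat_true] at h ⊢
      refine ⟨?_, ?_, by omega⟩
      · zify [h]; ring
      · intro hm
        have := h₂ hm
        omega
    · simp only [divStep, h, if_false]
      simp only [Nat.bit_val, Bool.toNat_false] at h ⊢
      refine ⟨by ring, ?_, by omega⟩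
      intro hm
      omega

namespace PTF

variable {α β γ : Type} [TreeRep α] [TreeRep β] [TreeRep γ]

@[fun_prop]
theorem natAdd {f g : α → ℕ} (hf : PTF f) (hg : PTF g) : PTF fun a => f a + g a := by
  have h : PTF fun x : ℕ × ℕ => LSFix.msb (addIter false x.1 x.2 (sz x)).2.2.2 :=
    msb (snd (snd (snd (addIter_ptf false))))
  exact (h.comp (prodMk hf hg)).congr fun a => (msb_addIter_add _ _).symm

@[fun_prop]
theorem natLt {f g : α → ℕ} (hf : PTF f) (hg : PTF g) : PTF fun a => f a < g a := by
  have h : PTF fun x : ℕ × ℕ => (addIter true x.1 x.2 (sz x)).2.2.1 = true :=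
    eq (fst (snd (snd (addIter_ptf true)))) (const _)
  exact (h.comp (prodMk hf hg)).congr fun a => propext (carry_addIter_sub _ _).symm

@[fun_prop]
theorem natLe {f g : α → ℕ} (hf : PTF f) (hg : PTF g) : PTF fun a => f a ≤ g a :=
  (not (natLt hg hf)).congr fun a => by simp

@[fun_prop]
theorem natSub {f g : α → ℕ} (hf : PTF f) (hg : PTF g) : PTF fun a => f a - g a := by
  have h : PTF fun x : ℕ × ℕ => LSFix.msb (addIter true x.1 x.2 (sz x)).2.2.2 :=
    msb (snd (snd (snd (addIter_ptf true))))
  refine (ite (natLe hg hf) (h.comp (prodMk hf hg)) (const 0)).congr fun a => ?_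
  split_ifs with hab
  · exact (msb_addIter_sub hab).symm
  · omega

@[fun_prop]
theorem natMul {f g : α → ℕ} (hf : PTF f) (hg : PTF g) : PTF fun a => f a * g a := by
  have h := foldl (α := ℕ × ℕ)
    (h := fun x : (ℕ × ℕ) × (ℕ × ℕ) × Bool =>
      (Nat.bit false x.2.1.1, if x.2.2 = true then x.2.1.2 + x.2.1.1 else x.2.1.2))
    (l := fun x => x.2.bits) (s := fun x => (x.1, 0)) (by fun_prop) (by fun_prop) (by fun_prop)
    (3 + 8 * Polynomial.X) (by
      rintro ⟨a, b⟩ k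
      dsimp only
      rw [foldl_mul, sz_prod]
      have hl : (b.bits.take k).length ≤ sz b :=
        (List.length_take_le' _ _).trans (length_le_sz b.bits)
      have ha := lt_two_pow_sz a
      have h₁ : a * 2 ^ (b.bits.take k).length < 2 ^ (sz a + sz b) := by
        rw [pow_add]
        exact Nat.mul_lt_mul_of_lt_of_le ha (Nat.pow_le_pow_right (by simp) hl) (by positivity)
      have h₂ : 0 + a * LSFix.msb (b.bits.take k).reverse < 2 ^ (sz a + sz b) := by
        have h₃ := msb_lt (b.bits.take k).reverse
        rw [List.length_reverse] at h₃
        exact (Nat.zero_add _).le.trans_lt ((Nat.mul_le_mul_left _ h₃.le).trans_lt h₁)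
      have e₁ := sz_le_of_lt h₁
      have e₂ := sz_le_of_lt h₂
      have e₃ := sz_prod a b
      simp only [Polynomial.eval_add, Polynomial.eval_mul, Polynomial.eval_X,
        Polynomial.eval_ofNat]
      omega)
  refine ((snd h).comp (prodMk hf hg)).congr fun a => ?_
  dsimp only
  rw [foldl_mul, msb_reverse_bits, Nat.zero_add]

@[fun_prop]
theorem natDiv {f g : α → ℕ} (hf : PTF f) (hg : PTF g) : PTF fun a => f a / g a := by
  have h := foldl (α := ℕ × ℕ)
    (h := fun x : (ℕ × ℕ) × (ℕ × ℕ) × Bool => divStep x.1.2 x.2.1 x.2.2)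
    (l := fun x => x.1.bits.reverse) (s := fun _ => (0, 0)) (by unfold divStep; fun_prop)
    (by fun_prop) (by fun_prop) (4 + 8 * Polynomial.X) (by
      rintro ⟨a, b⟩ k
      dsimp only
      obtain ⟨h₁, h₂, h₃⟩ := foldl_divStep b (a.bits.reverse.take k)
      have hl : (a.bits.reverse.take k).length ≤ sz a := by
        refine (List.length_take_le' _ _).trans ?_
        rw [List.length_reverse]
        exact length_le_sz a.bits
      have h₄ := msb_lt (a.bits.reverse.take k)
      have h₅ := Nat.pow_le_pow_right (n := 2) (by simp) hl
      generalize hs : (a.bits.reverse.take k).foldl (divStep b) (0, 0) = s at *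
      obtain ⟨q, r⟩ := s
      dsimp only at h₁ h₂ h₃
      have e₁ := sz_le_of_lt (h₃.trans_le h₅)
      have e₂ : sz r ≤ 1 + 4 * sz a := sz_le_of_lt (by omega)
      have e₃ := sz_prod a b
      rw [sz_prod]
      simp only [Polynomial.eval_add, Polynomial.eval_mul, Polynomial.eval_X,
        Polynomial.eval_ofNat]
      omega)
  refine (ite (P := fun a => g a = 0) (by fun_prop) (const 0)
    ((fst h).comp (prodMk hf hg))).congr fun a => ?_
  dsimp only
  split_ifs with h0
  · rw [h0, Nat.div_zero]
  · obtain ⟨h₁, h₂, h₃⟩ := foldl_divStep (g a) (f a).bits.reverse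
    rw [msb_reverse_bits] at h₁
    have hpos := Nat.pos_of_ne_zero h0
    have := h₂ hpos
    rw [Nat.div_eq_iff hpos]
    generalize (f a).bits.reverse.foldl (divStep (g a)) (0, 0) = s at *
    omega

end PTF

/-! ### Integers and constants -/

/-- Integers are represented by sign and absolute value. -/
instance : TreeRep ℤ where
  enc z := enc (decide (z < 0), z.natAbs)
  inj m n h := by
    have h := inj h
    simp only [Prod.mk.injEq, decide_eq_decide] at h
    omega

/-- Constants are represented by a tag and the integer or word. -/
noncomputable instance : TreeRep Const where
  enc
    | .num z => enc (True, z)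
    | .sym w => enc (False, w)
  inj a b h := by
    cases a <;> cases b
    · simpa using inj h
    · exact absurd (congrArg Prod.fst
        (inj (α := T × T) (a₁ := (enc True, _)) (a₂ := (enc False, _)) h)) (by
          simp [enc_true, enc_false])
    · exact absurd (congrArg Prod.fst
        (inj (α := T × T) (a₁ := (enc False, _)) (a₂ := (enc True, _)) h)) (by
          simp [enc_true, enc_false])
    · simpa using inj h

/-- The constant is an integer. -/
def Const.IsNum (c : Const) : Prop := ∃ z, c = .num z

namespace PTF

variable {α β γ : Type} [TreeRep α] [TreeRep β] [TreeRep γ]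

@[fun_prop]
theorem natAbs {f : α → ℤ} (hf : PTF f) : PTF fun a => (f a).natAbs :=
  snd (f := fun a => (decide (f a < 0), (f a).natAbs)) hf

theorem intNeg {f : α → ℤ} (hf : PTF f) : PTF fun a => f a < 0 := by
  have : PTF fun a => decide (f a < 0) := fst (f := fun a => (decide (f a < 0), (f a).natAbs)) hf
  exact (eq this (const true)).congr fun a => by simp

@[fun_prop]
theorem toNat {f : α → ℤ} (hf : PTF f) : PTF fun a => (f a).toNat :=
  (ite (intNeg hf) (const 0) (natAbs hf)).congr fun a => by split_ifs <;> omega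

theorem toNat_neg {f : α → ℤ} (hf : PTF f) : PTF fun a => (-f a).toNat :=
  (ite (intNeg hf) (natAbs hf) (const 0)).congr fun a => by split_ifs <;> omega

theorem natCast_sub {f g : α → ℕ} (hf : PTF f) (hg : PTF g) :
    PTF fun a => (f a : ℤ) - (g a : ℤ) := by
  have h : PTF fun a => (decide (f a < g a), if f a < g a then g a - f a else f a - g a) := by
    fun_prop
  refine of_enc_eq h fun a => ?_
  show enc (decide ((f a : ℤ) - (g a : ℤ) < 0), ((f a : ℤ) - (g a : ℤ)).natAbs) = _
  congr 1
  split_ifs with hlt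
  · simp [hlt]; omega
  · simp [hlt]; omega

@[fun_prop]
theorem intAdd {f g : α → ℤ} (hf : PTF f) (hg : PTF g) : PTF fun a => f a + g a :=
  (natCast_sub (natAdd (toNat hf) (toNat hg)) (natAdd (toNat_neg hf) (toNat_neg hg))).congr
    fun a => by omega

@[fun_prop]
theorem intSub {f g : α → ℤ} (hf : PTF f) (hg : PTF g) : PTF fun a => f a - g a :=
  (natCast_sub (natAdd (toNat hf) (toNat_neg hg)) (natAdd (toNat_neg hf) (toNat hg))).congr
    fun a => by omega

@[fun_prop]
theorem intMul {f g : α → ℤ} (hf : PTF f) (hg : PTF g) : PTF fun a => f a * g a := by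
  refine (natCast_sub (natAdd (natMul (toNat hf) (toNat hg)) (natMul (toNat_neg hf) (toNat_neg hg)))
    (natAdd (natMul (toNat hf) (toNat_neg hg)) (natMul (toNat_neg hf) (toNat hg)))).congr
    fun a => ?_
  have hf := Int.toNat_sub_toNat_neg (f a)
  have hg := Int.toNat_sub_toNat_neg (g a)
  generalize (f a).toNat = p at *
  generalize (-f a).toNat = q at *
  generalize (g a).toNat = r at *
  generalize (-g a).toNat = s at *
  rw [← hf, ← hg]
  push_cast
  ring

@[fun_prop]
theorem intLt {f g : α → ℤ} (hf : PTF f) (hg : PTF g) : PTF fun a => f a < g a :=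
  (intNeg (intSub hf hg)).congr fun a => by simp

@[fun_prop]
theorem intLe {f g : α → ℤ} (hf : PTF f) (hg : PTF g) : PTF fun a => f a ≤ g a :=
  (not (intLt hg hf)).congr fun a => by simp

theorem intSum {ι : Type} {f : ι → α → ℤ} (s : Finset ι) (hf : ∀ i, PTF (f i)) :
    PTF fun a => ∑ i ∈ s, f i a := by
  classical
  induction s using Finset.induction_on with
  | empty => exact (const 0).congr fun a => by simp
  | insert i s hi ih => exact (intAdd (hf i) ih).congr fun a => by rw [Finset.sum_insert hi]

@[fun_prop]
theorem num {f : α → ℤ} (hf : PTF f) : PTF fun a => Const.num (f a) :=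
  of_enc_eq (prodMk (const True) hf) fun _ => rfl

@[fun_prop]
theorem sym {f : α → List Bool} (hf : PTF f) : PTF fun a => Const.sym (f a) :=
  of_enc_eq (prodMk (const False) hf) fun _ => rfl

@[fun_prop]
theorem isNum {f : α → Const} (hf : PTF f) : PTF fun a => (f a).IsNum := by
  have h : PTF fun c : Const => c.IsNum := by
    have : PT (fun c : Const => enc c) fun c : Const => .node (enc c.IsNum)
        (match c with | .num z => enc z | .sym w => enc w) := by
      refine of_enc_eq (PTF.id (α := Const)) (g := fun c : Const => T.node (enc c.IsNum)
        (match c with | .num z => enc z | .sym w => enc w)) fun c => ?_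
      cases c with
      | num z =>
        rw [eq_true (show (Const.num z).IsNum from ⟨z, rfl⟩)]; rfl
      | sym w =>
        rw [eq_false (show ¬ (Const.sym w).IsNum from fun ⟨z, h⟩ => by cases h)]; rfl
    exact this.trans (.fst (fun c : Const => enc c.IsNum) _)
  exact h.comp hf

@[fun_prop]
theorem val {f : α → Const} (hf : PTF f) : PTF fun a => (f a).val := by
  have h : PTF Const.val := by
    refine ite_subtype (P := Const.IsNum) (isNum PTF.id) ?_ ?_
    · have : PT (fun c : {c : Const // c.IsNum} => T.node (enc True) (enc c.1.val))
          (fun c => enc c.1.val) := .snd (fun _ => enc True) _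
      unfold PTF
      convert this using 2 with c
      obtain ⟨_, z, rfl⟩ := c
      rfl
    · refine (const (0 : ℤ)).congr fun c => ?_
      obtain ⟨c, hc⟩ := c
      cases c with
      | num z => exact absurd ⟨z, rfl⟩ hc
      | sym w => rfl
  exact h.comp hf

theorem holds (op : CmpOp) {f g : α → Const} (hf : PTF f) (hg : PTF g) :
    PTF fun a => op.Holds (f a) (g a) := by
  cases op
  case eq => exact eq hf hg
  case ne => exact not (eq hf hg)
  case lt =>
    refine (and (and (isNum hf) (isNum hg)) (intLt (val hf) (val hg))).congr fun a => ?_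
    cases f a <;> cases g a <;> simp [CmpOp.Holds, Const.IsNum, Const.val]
  case gt =>
    refine (and (and (isNum hf) (isNum hg)) (intLt (val hg) (val hf))).congr fun a => ?_
    cases f a <;> cases g a <;> simp [CmpOp.Holds, Const.IsNum, Const.val]
  case le =>
    refine (and (and (isNum hf) (isNum hg)) (intLe (val hf) (val hg))).congr fun a => ?_
    cases f a <;> cases g a <;> simp [CmpOp.Holds, Const.IsNum, Const.val]
  case ge =>
    refine (and (and (isNum hf) (isNum hg)) (intLe (val hg) (val hf))).congr fun a => ?_
    cases f a <;> cases g a <;> simp [CmpOp.Holds, Const.IsNum, Const.val]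

end PTF

end LSFix

namespace LSFix

open TreeRep

/-! ### Representation of database tuples and decoding of inputs -/

/-- A tree for each natural number, used to represent the elements of finite types. -/
def unary : ℕ → T
  | 0 => .nil
  | n + 1 => .node .nil (unary n)

theorem unary_injective : Function.Injective unary := by
  intro m n h
  induction m generalizing n with
  | zero => cases n <;> simp_all [unary]
  | succ m ih =>
    cases n with
    | zero => simp [unary] at h
    | succ n => simp only [unary, T.node.injEq, true_and] at h; rw [ih h]

/-- Elements of a finite type are represented by their index in an enumeration. -/
@[reducible] noncomputable def TreeRep.ofFinite (X : Type) [Finite X] : TreeRep X where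
  enc x := unary (Finite.equivFin X x)
  inj := unary_injective.comp (Fin.val_injective.comp (Finite.equivFin X).injective)

variable {S : Schema}

noncomputable instance : TreeRep S.Rel := .ofFinite _

instance : Finite (Letter S) := by
  let f : Letter S → (S.Rel ⊕ Bool) ⊕ (Bool ⊕ Bool)
    | .rel R => .inl (.inl R)
    | .int b => .inl (.inr b)
    | .sym => .inr (.inl false)
    | .answer => .inr (.inl true)
    | .bit b => .inr (.inr b)
  refine Finite.of_injective f fun a b h => ?_
  cases a <;> cases b <;> simp_all [f]

noncomputable instance : TreeRep (Letter S) := .ofFinite _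

noncomputable instance : TreeRep (Fact S) where
  enc f := .node (enc f.1) (enc f.2)
  inj f g h := by
    obtain ⟨R, t⟩ := f
    obtain ⟨R', t'⟩ := g
    simp only [T.node.injEq] at h
    obtain rfl := inj h.1
    rw [inj h.2]

/-- The arguments of a database tuple of relation `R` (with default values for a tuple of another
relation). -/
def factArgs (R : S.Rel) (f : Fact S) : Tuple S R :=
  if h : f.1 = R then h ▸ f.2 else fun _ => .num 0

@[simp] theorem factArgs_mk (R : S.Rel) (t : Tuple S R) : factArgs R ⟨R, t⟩ = t := by
  simp [factArgs]

theorem eq_mk_factArgs {R : S.Rel} {f : Fact S} (h : f.1 = R) : f = ⟨R, factArgs R f⟩ := by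
  obtain ⟨R', t⟩ := f
  dsimp only at h
  subst h
  simp

namespace PTF

variable {α β : Type} [TreeRep α] [TreeRep β]

theorem rel {f : α → Fact S} (hf : PTF f) : PTF fun a => (f a).1 :=
  PT.trans hf (PT.fst (fun a => enc (f a).1) fun a => enc (f a).2)

theorem factMk (R : S.Rel) {f : α → Tuple S R} (hf : PTF f) :
    PTF fun a => (⟨R, f a⟩ : Fact S) :=
  PT.node (const R) hf

theorem args (R : S.Rel) {f : α → Fact S} (hf : PTF f) : PTF fun a => factArgs R (f a) := by
  have h : PTF fun f : Fact S => factArgs R f := by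
    have hrel : PTF fun f : Fact S => f.1 := rel (f := fun f => f) PTF.id
    have hR : PTF fun f : Fact S => f.1 = R := eq hrel (const R)
    refine ite_subtype hR ?_ ?_
    · have h := PT.snd (fun f : {f : Fact S // f.1 = R} => enc f.1.1) (fun f => enc f.1.2)
      have e : (fun f : {f : Fact S // f.1 = R} => enc (factArgs R f.1)) =
          fun f => enc f.1.2 := by
        funext ⟨⟨R', t⟩, hf⟩
        dsimp only at hf
        subst hf
        rw [factArgs_mk]
      unfold PTF
      rw [e]
      exact h
    · refine (const fun _ => Const.num 0).congr fun f => ?_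
      rw [factArgs, dif_neg f.2]
  exact h.comp hf

theorem getD {d : β} {l : α → List β} (hl : PTF l) (n : ℕ) : PTF fun a => (l a).getD n d := by
  induction n generalizing l with
  | zero =>
    refine (headD hl (d := d)).congr fun a => ?_
    cases l a <;> rfl
  | succ n ih =>
    refine (ih (tail hl)).congr fun a => ?_
    cases l a <;> simp

end PTF

/-- The state of the decoder, which reads an input word from the right: bits and constants that have
been read and do not yet belong to a constant or a tuple, database tuples, and the candidate
answer. -/
abbrev DecodeState (S : Schema) (n : ℕ) : Type :=
  List Bool × List Const × List (Fact S) × (Fin n → Const)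

/-- One step of the decoder. -/
def decodeStep {n : ℕ} : Letter S → DecodeState S n → DecodeState S n
  | .bit x, (b, cs, fs, t) => (x :: b, cs, fs, t)
  | .int s, (b, cs, fs, t) =>
    ([], .num (if s = true then (0 : ℕ) - (msb b.reverse : ℕ) else (msb b.reverse : ℕ) - (0 : ℕ))
      :: cs, fs, t)
  | .sym, (b, cs, fs, t) => ([], .sym b :: cs, fs, t)
  | .answer, (_, cs, fs, _) => ([], [], fs, fun i => cs.getD i (.num 0))
  | .rel R, (_, cs, fs, t) => ([], [], ⟨R, fun i => cs.getD i (.num 0)⟩ :: fs, t)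

/-- The initial state of the decoder. -/
def decodeInit (S : Schema) (n : ℕ) : DecodeState S n := ([], [], [], fun _ => .num 0)

theorem foldr_decodeStep_const {n : ℕ} (c : Const) (cs : List Const) (fs : List (Fact S))
    (t : Fin n → Const) :
    (encodeConst c).foldr decodeStep ([], cs, fs, t) = ([], c :: cs, fs, t) := by
  have h : ∀ w b : List Bool, (w.map Letter.bit).foldr decodeStep (b, cs, fs, t) =
      (w ++ b, cs, fs, t) := by
    intro w b
    induction w with
    | nil => rfl
    | cons x w ih => rw [List.map_cons, List.foldr_cons, ih]; rfl
  cases c with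
  | num z =>
    rw [encodeConst, List.foldr_cons, h, List.append_nil, decodeStep, msb_reverse_bits]
    congr 3
    by_cases hz : z < 0
    · simp only [hz, decide_true, if_true]; congr 1; omega
    · simp only [hz, decide_false]; congr 1; simp; omega
  | sym w => rw [encodeConst, List.foldr_cons, h, List.append_nil]; rfl

theorem foldr_decodeStep_tuple {n m : ℕ} (u : Fin m → Const) (fs : List (Fact S))
    (t : Fin n → Const) :
    (encodeTuple u).foldr decodeStep ([], [], fs, t) = ([], List.ofFn u, fs, t) := by
  have h : ∀ l : List Const, (l.flatMap encodeConst).foldr decodeStep ([], [], fs, t) =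
      ([], l, fs, t) := by
    intro l
    induction l with
    | nil => rfl
    | cons c l ih => rw [List.flatMap_cons, List.foldr_append, ih, foldr_decodeStep_const]
  exact h _

theorem getD_ofFn {n : ℕ} (t : Fin n → Const) (d : Const) :
    (fun i : Fin n => (List.ofFn t).getD i d) = t := by
  funext i
  simp [List.getD_eq_getElem?_getD]

theorem foldr_decodeStep_input (Q : Query S) (p : Input Q) :
    (encodeInput Q p).foldr decodeStep (decodeInit S Q.numFree) = ([], [], p.1, p.2) := by
  obtain ⟨D, c⟩ := p
  rw [encodeInput, List.foldr_append, List.foldr_cons, decodeInit, foldr_decodeStep_tuple,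
    decodeStep, getD_ofFn]
  dsimp only
  induction D with
  | nil => rfl
  | cons f D ih =>
    rw [List.flatMap_cons, List.foldr_append, ih, encodeFact, List.foldr_cons,
      foldr_decodeStep_tuple, decodeStep, getD_ofFn]

theorem decodeStep_ptf {n : ℕ} (a : Letter S) : PTF fun s : DecodeState S n => decodeStep a s := by
  cases a with
  | bit x =>
    have : PTF fun s : DecodeState S n => (x :: s.1, s.2.1, s.2.2.1, s.2.2.2) := by fun_prop
    exact this
  | int s =>
    have h : PTF fun s : DecodeState S n => (0 : ℕ) - (msb s.1.reverse : ℤ) :=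
      PTF.natCast_sub (.const 0) (by fun_prop)
    have h' : PTF fun s : DecodeState S n => (msb s.1.reverse : ℤ) - (0 : ℕ) :=
      PTF.natCast_sub (by fun_prop) (.const 0)
    have : PTF fun x : DecodeState S n => (([] : List Bool), Const.num (if s = true then
      (0 : ℕ) - (msb x.1.reverse : ℤ) else (msb x.1.reverse : ℤ) - (0 : ℕ)) :: x.2.1,
        x.2.2.1, x.2.2.2) := by
      fun_prop
    exact this
  | sym =>
    have : PTF fun x : DecodeState S n => (([] : List Bool), Const.sym x.1 :: x.2.1, x.2.2) := by
      fun_prop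
    exact this
  | answer =>
    exact PTF.prodMk (.const []) (.prodMk (.const []) (.prodMk (by fun_prop)
      (.pi fun i => .getD (d := Const.num 0) (by fun_prop) i)))
  | rel R =>
    exact PTF.prodMk (.const []) (.prodMk (.const []) (.prodMk (.cons (.factMk R
      (.pi fun i => .getD (d := Const.num 0) (by fun_prop) i)) (by fun_prop)) (by fun_prop)))

theorem sz_msb_reverse_le (b : List Bool) : sz (msb b.reverse) ≤ sz b := by
  induction b with
  | nil => exact le_rfl
  | cons x b ih =>
    rw [List.reverse_cons, msb_append_singleton]
    by_cases h : msb b.reverse = 0 ∧ x = false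
    · rw [h.1, h.2]
      exact T.size_pos _
    · have e : (Nat.bit x (msb b.reverse)).bits = x :: (msb b.reverse).bits :=
        Nat.bits_append_bit _ _ fun h0 => by
          by_contra h1
          exact h ⟨h0, by simpa using h1⟩
      have : sz (Nat.bit x (msb b.reverse)) = sz x + sz (msb b.reverse) + 1 := by
        show sz (Nat.bit x (msb b.reverse)).bits = _
        rw [e, sz_cons]
        rfl
      rw [this, sz_cons]
      omega

theorem sz_getD_le (m : ℕ) : ∀ cs : List Const,
    sz (fun i : Fin m => cs.getD i (.num 0)) ≤ sz cs + m * (sz (Const.num 0) + 1) + 1 := by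
  induction m with
  | zero => intro cs; rw [sz, enc_fin_zero]; simp
  | succ m ih =>
    intro cs
    rw [sz, enc_fin_succ, T.size_node]
    cases cs with
    | nil =>
      have := ih []
      rw [show Fin.tail (fun i : Fin (m + 1) => ([] : List Const).getD i (.num 0)) =
        fun i : Fin m => ([] : List Const).getD i (.num 0) from rfl, Nat.succ_mul]
      simp only [List.getD_nil] at this ⊢
      unfold sz at *
      omega
    | cons c cs =>
      have := ih cs
      rw [show Fin.tail (fun i : Fin (m + 1) => (c :: cs).getD i (.num 0)) =
        fun i : Fin m => cs.getD i (.num 0) from funext fun i => by simp [Fin.tail],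
        Nat.succ_mul, sz_cons]
      simp only [Fin.val_zero, List.getD_cons_zero]
      unfold sz at *
      omega

theorem sz_decodeStep_le (S : Schema) (n : ℕ) :
    ∃ K : ℕ, ∀ (a : Letter S) (s : DecodeState S n), sz (decodeStep a s) ≤ sz s + K := by
  have h : ∀ a : Letter S, ∃ K : ℕ, ∀ s : DecodeState S n, sz (decodeStep a s) ≤ sz s + K := by
    intro a
    cases a with
    | bit x =>
      refine ⟨4, fun ⟨b, cs, fs, t⟩ => ?_⟩
      have := sz_bool_le x
      simp only [decodeStep, sz_prod, sz_cons]
      omega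
    | int s =>
      refine ⟨20, fun ⟨b, cs, fs, t⟩ => ?_⟩
      simp only [decodeStep, sz_prod, sz_cons, sz_nil]
      have h₁ : ∀ z : ℤ, sz (Const.num z) = sz True + (sz (decide (z < 0)) + sz z.natAbs + 1) + 1 :=
        fun z => rfl
      have h₂ := sz_msb_reverse_le b
      have h₃ := sz_prop_le True
      rw [h₁]
      generalize hz : (if s = true then (0 : ℕ) - (msb b.reverse : ℤ) else
        (msb b.reverse : ℤ) - (0 : ℕ)) = z
      have h₄ := sz_bool_le (decide (z < 0))
      have h₅ : z.natAbs = msb b.reverse := by rw [← hz]; split_ifs <;> omega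
      rw [h₅]
      omega
    | sym =>
      refine ⟨20, fun ⟨b, cs, fs, t⟩ => ?_⟩
      simp only [decodeStep, sz_prod, sz_cons, sz_nil]
      have h₁ : sz (Const.sym b) = sz False + sz b + 1 := rfl
      have h₃ := sz_prop_le False
      rw [h₁]
      omega
    | answer =>
      refine ⟨n * (sz (Const.num 0) + 1) + 20, fun ⟨b, cs, fs, t⟩ => ?_⟩
      have := sz_getD_le n cs
      simp only [decodeStep, sz_prod, sz_nil]
      omega
    | rel R =>
      refine ⟨S.arity R * (sz (Const.num 0) + 1) + sz R + 20, fun ⟨b, cs, fs, t⟩ => ?_⟩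
      have h₁ := sz_getD_le (S.arity R) cs
      have h₂ : ∀ u : Tuple S R, sz (⟨R, u⟩ : Fact S) = sz R + sz u + 1 := fun u => rfl
      simp only [decodeStep, sz_prod, sz_nil, sz_cons, h₂]
      omega
  choose K hK using h
  obtain ⟨M, hM⟩ := Finite.exists_le K
  exact ⟨M, fun a s => (hK a s).trans (Nat.add_le_add_left (hM a) _)⟩

/-- The decoder runs in polynomial time; its input is the reversed word. -/
theorem decode_ptf (S : Schema) (n : ℕ) :
    PTF fun w : List (Letter S) => w.reverse.foldr decodeStep (decodeInit S n) := by
  obtain ⟨K, hK⟩ := sz_decodeStep_le S n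
  have hs : PTF fun x : List (Letter S) × DecodeState S n × Letter S =>
      decodeStep x.2.2 x.2.1 := by
    have hl : PTF fun x : List (Letter S) × DecodeState S n × Letter S => x.2.2 :=
      .snd (.snd .id)
    have hx : PTF fun x : List (Letter S) × DecodeState S n × Letter S => x.2.1 :=
      .fst (.snd .id)
    exact PTF.finCases (F := fun a (x : List (Letter S) × DecodeState S n × Letter S) =>
      decodeStep a x.2.1) hl fun a => (decodeStep_ptf a).comp hx
  have h := PTF.foldl (α := List (Letter S)) (l := fun w => w) (s := fun _ => decodeInit S n)
    hs .id (.const _) (Polynomial.C (sz (decodeInit S n)) + Polynomial.C K * Polynomial.X)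
    (by
      intro w k
      have key : ∀ (w : List (Letter S)) (s : DecodeState S n),
          sz (w.foldl (fun s a => decodeStep a s) s) ≤ sz s + K * w.length := by
        intro w
        induction w with
        | nil => intro s; simp
        | cons a w ih =>
          intro s
          rw [List.foldl_cons]
          refine (ih _).trans ?_
          have := hK a s
          rw [List.length_cons, Nat.mul_succ]
          omega
      refine (key _ _).trans ?_
      simp only [Polynomial.eval_add, Polynomial.eval_mul, Polynomial.eval_C, Polynomial.eval_X]
      exact Nat.add_le_add_left (Nat.mul_le_mul_left _
        ((List.length_take_le' _ _).trans (length_le_sz w))) _)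
  exact h.congr fun w => by rw [List.foldr_reverse]

/-! ### From polynomial time predicates to Turing machines -/

namespace Prog

variable {A : Type} [TreeRep A]

open Classical in
/-- Pushes the letter on top of the input stack on the list on the main stack, if the letter is
among the given ones. For an empty list the instruction is arbitrary. -/
noncomputable def readLetter : List A → Prog A
  | [] => .pop .cnt
  | a :: as => .ite .inp (fun o => o = some a)
      (.seq (pushTree (enc a)) (.push .main (some true))) (readLetter as)

/-- Moves the input to the main stack, as a list in reverse order. -/
noncomputable def read (as : List A) : Prog A :=
  .seq (.push .main (some false))
    (.loop .inp (fun o => o.isSome) (.seq (readLetter as) (.pop .inp)))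

theorem runLe_readLetter {a : A} {as : List A} (ha : a ∈ as) (i : List A) (o : List Bool)
    (m l : List (Option Bool)) :
    RunLe (readLetter as) (st (a :: i) o m [] [] l)
      (st (a :: i) o (some true :: ((enc a).cells ++ m)) [] [] l)
      (as.length + (enc a).size + 1) := by
  induction as with
  | nil => simp at ha
  | cons b as ih =>
    by_cases hb : a = b
    · subst hb
      exact RunLe.mono (RunLe.iteTrue (by simp [st]) (RunLe.seq (runLe_pushTree _ _)
        (runLe_push_main _))) (by simp; omega)
    · have := ih ((List.mem_cons.1 ha).resolve_left hb)
      exact RunLe.mono (RunLe.iteFalse (by simp [st, hb]) this) (by simp; omega)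

theorem runLe_read_loop {as : List A} (has : ∀ a, a ∈ as) {M : ℕ} (hM : ∀ a : A, sz a ≤ M)
    (w : List A) : ∀ v : List A,
    RunLe (.loop .inp (fun o => o.isSome) (.seq (readLetter as) (.pop .inp)))
      (st w [] (enc v).cells [] [] []) (st [] [] (enc (w.reverse ++ v)).cells [] [] [])
      (w.length * (as.length + M + 3) + 1) := by
  induction w with
  | nil => intro v; exact RunLe.mono (RunLe.loopFalse rfl) (by simp)
  | cons a w ih =>
    intro v
    have h := ih (a :: v)
    rw [enc_cons, T.cells_node] at h
    rw [show (a :: w).reverse ++ v = w.reverse ++ a :: v by simp]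
    refine RunLe.mono (RunLe.loopTrue rfl (RunLe.seq (runLe_readLetter (has a) _ _ _ _)
      (RunLe.pop _ (update_st_inp ..))) h) ?_
    have := hM a
    unfold sz at this
    rw [List.length_cons, Nat.succ_mul]
    omega

end Prog

theorem sz_list_le {A : Type} [TreeRep A] {M : ℕ} (hM : ∀ a : A, sz a ≤ M) (w : List A) :
    sz w ≤ w.length * (M + 1) + 1 := by
  induction w with
  | nil => simp [sz_nil]
  | cons a w ih =>
    have := hM a
    rw [sz_cons, List.length_cons, Nat.succ_mul]
    omega

/-- Polynomial time predicates of words are decided by polynomial time Turing machines. -/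
theorem inPTIME_of_word {α A : Type} [Finite A] [TreeRep A] (enc : α → List A) (P : Set α)
    {G : List A → Prop} (hG : PTF G) (h : ∀ a, G (enc a).reverse ↔ a ∈ P) : InPTIME enc P := by
  classical
  have := Fintype.ofFinite A
  obtain ⟨M, hM⟩ := Finite.exists_le fun a : A => sz a
  obtain ⟨p, b, hp⟩ := hG A
  let as : List A := Finset.univ.toList
  refine inPTIME_of_prog enc P
    (.seq (Prog.read as) (.seq p (.ite .main (fun o => o = some (some false))
      (.seq (.pop .main) (.push .out false))
      (.seq (.pop .main) (.seq (.pop .main) (.seq (.pop .main) (.push .out true)))))))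
    (1 + (Polynomial.X * Polynomial.C (as.length + M + 3) + 1) +
      (b.comp (Polynomial.X * Polynomial.C (M + 1) + 1) + 5))
    (fun a => decide (a ∈ P)) (fun a => decide_eq_true_iff) fun a => ?_
  have hio : ∀ (i : List A) (o : List Bool), ioStore i o = st i o [] [] [] [] := by
    intro i o
    funext k
    cases k <;> rfl
  rw [hio, hio]
  have hr := Prog.runLe_read_loop (as := as) (fun a => by simp [as]) hM (enc a) []
  rw [List.append_nil] at hr
  have h₁ := hp (enc a).reverse [] [] [] []
  rw [List.append_nil, List.append_nil] at h₁
  have hsz : sz (enc a).reverse ≤ (enc a).length * (M + 1) + 1 := by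
    simpa using sz_list_le hM (enc a).reverse
  refine RunLe.mono (RunLe.seq (RunLe.seq (RunLe.push _ _ (update_st_main ..)) hr)
    (RunLe.seq h₁ (n' := 5) ?_)) ?_
  · by_cases ha : a ∈ P
    · have hg : G (enc a).reverse = True := eq_true ((h a).2 ha)
      simp only [hg, enc_true, ha, decide_true, T.cells_node, T.cells_nil, List.cons_append,
        List.nil_append]
      exact RunLe.mono (RunLe.iteFalse (by simp [st]) (RunLe.seq runLe_pop_main (RunLe.seq
        runLe_pop_main (RunLe.seq runLe_pop_main (RunLe.push _ _ (update_st_out ..)))))) le_rfl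
    · have hg : G (enc a).reverse = False := eq_false (mt (h a).1 ha)
      simp only [hg, enc_false, ha, decide_false, T.cells_nil]
      exact RunLe.mono (RunLe.iteTrue (by simp [st]) (RunLe.seq runLe_pop_main
        (RunLe.push _ _ (update_st_out ..)))) (by norm_num)
  · have := polynomial_eval_mono b hsz
    simp only [Polynomial.eval_add, Polynomial.eval_mul, Polynomial.eval_X, Polynomial.eval_C,
      Polynomial.eval_comp, Polynomial.eval_one, Polynomial.eval_ofNat] at this ⊢
    unfold sz at this
    omega

/-- Polynomial time predicates of inputs are decided by polynomial time Turing machines. -/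
theorem inPTIME_of_ptf (Q : Query S) (P : Set (Input Q)) (hP : PTF fun p : Input Q => p ∈ P) :
    InPTIME (encodeInput Q) P := by
  have hG : PTF fun w : List (Letter S) =>
      ((w.reverse.foldr decodeStep (decodeInit S Q.numFree)).2.2.1,
        (w.reverse.foldr decodeStep (decodeInit S Q.numFree)).2.2.2) ∈ P :=
    hP.comp (.prodMk (.fst (.snd (.snd (decode_ptf S _)))) (.snd (.snd (.snd (decode_ptf S _)))))
  refine inPTIME_of_word _ P hG fun p => ?_
  rw [List.reverse_reverse, foldr_decodeStep_input]

end LSFix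

namespace LSFix

variable {S : Schema}

/-! ### Fixes are made tuple by tuple -/

/-- The database tuple violates none of the denials. -/
def Valid (IC : Finset (OneAtomDenial S)) (f : Fact S) : Prop :=
  ∀ ic ∈ IC, ¬ ∃ ν, ic.atom.ground ν = f ∧ ∀ b ∈ ic.builtIns, b.Holds ν

/-- `t'` is an admissible replacement of the tuple `t` in a fix. -/
structure IsTupleFix (IC : Finset (OneAtomDenial S)) {R : S.Rel} (t t' : Tuple S R) : Prop where
  rigid : RigidEq t t'
  isNum : ∀ i ∈ S.fixable R, (t' i).IsNum
  valid : Valid IC ⟨R, t'⟩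

/-- The contribution of a tuple to the square distance. -/
def tupleCost {R : S.Rel} (t t' : Tuple S R) : ℤ :=
  ∑ i ∈ S.fixable R, ((t i).val - (t' i).val) ^ 2

/-- `t'` is an admissible replacement of `t` at minimal cost. -/
def IsOptFix (IC : Finset (OneAtomDenial S)) {R : S.Rel} (t t' : Tuple S R) : Prop :=
  IsTupleFix IC t t' ∧ ∀ t'', IsTupleFix IC t t'' → tupleCost t t' ≤ tupleCost t t''

theorem mem_tuples {D : Instance S} {R : S.Rel} {t : Tuple S R} :
    t ∈ tuples D R ↔ (⟨R, t⟩ : Fact S) ∈ D := by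
  simp [tuples]

theorem RigidEq.keyOf_eq {R : S.Rel} {t t' : Tuple S R} (h : RigidEq t t') :
    keyOf t = keyOf t' := by
  funext ⟨i, hi⟩
  exact h i (Finset.disjoint_left.1 (S.key_disjoint_fixable R) hi)

theorem tupleCost_nonneg {R : S.Rel} (t t' : Tuple S R) : 0 ≤ tupleCost t t' :=
  Finset.sum_nonneg fun _ _ => sq_nonneg _

theorem exists_isOptFix {IC : Finset (OneAtomDenial S)} {R : S.Rel} {t t' : Tuple S R}
    (h : IsTupleFix IC t t') : ∃ t'', IsOptFix IC t t'' := by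
  obtain ⟨u, hu, hmin⟩ := WellFounded.has_min
    (InvImage.wf (fun u : Tuple S R => (tupleCost t u).toNat) Nat.lt_wfRel.wf)
    {u | IsTupleFix IC t u} ⟨t', h⟩
  refine ⟨u, hu, fun v hv => ?_⟩
  have h₁ : ¬ (tupleCost t v).toNat < (tupleCost t u).toNat := hmin v hv
  have := tupleCost_nonneg t u
  have := tupleCost_nonneg t v
  omega

/-- The relation `R` of the instance `D'` consists of the images under `φ` of the tuples of `D`. -/
def IsImage (φ : ∀ R, Tuple S R → Tuple S R) (D D' : Instance S) : Prop :=
  ∀ R t', t' ∈ tuples D' R ↔ ∃ t ∈ tuples D R, φ R t = t'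

open Classical in
theorem exists_isImage (φ : ∀ R, Tuple S R → Tuple S R) (D : Instance S) :
    ∃ D', IsImage φ D D' := by
  refine ⟨D.image fun f => ⟨f.1, φ f.1 f.2⟩, fun R t' => ?_⟩
  rw [mem_tuples, Finset.mem_image]
  constructor
  · rintro ⟨⟨R', t⟩, ht, h⟩
    obtain rfl : R' = R := congrArg Sigma.fst h
    exact ⟨t, mem_tuples.2 ht, eq_of_heq (Sigma.mk.inj h).2⟩
  · rintro ⟨t, ht, rfl⟩
    exact ⟨⟨R, t⟩, mem_tuples.1 ht, rfl⟩

variable {IC : Finset (OneAtomDenial S)} {D D' : Instance S}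

theorem IsFix.exists_isImage (h : IsFix IC D D') : ∃ φ : ∀ R, Tuple S R → Tuple S R,
    (∀ R, ∀ t ∈ tuples D R, IsTupleFix IC t (φ R t)) ∧ IsImage φ D D' := by
  have hr := h.rigid
  choose! φ hφ hrig using hr
  refine ⟨φ, fun R t ht => ⟨hrig R t ht, h.wellTyped R _ (hφ R t ht), fun ic hic hν => ?_⟩,
    fun R t' => ⟨fun ht' => ?_, ?_⟩⟩
  · obtain ⟨ν, hν, hb⟩ := hν
    refine h.denials ic hic ν ⟨?_, hb⟩
    rw [hν]
    exact mem_tuples.1 (hφ R t ht)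
  · obtain ⟨t, ht, htt'⟩ := h.rigid' R t' ht'
    exact ⟨t, ht, h.keys R _ (hφ R t ht) _ ht'
      ((hrig R t ht).keyOf_eq.symm.trans htt'.keyOf_eq)⟩
  · rintro ⟨t, ht, rfl⟩
    exact hφ R t ht

theorem IsImage.isFix {φ : ∀ R, Tuple S R → Tuple S R} (hK : SatisfiesKeys D)
    (hφ : ∀ R, ∀ t ∈ tuples D R, IsTupleFix IC t (φ R t)) (h : IsImage φ D D') :
    IsFix IC D D' where
  wellTyped R t' ht' i hi := by
    obtain ⟨t, ht, rfl⟩ := (h R t').1 ht'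
    exact (hφ R t ht).isNum i hi
  rigid R t ht := ⟨φ R t, (h R _).2 ⟨t, ht, rfl⟩, (hφ R t ht).rigid⟩
  rigid' R t' ht' := by
    obtain ⟨t, ht, rfl⟩ := (h R t').1 ht'
    exact ⟨t, ht, (hφ R t ht).rigid⟩
  keys R t₁' h₁ t₂' h₂ hk := by
    obtain ⟨t₁, ht₁, rfl⟩ := (h R t₁').1 h₁
    obtain ⟨t₂, ht₂, rfl⟩ := (h R t₂').1 h₂
    rw [hK R t₁ ht₁ t₂ ht₂
      (((hφ R t₁ ht₁).rigid.keyOf_eq.trans hk).trans (hφ R t₂ ht₂).rigid.keyOf_eq.symm)]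
  denials ic hic ν := by
    rintro ⟨hD, hb⟩
    obtain ⟨t, ht, e⟩ := (h _ (ic.atom.ground ν).2).1 (mem_tuples.2 hD)
    exact (hφ _ t ht).valid ic hic ⟨ν, by rw [e], hb⟩

theorem tupleAt_keyOf (hK : SatisfiesKeys D) {R : S.Rel} {t : Tuple S R} (ht : t ∈ tuples D R) :
    tupleAt D R (keyOf t) = t := by
  have h : ∃ t' ∈ tuples D R, keyOf t' = keyOf t := ⟨t, ht, rfl⟩
  rw [tupleAt, dif_pos h]
  exact hK R _ h.choose_spec.1 _ ht h.choose_spec.2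

theorem sqDist_eq_sum {φ : ∀ R, Tuple S R → Tuple S R} (hK : SatisfiesKeys D)
    (hφ : ∀ R, ∀ t ∈ tuples D R, IsTupleFix IC t (φ R t)) (h : IsImage φ D D') :
    sqDist D D' = ∑ R : S.Rel, ∑ t ∈ tuples D R, tupleCost t (φ R t) := by
  have hK' := (h.isFix hK hφ).keys
  refine Finset.sum_congr rfl fun R _ => ?_
  rw [keyVals, Finset.sum_image fun t ht t' ht' => hK R t ht t' ht']
  refine Finset.sum_congr rfl fun t ht => ?_
  rw [tupleAt_keyOf hK ht, (hφ R t ht).rigid.keyOf_eq,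
    tupleAt_keyOf hK' ((h R _).2 ⟨t, ht, rfl⟩)]
  rfl

/-- The least squares fixes arise by replacing each tuple by an optimal one, independently. -/
theorem isLSFix_iff (hK : SatisfiesKeys D) : IsLSFix IC D D' ↔
    ∃ φ : ∀ R, Tuple S R → Tuple S R,
      (∀ R, ∀ t ∈ tuples D R, IsOptFix IC t (φ R t)) ∧ IsImage φ D D' := by
  classical
  constructor
  · intro h
    obtain ⟨φ, hφ, hD'⟩ := h.isFix.exists_isImage
    refine ⟨φ, fun R t ht => ⟨hφ R t ht, fun u hu => ?_⟩, hD'⟩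
    by_contra! hlt
    -- every tuple that can be improved is improved at once
    let ψ : ∀ R, Tuple S R → Tuple S R := fun R t =>
      if h : ∃ u, IsTupleFix IC t u ∧ tupleCost t u < tupleCost t (φ R t) then h.choose else φ R t
    have hψ : ∀ R, ∀ t ∈ tuples D R, IsTupleFix IC t (ψ R t) := by
      intro R t ht
      by_cases h : ∃ u, IsTupleFix IC t u ∧ tupleCost t u < tupleCost t (φ R t)
      · simp only [ψ, dif_pos h]
        exact h.choose_spec.1
      · simp only [ψ, dif_neg h]
        exact hφ R t ht
    have hle : ∀ R t, tupleCost t (ψ R t) ≤ tupleCost t (φ R t) := by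
      intro R t
      by_cases h : ∃ u, IsTupleFix IC t u ∧ tupleCost t u < tupleCost t (φ R t)
      · simp only [ψ, dif_pos h]
        exact h.choose_spec.2.le
      · simp only [ψ, dif_neg h]
        exact le_rfl
    have hlt' : tupleCost t (ψ R t) < tupleCost t (φ R t) := by
      have h : ∃ u, IsTupleFix IC t u ∧ tupleCost t u < tupleCost t (φ R t) := ⟨u, hu, hlt⟩
      simp only [ψ, dif_pos h]
      exact h.choose_spec.2
    obtain ⟨D'', hD''⟩ := LSFix.exists_isImage ψ D
    have := h.minimal D'' (hD''.isFix hK hψ)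
    rw [sqDist_eq_sum hK hφ hD', sqDist_eq_sum hK hψ hD''] at this
    refine absurd this (not_le.2 (Finset.sum_lt_sum
      (fun R _ => Finset.sum_le_sum fun t _ => hle R t) ⟨R, Finset.mem_univ _,
        Finset.sum_lt_sum (fun t _ => hle R t) ⟨t, ht, hlt'⟩⟩))
  · rintro ⟨φ, hφ, hD'⟩
    have hφ' : ∀ R, ∀ t ∈ tuples D R, IsTupleFix IC t (φ R t) := fun R t ht => (hφ R t ht).1
    refine ⟨hD'.isFix hK hφ', fun D'' hfix => ?_⟩
    obtain ⟨ψ, hψ, hD''⟩ := hfix.exists_isImage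
    rw [sqDist_eq_sum hK hφ' hD', sqDist_eq_sum hK hψ hD'']
    exact Finset.sum_le_sum fun R _ => Finset.sum_le_sum fun t ht => (hφ R t ht).2 _ (hψ R t ht)

/-! ### Optimal replacements of a tuple -/

/-- The set contains all integers that occur in the denials. -/
def ContainsConsts (C : Finset ℤ) (IC : Finset (OneAtomDenial S)) : Prop :=
  ∀ ic ∈ IC, (∀ i z, ic.atom.args i = .const (.num z) → z ∈ C) ∧
    ∀ a, BuiltIn.cmp a ∈ ic.builtIns → ∀ z, a.c = .num z → z ∈ C

theorem exists_containsConsts (IC : Finset (OneAtomDenial S)) :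
    ∃ C : Finset ℤ, ContainsConsts C IC := by
  classical
  induction IC using Finset.induction_on with
  | empty => exact ⟨∅, fun ic hic => by simp at hic⟩
  | insert ic IC _ ih =>
    obtain ⟨C, hC⟩ := ih
    let termVal : Term → ℤ := fun τ => match τ with
      | .const c => c.val
      | .var _ => 0
    let builtInVal : BuiltIn → ℤ := fun b => match b with
      | .cmp a => a.c.val
      | _ => 0
    refine ⟨C ∪ (Finset.univ.image fun i => termVal (ic.atom.args i)) ∪
      (ic.builtIns.map builtInVal).toFinset, fun ic' hic' => ?_⟩
    rcases Finset.mem_insert.1 hic' with rfl | hic'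
    · refine ⟨fun i z h => ?_, fun a ha z h => ?_⟩
      · exact Finset.mem_union_left _ (Finset.mem_union_right _
          (Finset.mem_image.2 ⟨i, Finset.mem_univ _, by simp only [h, termVal, Const.val]⟩))
      · exact Finset.mem_union_right _ (List.mem_toFinset.2 (List.mem_map.2
          ⟨_, ha, by simp only [h, builtInVal, Const.val]⟩))
    · refine ⟨fun i z h => ?_, fun a ha z h => ?_⟩
      · exact Finset.mem_union_left _ (Finset.mem_union_left _ ((hC ic' hic').1 i z h))
      · exact Finset.mem_union_left _ (Finset.mem_union_left _ ((hC ic' hic').2 a ha z h))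

/-- No element of `C` lies between `v` and `v'` (inclusively). -/
def SameSide (C : Finset ℤ) (v v' : ℤ) : Prop :=
  ∀ c ∈ C, (v < c ∧ v' < c) ∨ (c < v ∧ c < v')

theorem CmpOp.holds_swap {v v' : ℤ} {c : Const}
    (hc : ∀ z, c = .num z → (v < z ∧ v' < z) ∨ (z < v ∧ z < v')) {op : CmpOp} {y : Const}
    (h : op.Holds y c) : op.Holds (Equiv.swap (Const.num v) (.num v') y) c := by
  have key : ∀ v v' : ℤ, (∀ z, c = .num z → (v < z ∧ v' < z) ∨ (z < v ∧ z < v')) →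
      op.Holds (.num v) c → op.Holds (.num v') c := by
    intro v v' hc h
    cases c with
    | num z =>
      have := hc z rfl
      cases op <;> simp only [CmpOp.Holds, ne_eq, Const.num.injEq] at h ⊢ <;> omega
    | sym w => cases op <;> simp_all [CmpOp.Holds]
  rw [Equiv.swap_apply_def]
  split_ifs with h₁ h₂
  · subst h₁; exact key v v' hc h
  · subst h₂; exact key v' v (fun z hz => by have := hc z hz; omega) h
  · exact h

/-- The denials do not distinguish integers that are on the same side of all constants, as long as
equalities are respected. -/
theorem Valid.swap {C : Finset ℤ} (hC : ContainsConsts C IC) {v v' : ℤ} (hv : SameSide C v v')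
    {R : S.Rel} {t : Tuple S R} (h : Valid IC ⟨R, t⟩) :
    Valid IC ⟨R, fun i => Equiv.swap (Const.num v) (.num v') (t i)⟩ := by
  intro ic hic
  rintro ⟨ν, hν, hb⟩
  refine h ic hic ⟨fun w => Equiv.swap (Const.num v) (.num v') (ν w), ?_, fun b hbm => ?_⟩
  · obtain rfl : ic.atom.rel = R := congrArg Sigma.fst hν
    have hν' := eq_of_heq (Sigma.mk.inj hν).2
    refine congrArg (Sigma.mk _) (funext fun i => ?_)
    have hi := congrFun hν' i
    cases hτ : ic.atom.args i with
    | var w =>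
      rw [hτ] at hi
      simp only [Term.eval] at hi ⊢
      rw [hi, Equiv.swap_apply_self]
    | const c =>
      rw [hτ] at hi
      simp only [Term.eval] at hi ⊢
      rw [← Equiv.swap_apply_self (Const.num v) (.num v') (t i), ← hi]
      refine (Equiv.swap_apply_of_ne_of_ne ?_ ?_).symm <;> rintro rfl
      · have := hv _ ((hC ic hic).1 i _ hτ); omega
      · have := hv _ ((hC ic hic).1 i _ hτ); omega
  · have := hb b hbm
    cases b with
    | cmp a => exact CmpOp.holds_swap (fun z hz => hv z ((hC ic hic).2 a hbm z hz)) this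
    | eq x y =>
      simp only [BuiltIn.Holds] at this ⊢
      rw [this]
    | ne x y =>
      simp only [BuiltIn.Holds] at this ⊢
      exact fun h => this ((Equiv.swap _ _).injective h)

theorem exists_unused_value {n : ℕ} (t : Fin n → Const) (v ε : ℤ) (hε : ε ≠ 0) :
    ∃ k : ℕ, 1 ≤ k ∧ k ≤ n + 1 ∧ ∀ j, t j ≠ .num (v - ε * k) := by
  by_contra! h
  have h' : ∀ k : Fin (n + 1), ∃ j, t j = .num (v - ε * ((k : ℕ) + 1 : ℕ)) := fun k =>
    h (k + 1) (by omega) (by omega)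
  choose f hf using h'
  have : Function.Injective f := by
    intro k k' hk
    have h₁ := hf k
    rw [hk, hf k', Const.num.injEq] at h₁
    have h₂ : ε * (((k' : ℕ) + 1 : ℕ) : ℤ) = ε * (((k : ℕ) + 1 : ℕ) : ℤ) := by linarith
    have h₃ := mul_left_cancel₀ hε h₂
    apply Fin.ext
    omega
  have := Fintype.card_le_of_injective f this
  simp at this

/-- An optimal value at a fixable position is a rigid value of the tuple, or close to a constant of
the denials, or close to the average of the original values of the positions that share the optimal
value: otherwise all occurrences of the value could be moved to an unused value nearer to the
average. -/
theorem IsOptFix.value {C : Finset ℤ} (hC : ContainsConsts C IC) {R : S.Rel} {t t' : Tuple S R}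
    (h : IsOptFix IC t t') {i : Fin (S.arity R)} (hi : i ∈ S.fixable R) {v : ℤ}
    (hv : t' i = .num v) :
    (∃ j, t j = .num v) ∨ (∃ c ∈ C, |v - c| ≤ S.arity R + 1) ∨
      ∃ B : Finset (Fin (S.arity R)), 0 < B.card ∧
        |(B.card : ℤ) * v - ∑ j ∈ B, (t j).val| ≤ B.card * (S.arity R + 1) := by
  classical
  by_contra! hcon
  obtain ⟨h₁, h₂, h₃⟩ := hcon
  let B := (S.fixable R).filter fun j => t' j = .num v
  have hB : 0 < B.card := Finset.card_pos.2 ⟨i, Finset.mem_filter.2 ⟨hi, hv⟩⟩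
  have h₃ := h₃ B hB
  set m : ℤ := (B.card : ℤ)
  set s := ∑ j ∈ B, (t j).val with hs
  have hm : 0 < m := Int.natCast_pos.2 hB
  obtain ⟨ε, hε, hε'⟩ : ∃ ε : ℤ, (ε = 1 ∨ ε = -1) ∧ m * (S.arity R + 1) < ε * (m * v - s) := by
    rcases lt_abs.1 h₃ with h | h
    · exact ⟨1, .inl rfl, by linarith⟩
    · exact ⟨-1, .inr rfl, by linarith⟩
  obtain ⟨k, hk₁, hk₂, hk⟩ := exists_unused_value t' v ε (by rcases hε with rfl | rfl <;> simp)
  set v' := v - ε * k with hv'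
  have hside : SameSide C v v' := by
    intro c hc
    have := h₂ c hc
    have hk₂' : (k : ℤ) ≤ S.arity R + 1 := by exact_mod_cast hk₂
    have hk₁' : (1 : ℤ) ≤ k := by exact_mod_cast hk₁
    rcases lt_abs.1 this with h | h <;> rcases hε with rfl | rfl <;> omega
  let u : Tuple S R := fun j => Equiv.swap (Const.num v) (.num v') (t' j)
  have hu : ∀ j, u j = if t' j = .num v then .num v' else t' j := by
    intro j
    simp only [u, Equiv.swap_apply_def, if_neg (hk j)]
  have hfix : IsTupleFix IC t u := by
    refine ⟨fun j hj => ?_, fun j hj => ?_, h.1.valid.swap hC hside⟩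
    · rw [hu, if_neg, h.1.rigid j hj]
      rw [← h.1.rigid j hj]
      exact h₁ j
    · rw [hu]
      split_ifs
      · exact ⟨_, rfl⟩
      · exact h.1.isNum j hj
  have hcost := h.2 u hfix
  have hdiff : tupleCost t u - tupleCost t t' =
      ∑ j ∈ B, ((v' ^ 2 - v ^ 2) - 2 * (v' - v) * (t j).val) := by
    rw [tupleCost, tupleCost, ← Finset.sum_sub_distrib, Finset.sum_filter]
    refine Finset.sum_congr rfl fun j _ => ?_
    rw [hu]
    split_ifs with hj
    · rw [hj]; simp only [Const.val]; ring
    · ring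
  rw [Finset.sum_sub_distrib, ← Finset.mul_sum, ← hs, Finset.sum_const, nsmul_eq_mul] at hdiff
  have hε2 : ε * ε = 1 := by rcases hε with rfl | rfl <;> norm_num
  have e : tupleCost t u - tupleCost t t' = -(k * (2 * (ε * (m * v - s)) - m * k)) := by
    rw [hdiff, hv']
    linear_combination (m : ℤ) * k ^ 2 * hε2
  have hk₂' : (k : ℤ) ≤ S.arity R + 1 := by exact_mod_cast hk₂
  have hk₁' : (1 : ℤ) ≤ k := by exact_mod_cast hk₁
  have hmk : m * k ≤ m * (S.arity R + 1) := mul_le_mul_of_nonneg_left hk₂' hm.le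
  have hmk' : 0 < m * k := by positivity
  have : 0 < (k : ℤ) * (2 * (ε * (m * v - s)) - m * k) := mul_pos (by omega) (by linarith)
  linarith

/-- Quotient of an integer and a positive number, rounded towards zero. -/
def roundDiv (s : ℤ) (m : ℕ) : ℤ := ((s.toNat / m : ℕ) : ℤ) - (((-s).toNat / m : ℕ) : ℤ)

theorem abs_sub_roundDiv_le {v s : ℤ} {m n : ℕ} (hm : 0 < m)
    (h : |(m : ℤ) * v - s| ≤ m * (n + 1)) : |v - roundDiv s m| ≤ n + 2 := by
  have hm' : (0 : ℤ) < m := by exact_mod_cast hm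
  have key : |(m : ℤ) * roundDiv s m - s| ≤ m := by
    have h₁ : ∀ x : ℕ, (m : ℤ) * ((x / m : ℕ) : ℤ) ≤ x ∧ (x : ℤ) ≤ m * ((x / m : ℕ) : ℤ) + m := by
      intro x
      have e := Nat.div_add_mod x m
      have l := Nat.mod_lt x hm
      constructor
      · exact_mod_cast Nat.mul_div_le x m
      · have : x ≤ m * (x / m) + m := by omega
        exact_mod_cast this
    have h₂ := Int.toNat_sub_toNat_neg s
    rcases le_total 0 s with hs | hs
    · have h₃ : (-s).toNat = 0 := by omega
      obtain ⟨h₄, h₅⟩ := h₁ s.toNat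
      rw [roundDiv, h₃, Nat.zero_div]
      rw [abs_le]
      push_cast at *
      constructor <;> nlinarith
    · have h₃ : s.toNat = 0 := by omega
      obtain ⟨h₄, h₅⟩ := h₁ (-s).toNat
      rw [roundDiv, h₃, Nat.zero_div]
      rw [abs_le]
      push_cast at *
      constructor <;> nlinarith
  have h' : (m : ℤ) * |v - roundDiv s m| ≤ m * (n + 2) := by
    rw [← abs_of_pos hm', ← abs_mul, abs_of_pos hm']
    calc |(m : ℤ) * (v - roundDiv s m)|
        = |((m : ℤ) * v - s) - ((m : ℤ) * roundDiv s m - s)| := by congr 1; ring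
      _ ≤ |(m : ℤ) * v - s| + |(m : ℤ) * roundDiv s m - s| := abs_sub _ _
      _ ≤ m * (n + 1) + m := add_le_add h key
      _ = m * (n + 2) := by ring
  exact le_of_mul_le_mul_left h' hm'

end LSFix

namespace LSFix

open TreeRep

variable {S : Schema}

/-! ### Assignments that are determined by equations -/

/-- The assignment that is determined by the equations `τ x = v x`, on the variables that occur in
them. -/
noncomputable def solve {X : Type} (τ : X → Term) (v : X → Const) (w : ℕ) : Const :=
  open Classical in if h : ∃ x, τ x = .var w then v h.choose else .num 0

theorem eq_solve {X : Type} {τ : X → Term} {v : X → Const} {ν : ℕ → Const}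
    (h : ∀ x, (τ x).eval ν = v x) {w : ℕ} (hw : ∃ x, τ x = .var w) : ν w = solve τ v w := by
  rw [solve, dif_pos hw, ← h, hw.choose_spec]
  rfl

theorem Atom.ground_eq_iff {L : Atom S} {ν : ℕ → Const} {f : Fact S} :
    L.ground ν = f ↔ f.1 = L.rel ∧ ∀ i, (L.args i).eval ν = factArgs L.rel f i := by
  constructor
  · rintro rfl
    exact ⟨rfl, fun i => by rw [Atom.ground, factArgs_mk]⟩
  · rintro ⟨h, h'⟩
    rw [eq_mk_factArgs h, Atom.ground]
    exact congrArg _ (funext h')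

namespace PTF

variable {α β : Type} [TreeRep α] [TreeRep β]

theorem forall_list {ι : Type} {l : List ι} {P : ι → α → Prop} (h : ∀ i ∈ l, PTF (P i)) :
    PTF fun a => ∀ i ∈ l, P i a := by
  induction l with
  | nil => exact (const True).congr fun a => by simp
  | cons i l ih =>
    exact (and (h i (by simp)) (ih fun j hj => h j (by simp [hj]))).congr fun a => by simp

theorem forall_finset {ι : Type} {s : Finset ι} {P : ι → α → Prop} (h : ∀ i ∈ s, PTF (P i)) :
    PTF fun a => ∀ i ∈ s, P i a :=
  (forall_list (l := s.toList) fun i hi => h i (Finset.mem_toList.1 hi)).congr fun a => by simp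

theorem term_eval {N : α → ℕ → Const} (hN : ∀ w, PTF fun a => N a w) (τ : Term) :
    PTF fun a => τ.eval (N a) := by
  cases τ with
  | var w => exact hN w
  | const c => exact const c

theorem builtIn_holds {N : α → ℕ → Const} (hN : ∀ w, PTF fun a => N a w) (b : BuiltIn) :
    PTF fun a => b.Holds (N a) := by
  cases b with
  | cmp c => exact holds c.op (hN _) (const _)
  | eq x y => exact eq (hN x) (hN y)
  | ne x y => exact not (eq (hN x) (hN y))

/-- Existence of an assignment that satisfies given equations and a predicate that depends only on
the variables of the equations. -/
theorem exists_assignment {X : Type} [Finite X] {τ : X → Term} {v : α → X → Const}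
    (hv : ∀ x, PTF fun a => v a x) {P : α → (ℕ → Const) → Prop}
    (hloc : ∀ a ν ν', (∀ w, (∃ x, τ x = .var w) → ν w = ν' w) → P a ν → P a ν')
    (hP : ∀ N : α → ℕ → Const, (∀ w, PTF fun a => N a w) → PTF fun a => P a (N a)) :
    PTF fun a => ∃ ν, (∀ x, (τ x).eval ν = v a x) ∧ P a ν := by
  have hN : ∀ w, PTF fun a => solve τ (v a) w := by
    intro w
    by_cases h : ∃ x, τ x = .var w
    · simpa only [solve, dif_pos h] using hv h.choose
    · simpa only [solve, dif_neg h] using const _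
  have h₁ : PTF fun a => ∀ x, (τ x).eval (solve τ (v a)) = v a x :=
    forall_finite fun x => eq (term_eval hN _) (hv x)
  refine (and h₁ (hP _ hN)).congr fun a => propext ⟨?_, fun h => ⟨_, h.1, h.2⟩⟩
  rintro ⟨ν, hν, h⟩
  have e : ∀ w, (∃ x, τ x = .var w) → ν w = solve τ (v a) w := fun w hw => eq_solve hν hw
  refine ⟨fun x => ?_, hloc a ν _ e h⟩
  rw [← hν x]
  cases hx : τ x with
  | var w => exact (e w ⟨x, hx⟩).symm
  | const c => rfl

/-- Existence of an assignment under which an atom becomes a given database tuple, and which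
satisfies a predicate that depends only on the variables of the atom. -/
theorem exists_ground (L : Atom S) {f : α → Fact S} (hf : PTF f) {P : α → (ℕ → Const) → Prop}
    (hloc : ∀ a ν ν', (∀ w ∈ L.vars, ν w = ν' w) → P a ν → P a ν')
    (hP : ∀ N : α → ℕ → Const, (∀ w, PTF fun a => N a w) → PTF fun a => P a (N a)) :
    PTF fun a => ∃ ν, L.ground ν = f a ∧ P a ν := by
  have h₁ : PTF fun a => (f a).1 = L.rel := eq (rel hf) (const L.rel)
  have h₂ := exists_assignment (τ := L.args) (v := fun a => factArgs L.rel (f a))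
    (fun i => (apply i).comp (args L.rel hf)) hloc hP
  refine (and h₁ h₂).congr fun a => propext ?_
  simp only [Atom.ground_eq_iff, and_assoc, exists_and_left]

end PTF

theorem BuiltIn.holds_congr {b : BuiltIn} {ν ν' : ℕ → Const} (h : ∀ w ∈ b.vars, ν w = ν' w) :
    b.Holds ν ↔ b.Holds ν' := by
  cases b with
  | cmp a => simp only [BuiltIn.Holds, Comparison.Holds, h a.x rfl]
  | eq x y => simp only [BuiltIn.Holds, h x (.inl rfl), h y (.inr rfl)]
  | ne x y => simp only [BuiltIn.Holds, h x (.inl rfl), h y (.inr rfl)]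

/-! ### Optimal replacements are found in polynomial time -/

section optFix

variable {α : Type} [TreeRep α] (IC : Finset (OneAtomDenial S)) {R : S.Rel}

theorem valid_ptf {f : α → Fact S} (hf : PTF f) : PTF fun a => Valid IC (f a) :=
  .forall_finset fun ic _ => .not (.exists_ground ic.atom hf
    (P := fun _ ν => ∀ b ∈ ic.builtIns, b.Holds ν)
    (fun _ _ _ h hP b hb => (BuiltIn.holds_congr fun w hw => h w (ic.safe b hb hw)).1 (hP b hb))
    (fun _ hN => .forall_list fun b _ => .builtIn_holds hN b))

variable {f g : α → Tuple S R}

theorem isTupleFix_ptf (hf : PTF f) (hg : PTF g) : PTF fun a => IsTupleFix IC (f a) (g a) := by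
  have h₁ : PTF fun a => RigidEq (f a) (g a) := .forall_finite fun i =>
    .imp (.const _) (.eq ((PTF.apply i).comp hf) ((PTF.apply i).comp hg))
  have h₂ : PTF fun a => ∀ i ∈ S.fixable R, (g a i).IsNum := .forall_finset fun i _ =>
    .isNum ((PTF.apply i).comp hg)
  refine (PTF.and h₁ (.and h₂ (valid_ptf IC (.factMk R hg)))).congr fun a => propext ?_
  exact ⟨fun h => ⟨h.1, h.2, h.3⟩, fun h => ⟨h.1, h.2.1, h.2.2⟩⟩

theorem tupleCost_ptf (hf : PTF f) (hg : PTF g) : PTF fun a => tupleCost (f a) (g a) := by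
  have h : ∀ i, PTF fun a => (f a i).val - (g a i).val := fun i =>
    .intSub (.val ((PTF.apply i).comp hf)) (.val ((PTF.apply i).comp hg))
  exact (PTF.intSum (S.fixable R) fun i => .intMul (h i) (h i)).congr fun a => by
    simp only [tupleCost, sq]

omit [TreeRep α] in
theorem exists_candidate_values (R : S.Rel) : ∃ (J : Type) (_ : Finite J)
    (cand : J → Tuple S R → Const), (∀ j, PTF (cand j)) ∧
      ∀ t t', IsOptFix IC t t' → ∀ i, ∃ j, t' i = cand j t := by
  obtain ⟨C, hC⟩ := exists_containsConsts IC
  let n : ℤ := S.arity R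
  let offsets := {o : ℤ // o ∈ Finset.Icc (-(n + 2)) (n + 2)}
  have : Finite offsets := inferInstanceAs (Finite {o : ℤ // o ∈ Finset.Icc (-(n + 2)) (n + 2)})
  let sum (B : Finset (Fin (S.arity R))) (t : Tuple S R) : ℤ := ∑ j ∈ B, (t j).val
  have hsum : ∀ B, PTF (sum B) := fun B => .intSum B fun i => .val (.apply i)
  refine ⟨Fin (S.arity R) ⊕ ({c : ℤ // c ∈ C} × offsets) ⊕ (Finset (Fin (S.arity R)) × offsets),
    inferInstance, fun
      | .inl j => fun t => t j
      | .inr (.inl (c, o)) => fun _ => .num (c.1 + o.1)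
      | .inr (.inr (B, o)) => fun t => .num (roundDiv (sum B t) B.card + o.1), ?_, ?_⟩
  · rintro (j | ⟨c, o⟩ | ⟨B, o⟩)
    · exact .apply j
    · exact .const _
    · exact .num (.intAdd (.natCast_sub (.natDiv (.toNat (hsum B)) (.const _))
        (.natDiv (.toNat_neg (hsum B)) (.const _))) (.const _))
  · intro t t' h i
    by_cases hi : i ∈ S.fixable R
    · obtain ⟨v, hv⟩ := h.1.isNum i hi
      rcases h.value hC hi hv with ⟨j, hj⟩ | ⟨c, hc, hvc⟩ | ⟨B, hB, hvB⟩
      · exact ⟨.inl j, by rw [hv]; exact hj.symm⟩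
      · rw [abs_le] at hvc
        refine ⟨.inr (.inl (⟨c, hc⟩, ⟨v - c, Finset.mem_Icc.2 ?_⟩)), ?_⟩
        · constructor <;> simp only [n] <;> omega
        · rw [hv]; congr 1; simp
      · have := abs_sub_roundDiv_le hB hvB
        rw [abs_le] at this
        refine ⟨.inr (.inr (B, ⟨v - roundDiv (sum B t) B.card, Finset.mem_Icc.2 ?_⟩)), ?_⟩
        · constructor <;> simp only [n, sum] <;> omega
        · rw [hv]; congr 1; simp
    · exact ⟨.inl i, (h.1.rigid i hi).symm⟩

omit [TreeRep α] in
/-- The optimal replacements of a tuple are among a fixed number of candidates, which are computed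
in polynomial time. -/
theorem exists_candidates (R : S.Rel) : ∃ (J : Type) (_ : Finite J)
    (cand : J → Tuple S R → Tuple S R), (∀ j, PTF (cand j)) ∧
      ∀ t t', IsOptFix IC t t' → ∃ j, t' = cand j t := by
  obtain ⟨J, hJ, cand, hcand, h⟩ := exists_candidate_values IC R
  refine ⟨Fin (S.arity R) → J, inferInstance, fun χ t i => cand (χ i) t,
    fun χ => .pi fun i => hcand (χ i), fun t t' htt' => ?_⟩
  choose χ hχ using h t t' htt'
  exact ⟨χ, funext hχ⟩

theorem isOptFix_ptf (hf : PTF f) (hg : PTF g) : PTF fun a => IsOptFix IC (f a) (g a) := by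
  obtain ⟨J, hJ, cand, hcand, h⟩ := exists_candidates IC R
  have hc : ∀ j, PTF fun a => cand j (f a) := fun j => (hcand j).comp hf
  have h₂ : PTF fun a => ∀ j, IsTupleFix IC (f a) (cand j (f a)) →
      tupleCost (f a) (g a) ≤ tupleCost (f a) (cand j (f a)) := .forall_finite fun j =>
    .imp (isTupleFix_ptf IC hf (hc j)) (.intLe (tupleCost_ptf hf hg) (tupleCost_ptf hf (hc j)))
  refine (PTF.and (isTupleFix_ptf IC hf hg) h₂).congr fun a => propext
    ⟨fun hopt => ⟨hopt.1, fun j => hopt.2 _⟩, fun ⟨hfix, hle⟩ => ⟨hfix, fun u hu => ?_⟩⟩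
  obtain ⟨t, ht⟩ := exists_isOptFix hu
  obtain ⟨j, rfl⟩ := h _ _ ht
  exact (hle j ht.1).trans (ht.2 u hu)

/-- Quantification over the optimal replacements of a tuple. -/
theorem exists_isOptFix_ptf (hf : PTF f) {P : α → Tuple S R → Prop}
    (hP : ∀ g : α → Tuple S R, PTF g → PTF fun a => P a (g a)) :
    PTF fun a => ∃ t, IsOptFix IC (f a) t ∧ P a t := by
  obtain ⟨J, hJ, cand, hcand, h⟩ := exists_candidates IC R
  have hc : ∀ j, PTF fun a => cand j (f a) := fun j => (hcand j).comp hf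
  have : PTF fun a => ∃ j, IsOptFix IC (f a) (cand j (f a)) ∧ P a (cand j (f a)) :=
    .exists_finite fun j => .and (isOptFix_ptf IC hf (hc j)) (hP _ (hc j))
  refine this.congr fun a => propext ⟨?_, fun ⟨j, hj⟩ => ⟨_, hj⟩⟩
  rintro ⟨t, ht, hPt⟩
  obtain ⟨j, rfl⟩ := h _ _ ht
  exact ⟨j, ht, hPt⟩

end optFix

end LSFix

namespace LSFix

open TreeRep

variable {S : Schema}

/-! ### Least squares fixes as choices of database tuples -/

/-- `g` arises from the database tuple `f` by an optimal replacement. -/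
def IsOptFact (IC : Finset (OneAtomDenial S)) (f g : Fact S) : Prop :=
  ∃ t, IsOptFix IC f.2 t ∧ g = ⟨f.1, t⟩

theorem factArgs_self (f : Fact S) : factArgs f.1 f = f.2 := factArgs_mk f.1 f.2

theorem isLSFix_iff_image {IC : Finset (OneAtomDenial S)} {D D' : Instance S}
    (hK : SatisfiesKeys D) : IsLSFix IC D D' ↔
      ∃ φ : Fact S → Fact S, (∀ f ∈ D, IsOptFact IC f (φ f)) ∧ ∀ g, g ∈ D' ↔ ∃ f ∈ D, φ f = g := by
  rw [isLSFix_iff hK]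
  constructor
  · rintro ⟨φ, hφ, hD'⟩
    refine ⟨fun f => ⟨f.1, φ f.1 f.2⟩, fun f hf => ⟨_, hφ _ _ (mem_tuples.2 hf), rfl⟩, ?_⟩
    rintro ⟨R, t'⟩
    rw [← mem_tuples, hD' R t']
    constructor
    · rintro ⟨t, ht, rfl⟩
      exact ⟨⟨R, t⟩, mem_tuples.1 ht, rfl⟩
    · rintro ⟨⟨R', t⟩, ht, h⟩
      obtain rfl : R' = R := congrArg Sigma.fst h
      exact ⟨t, mem_tuples.2 ht, eq_of_heq (Sigma.mk.inj h).2⟩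
  · rintro ⟨φ, hφ, hD'⟩
    have key : ∀ R, ∀ t ∈ tuples D R, IsOptFix IC t (factArgs R (φ ⟨R, t⟩)) ∧
        φ ⟨R, t⟩ = ⟨R, factArgs R (φ ⟨R, t⟩)⟩ := by
      intro R t ht
      obtain ⟨t', ht', e⟩ := hφ _ (mem_tuples.1 ht)
      rw [e, factArgs_mk]
      exact ⟨ht', rfl⟩
    refine ⟨fun R t => factArgs R (φ ⟨R, t⟩), fun R t ht => (key R t ht).1, fun R t' => ?_⟩
    rw [mem_tuples, hD']
    constructor
    · rintro ⟨⟨R', t⟩, ht, h⟩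
      have ht := mem_tuples.2 ht
      have e := (key R' t ht).2
      obtain rfl : R' = R := congrArg Sigma.fst (e.symm.trans h)
      exact ⟨t, ht, by dsimp only; rw [h, factArgs_mk]⟩
    · rintro ⟨t, ht, rfl⟩
      exact ⟨⟨R, t⟩, mem_tuples.1 ht, (key R t ht).2⟩

/-- The database tuple `f` belongs to the relation of the atom `L` and has the key value of `L`
under the assignment `ν`. -/
def KeyMatch (L : Atom S) (f : Fact S) (ν : ℕ → Const) : Prop :=
  f.1 = L.rel ∧ ∀ i : {i // i ∈ S.key L.rel}, (L.args i).eval ν = factArgs L.rel f i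

theorem keyMatch_ground (L : Atom S) (ν : ℕ → Const) : KeyMatch L (L.ground ν) ν :=
  ⟨rfl, fun i => ((Atom.ground_eq_iff (L := L) (ν := ν) (f := L.ground ν)).1 rfl).2 i.1⟩

theorem IsOptFact.keyMatch_iff {IC : Finset (OneAtomDenial S)} {f g : Fact S}
    (h : IsOptFact IC f g) {L : Atom S} {ν : ℕ → Const} : KeyMatch L g ν ↔ KeyMatch L f ν := by
  obtain ⟨t, ht, rfl⟩ := h
  obtain ⟨R, u⟩ := f
  dsimp only at t ht
  refine and_congr_right fun hR => forall_congr' fun i => ?_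
  dsimp only at hR
  subst hR
  rw [factArgs_mk, factArgs_mk]
  have : u i = t i :=
    ht.1.rigid i (Finset.disjoint_left.1 (S.key_disjoint_fixable L.rel) i.2)
  rw [this]

theorem KeyMatch.congr {L : Atom S} {f : Fact S} {ν ν' : ℕ → Const}
    (h : ∀ w ∈ L.keyVars, ν w = ν' w) (hL : KeyMatch L f ν) : KeyMatch L f ν' := by
  refine ⟨hL.1, fun i => ?_⟩
  rw [← hL.2 i]
  cases hi : L.args i with
  | var w => exact (h w ⟨i, i.2, hi⟩).symm
  | const c => rfl

/-! ### Conditions on queries that are local to an atom -/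

variable {Q : Query S}

/-- The conditions of the query on the variables of the atom `L`, where the answer is `c`. -/
def LocalCond (Q : Query S) (c : Fin Q.numFree → Const) (L : Atom S) (ν : ℕ → Const) : Prop :=
  (∀ i, Q.head i ∈ L.vars → ν (Q.head i) = c i) ∧
    ∀ a ∈ Q.builtIns, a.x ∈ L.vars → a.Holds ν

theorem LocalCond.congr {c : Fin Q.numFree → Const} {L : Atom S} {ν ν' : ℕ → Const}
    (h : ∀ w ∈ L.vars, ν w = ν' w) (hL : LocalCond Q c L ν) : LocalCond Q c L ν' := by
  refine ⟨fun i hi => by rw [← h _ hi, hL.1 i hi], fun a ha hx => ?_⟩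
  have := hL.2 a ha hx
  rwa [Comparison.Holds, h _ hx] at this

theorem sat_iff {D : Instance S} {c : Fin Q.numFree → Const} :
    Q.Sat D c ↔ ∃ ν, ∀ L ∈ Q.atoms, L.ground ν ∈ D ∧ LocalCond Q c L ν := by
  refine exists_congr fun ν => ⟨fun ⟨h₁, h₂, h₃⟩ L hL => ⟨h₂ L hL, fun i _ => h₁ i,
    fun a ha _ => h₃ a ha⟩, fun h => ⟨fun i => ?_, fun L hL => (h L hL).1, fun a ha => ?_⟩⟩
  · obtain ⟨L, hL, hi⟩ := Q.head_safe i
    exact (h L hL).2.1 i hi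
  · obtain ⟨L, hL, hi⟩ := Q.builtIns_safe a ha
    exact (h L hL).2.2 a ha hi

theorem Query.InCTree.eq_of_rel_eq (hQ : Q.InCTree) {L L' : Atom S} (hL : L ∈ Q.atoms)
    (hL' : L' ∈ Q.atoms) (h : L.rel = L'.rel) : L = L' :=
  List.inj_on_of_nodup_map hQ.noRepeatedRel hL hL' h

/-! ### Brave semantics -/

section semantics

variable {IC : Finset (OneAtomDenial S)} {D : Instance S} {c : Fin Q.numFree → Const}

/-- Under the brave semantics the replacements of the database tuples that match the atoms can be
chosen freely, as different atoms belong to different relations. -/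
theorem brave_iff (hQ : Q.InCTree) (hK : SatisfiesKeys D) :
    ConsistentAnswer Q IC D c .brave ↔ (∀ f ∈ D, ∃ g, IsOptFact IC f g) ∧
      ∃ ν, ∀ L ∈ Q.atoms, (∃ f ∈ D, IsOptFact IC f (L.ground ν)) ∧ LocalCond Q c L ν := by
  classical
  constructor
  · rintro ⟨D', hD', hsat⟩
    obtain ⟨φ, hφ, hmem⟩ := (isLSFix_iff_image hK).1 hD'
    obtain ⟨ν, hν⟩ := sat_iff.1 hsat
    refine ⟨fun f hf => ⟨_, hφ f hf⟩, ν, fun L hL => ⟨?_, (hν L hL).2⟩⟩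
    obtain ⟨f, hf, e⟩ := (hmem _).1 (hν L hL).1
    exact ⟨f, hf, e ▸ hφ f hf⟩
  · rintro ⟨hopt, ν, hν⟩
    choose! o ho using hopt
    let φ : Fact S → Fact S := fun f =>
      if h : ∃ L ∈ Q.atoms, IsOptFact IC f (L.ground ν) then h.choose.ground ν else o f
    have hφ : ∀ f ∈ D, IsOptFact IC f (φ f) := by
      intro f hf
      by_cases h : ∃ L ∈ Q.atoms, IsOptFact IC f (L.ground ν)
      · simp only [φ, dif_pos h]; exact h.choose_spec.2
      · simp only [φ, dif_neg h]; exact ho f hf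
    have hL : ∀ L ∈ Q.atoms, ∀ f, IsOptFact IC f (L.ground ν) → φ f = L.ground ν := by
      intro L hL f hf
      have h : ∃ L ∈ Q.atoms, IsOptFact IC f (L.ground ν) := ⟨L, hL, hf⟩
      simp only [φ, dif_pos h]
      have e : h.choose.rel = L.rel := by
        obtain ⟨t, _, e⟩ := h.choose_spec.2
        obtain ⟨t', _, e'⟩ := hf
        exact (congrArg Sigma.fst e).trans (congrArg Sigma.fst e').symm
      rw [hQ.eq_of_rel_eq h.choose_spec.1 hL e]
    refine ⟨D.image φ, (isLSFix_iff_image hK).2 ⟨φ, hφ, fun g => Finset.mem_image⟩,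
      sat_iff.2 ⟨ν, fun L hLQ => ⟨?_, (hν L hLQ).2⟩⟩⟩
    obtain ⟨f, hf, hfL⟩ := (hν L hLQ).1
    exact Finset.mem_image.2 ⟨f, hf, hL L hLQ f hfL⟩

/-! ### Skeptical semantics -/

/-- The atoms of a query. -/
abbrev Query.Vertex (Q : Query S) : Type := {L : Atom S // L ∈ Q.atoms}

instance : Finite Q.Vertex := (List.finite_toSet Q.atoms).to_subtype

theorem Query.InCTree.wellFounded_child (hQ : Q.InCTree) :
    WellFounded fun L' L : Q.Vertex => Q.JoinArc L L' := by
  let r : Q.Vertex → Q.Vertex → Prop := fun L' L => Relation.TransGen Q.JoinArc L L'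
  have : IsTrans Q.Vertex r := ⟨fun _ _ _ h h' => h'.trans h⟩
  have : Std.Irrefl r := ⟨fun L h => hQ.forest.1 L h⟩
  exact Subrelation.wf (r := r) (fun h => .single h) (Finite.wellFounded_of_trans_of_irrefl r)

theorem Query.InCTree.wellFounded_parent (hQ : Q.InCTree) :
    WellFounded fun L L' : Q.Vertex => Q.JoinArc L L' := by
  let r : Q.Vertex → Q.Vertex → Prop := fun L L' => Relation.TransGen Q.JoinArc L L'
  have : IsTrans Q.Vertex r := ⟨fun _ _ _ h h' => h.trans h'⟩
  have : Std.Irrefl r := ⟨fun L h => hQ.forest.1 L h⟩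
  exact Subrelation.wf (r := r) (fun h => .single h) (Finite.wellFounded_of_trans_of_irrefl r)

theorem Atom.nonKeyVars_subset (L : Atom S) : L.nonKeyVars ⊆ L.vars :=
  fun _ ⟨i, _, h⟩ => ⟨i, h⟩

theorem Atom.mem_vars_iff {L : Atom S} {w : ℕ} :
    w ∈ L.vars ↔ w ∈ L.keyVars ∨ w ∈ L.nonKeyVars := by
  constructor
  · rintro ⟨i, h⟩
    by_cases hi : i ∈ S.key L.rel
    · exact .inl ⟨i, hi, h⟩
    · exact .inr ⟨i, hi, h⟩
  · rintro (⟨i, _, h⟩ | ⟨i, _, h⟩) <;> exact ⟨i, h⟩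

theorem Query.InCTree.eq_of_nonKeyVars (hQ : Q.InCTree) {L L' : Atom S} (hL : L ∈ Q.atoms)
    (hL' : L' ∈ Q.atoms) {w : ℕ} (h : w ∈ L.nonKeyVars) (h' : w ∈ L'.nonKeyVars) : L = L' := by
  by_contra hne
  refine hQ.forest.1 L (.tail (b := L') (.single ?_) ?_)
  · exact ⟨hL, hL', .inl ⟨hne, w, h, L'.nonKeyVars_subset h'⟩⟩
  · exact ⟨hL', hL, .inl ⟨fun e => hne e.symm, w, h', L.nonKeyVars_subset h⟩⟩

/-- The key of a child is determined by the non-key attributes of its parent. -/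
theorem Query.InCTree.keyVars_subset (hQ : Q.InCTree) {L L' : Atom S} (h : Q.JoinArc L L') :
    L'.keyVars ⊆ L.nonKeyVars := by
  have hne : L ≠ L' := by
    rintro rfl
    exact hQ.forest.1 _ (.single h)
  obtain ⟨hL, hL', ⟨-, w, hw, hw'⟩ | ⟨e, -⟩⟩ := h
  · rcases Atom.mem_vars_iff.1 hw' with hk | hn
    · exact hQ.full L hL L' hL' hne ⟨w, hw, hk⟩
    · exact absurd (hQ.eq_of_nonKeyVars hL hL' hw hn) hne
  · exact absurd e hne

/-- The tuple `g` matches the atom `L`, with database tuples that are good for its children. -/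
def Matches (D : Instance S) (c : Fin Q.numFree → Const)
    (L : Q.Vertex) (good : ∀ L' : Q.Vertex, Q.JoinArc L L' → Fact S → Prop) (g : Fact S) : Prop :=
  ∃ ν, L.1.ground ν = g ∧ LocalCond Q c L ν ∧
    ∀ L' : Q.Vertex, ∀ h : Q.JoinArc L L', ∃ f ∈ D, KeyMatch L' f ν ∧ good L' h f

/-- A database tuple of `D` is good for the atom `L` if the subtree of the query with root `L` is
satisfied at this tuple in every least squares fix: every optimal replacement matches `L` and leads
to good tuples for the children of `L`. -/
def Good (hQ : Q.InCTree) (IC : Finset (OneAtomDenial S)) (D : Instance S)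
    (c : Fin Q.numFree → Const) : Q.Vertex → Fact S → Prop :=
  hQ.wellFounded_child.fix fun L good f => ∀ g, IsOptFact IC f g → Matches D c L good g

theorem good_iff (hQ : Q.InCTree) {L : Q.Vertex} {f : Fact S} :
    Good hQ IC D c L f ↔ ∀ g, IsOptFact IC f g →
      Matches D c L (fun L' _ => Good hQ IC D c L') g := by
  rw [Good, WellFounded.fix_eq]

/-- If every atom has a good tuple, with compatible key values, then the answer holds in all least
squares fixes: starting from the roots, the tuples and the values of the non-key variables are found
one atom after the other. -/
theorem sat_of_good (hQ : Q.InCTree) (hK : SatisfiesKeys D) {D' : Instance S}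
    (hD' : IsLSFix IC D D') {ν₀ : ℕ → Const}
    (h : ∀ L : Q.Vertex, ∃ f ∈ D, Good hQ IC D c L f ∧ KeyMatch L f ν₀) : Q.Sat D' c := by
  classical
  obtain ⟨φ, hφ, hmem⟩ := (isLSFix_iff_image hK).1 hD'
  have hN : ∀ (L : Q.Vertex) (f : Fact S), ∃ ν, f ∈ D → Good hQ IC D c L f →
      L.1.ground ν = φ f ∧ LocalCond Q c L ν ∧
        ∀ L' : Q.Vertex, Q.JoinArc L L' → ∃ f' ∈ D, KeyMatch L' f' ν ∧ Good hQ IC D c L' f' := by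
    intro L f
    by_cases h : f ∈ D ∧ Good hQ IC D c L f
    · obtain ⟨ν, hν⟩ := (good_iff hQ).1 h.2 _ (hφ f h.1)
      exact ⟨ν, fun _ _ => hν⟩
    · exact ⟨fun _ => .num 0, fun h₁ h₂ => absurd ⟨h₁, h₂⟩ h⟩
  choose N hN using hN
  have hG : ∀ (L : Q.Vertex) (f : Fact S) (L' : Q.Vertex), ∃ f', f ∈ D → Good hQ IC D c L f →
      Q.JoinArc L L' → f' ∈ D ∧ KeyMatch L' f' (N L f) ∧ Good hQ IC D c L' f' := by
    intro L f L'
    by_cases h : f ∈ D ∧ Good hQ IC D c L f ∧ Q.JoinArc L L'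
    · obtain ⟨f', hf'⟩ := (hN L f h.1 h.2.1).2.2 L' h.2.2
      exact ⟨f', fun _ _ _ => hf'⟩
    · exact ⟨f, fun h₁ h₂ h₃ => absurd ⟨h₁, h₂, h₃⟩ h⟩
  choose G hG using hG
  choose F₀ hF₀D hF₀good hF₀key using h
  let F : Q.Vertex → Fact S := hQ.wellFounded_parent.fix fun L F =>
    if h : ∃ P : Q.Vertex, Q.JoinArc P L then G h.choose (F h.choose h.choose_spec) L else F₀ L
  have hFchild : ∀ P L : Q.Vertex, Q.JoinArc P L → F L = G P (F P) L := by
    intro P L hPL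
    have h : ∃ P : Q.Vertex, Q.JoinArc P L := ⟨P, hPL⟩
    have e : h.choose = P := Subtype.ext (hQ.forest.2 _ _ _ h.choose_spec hPL)
    have : F L = G h.choose (F h.choose) L := by
      simp only [F]
      rw [WellFounded.fix_eq, dif_pos h]
    rw [this, e]
  have hFroot : ∀ L : Q.Vertex, (¬ ∃ P : Q.Vertex, Q.JoinArc P L) → F L = F₀ L := by
    intro L h
    simp only [F]
    rw [WellFounded.fix_eq, dif_neg h]
  have hF : ∀ L, F L ∈ D ∧ Good hQ IC D c L (F L) := by
    intro L
    induction L using hQ.wellFounded_parent.induction with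
    | _ L ih =>
      by_cases h : ∃ P : Q.Vertex, Q.JoinArc P L
      · obtain ⟨P, hP⟩ := h
        obtain ⟨h₁, h₂⟩ := ih P hP
        rw [hFchild P L hP]
        exact ⟨(hG P _ L h₁ h₂ hP).1, (hG P _ L h₁ h₂ hP).2.2⟩
      · rw [hFroot L h]
        exact ⟨hF₀D L, hF₀good L⟩
  -- each variable gets its value from the unique atom with a non-key occurrence, if there is one
  let ν : ℕ → Const := fun w =>
    if h : ∃ L : Q.Vertex, w ∈ L.1.nonKeyVars then N h.choose (F h.choose) w else ν₀ w
  have hν : ∀ (L : Q.Vertex) (w), w ∈ L.1.nonKeyVars → ν w = N L (F L) w := by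
    intro L w hw
    have h : ∃ L : Q.Vertex, w ∈ L.1.nonKeyVars := ⟨L, hw⟩
    have e : h.choose = L :=
      Subtype.ext (hQ.eq_of_nonKeyVars h.choose.2 L.2 h.choose_spec hw)
    simp only [ν, dif_pos h]
    rw [e]
  have hkey : ∀ L : Q.Vertex, KeyMatch L (F L) (N L (F L)) := fun L =>
    (hφ _ (hF L).1).keyMatch_iff.1 ((hN L _ (hF L).1 (hF L).2).1 ▸ keyMatch_ground L.1 _)
  have hagree : ∀ (L : Q.Vertex) (w), w ∈ L.1.vars → N L (F L) w = ν w := by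
    intro L w hw
    by_cases hn : w ∈ L.1.nonKeyVars
    · exact (hν L w hn).symm
    obtain ⟨i, hi, hiw⟩ := (Atom.mem_vars_iff.1 hw).resolve_right hn
    have h₁ := (hkey L).2 ⟨i, hi⟩
    by_cases h : ∃ P : Q.Vertex, Q.JoinArc P L
    · obtain ⟨P, hP⟩ := h
      rw [hν P w (hQ.keyVars_subset hP ⟨i, hi, hiw⟩)]
      have h₂ := (hG P _ L (hF P).1 (hF P).2 hP).2.1
      rw [← hFchild P L hP] at h₂
      have h₂ := h₁.trans (h₂.2 ⟨i, hi⟩).symm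
      simpa only [hiw, Term.eval] using h₂
    · have hw₀ : ¬ ∃ L' : Q.Vertex, w ∈ L'.1.nonKeyVars := by
        rintro ⟨L', hL'⟩
        refine h ⟨L', L'.2, L.2, .inl ⟨?_, w, hL', hw⟩⟩
        intro e
        exact hn (e ▸ hL')
      have h₂ := hF₀key L
      rw [← hFroot L h] at h₂
      have h₂ := h₁.trans (h₂.2 ⟨i, hi⟩).symm
      simp only [ν, dif_neg hw₀]
      simpa only [hiw, Term.eval] using h₂
  refine sat_iff.2 ⟨ν, fun L hL => ?_⟩
  have ha := hagree ⟨L, hL⟩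
  obtain ⟨h₁, h₂⟩ := hF ⟨L, hL⟩
  refine ⟨?_, (hN ⟨L, hL⟩ _ h₁ h₂).2.1.congr ha⟩
  have e : L.ground ν = L.ground (N ⟨L, hL⟩ (F ⟨L, hL⟩)) := by
    refine congrArg (Sigma.mk _) (funext fun i => ?_)
    cases hi : L.args i with
    | var w => exact (ha w ⟨i, hi⟩).symm
    | const c => rfl
  rw [e, (hN ⟨L, hL⟩ _ h₁ h₂).1]
  exact (hmem _).2 ⟨_, h₁, rfl⟩

/-- The skeptical semantics is characterized by good tuples. For the necessity, a least squares fix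
is considered in which every tuple that is not good is replaced by a counterexample. -/
theorem skeptical_iff (hQ : Q.InCTree) (hK : SatisfiesKeys D) :
    ConsistentAnswer Q IC D c .skeptical ↔ (∀ f ∈ D, ∃ g, IsOptFact IC f g) →
      ∃ ν, ∀ L : Q.Vertex, ∃ f ∈ D, Good hQ IC D c L f ∧ KeyMatch L f ν := by
  classical
  constructor
  · intro hcons hopt
    choose! o ho using hopt
    let Bad : Fact S → Fact S → Prop := fun f g => IsOptFact IC f g ∧
      ∃ L : Q.Vertex, L.1.rel = f.1 ∧ ¬ Matches D c L (fun L' _ => Good hQ IC D c L') g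
    let φ : Fact S → Fact S := fun f => if h : ∃ g, Bad f g then h.choose else o f
    have hφ : ∀ f ∈ D, IsOptFact IC f (φ f) := by
      intro f hf
      by_cases h : ∃ g, Bad f g
      · simp only [φ, dif_pos h]; exact h.choose_spec.1
      · simp only [φ, dif_neg h]; exact ho f hf
    obtain ⟨ν, hν⟩ := sat_iff.1 (hcons (D.image φ)
      ((isLSFix_iff_image hK).2 ⟨φ, hφ, fun g => Finset.mem_image⟩))
    have hf : ∀ L : Q.Vertex, ∃ f ∈ D, φ f = L.1.ground ν := fun L =>
      Finset.mem_image.1 (hν L L.2).1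
    choose F hFD hF using hf
    have hkey : ∀ L : Q.Vertex, KeyMatch L (F L) ν := fun L =>
      (hφ _ (hFD L)).keyMatch_iff.1 (hF L ▸ keyMatch_ground L.1 ν)
    refine ⟨ν, fun L => ⟨F L, hFD L, ?_, hkey L⟩⟩
    induction L using hQ.wellFounded_child.induction with
    | _ L ih =>
      by_contra hbad
      rw [good_iff] at hbad
      push Not at hbad
      obtain ⟨g, hg, hng⟩ := hbad
      have h : ∃ g, Bad (F L) g := ⟨g, hg, L, (hkey L).1.symm, hng⟩
      obtain ⟨-, L', hL', hn⟩ := h.choose_spec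
      have e : L' = L := Subtype.ext (hQ.eq_of_rel_eq L'.2 L.2 (hL'.trans (hkey L).1))
      subst e
      have e' : φ (F L') = h.choose := by simp only [φ, dif_pos h]
      rw [← e', hF L'] at hn
      exact hn ⟨ν, rfl, (hν _ L'.2).2, fun L'' hL'' => ⟨F L'', hFD L'', hkey L'', ih L'' hL''⟩⟩
  · intro h D' hD'
    obtain ⟨φ, hφ, -⟩ := (isLSFix_iff_image hK).1 hD'
    obtain ⟨ν, hν⟩ := h fun f hf => ⟨_, hφ f hf⟩
    exact sat_of_good hQ hK hD' hν

end semantics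

end LSFix

namespace LSFix

open TreeRep

variable {S : Schema}

/-! ### Consistent query answering in polynomial time -/

section ptf

variable {α : Type} [TreeRep α] {IC : Finset (OneAtomDenial S)}

/-- Quantification over the optimal replacements of a database tuple. -/
theorem exists_isOptFact_ptf {f : α → Fact S} (hf : PTF f) {P : α → Fact S → Prop}
    (hP : ∀ g : α → Fact S, PTF g → PTF fun a => P a (g a)) :
    PTF fun a => ∃ g, IsOptFact IC (f a) g ∧ P a g := by
  have h : ∀ R, PTF fun a => ∃ t, IsOptFix IC (factArgs R (f a)) t ∧ P a ⟨R, t⟩ := fun R =>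
    exists_isOptFix_ptf IC (.args R hf) fun g hg => hP _ (.factMk R hg)
  refine (PTF.finCases (.rel hf) h).congr fun a => propext ?_
  rw [factArgs_self]
  constructor
  · rintro ⟨_, ⟨t, ht, rfl⟩, h⟩
    exact ⟨t, ht, h⟩
  · rintro ⟨t, ht, h⟩
    exact ⟨_, ⟨t, ht, rfl⟩, h⟩

/-- Quantification over the optimal replacements of a fixed number of database tuples. -/
theorem exists_forall_isOptFact_ptf {n : ℕ} {f : Fin n → α → Fact S} (hf : ∀ i, PTF (f i))
    {P : α → (Fin n → Fact S) → Prop}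
    (hP : ∀ g : α → Fin n → Fact S, PTF g → PTF fun a => P a (g a)) :
    PTF fun a => ∃ g, (∀ i, IsOptFact IC (f i a) (g i)) ∧ P a g := by
  induction n generalizing α with
  | zero =>
    refine (hP _ (.const fun i => i.elim0)).congr fun a => propext ⟨?_, fun h => ⟨_, nofun, h⟩⟩
    rintro ⟨g, -, h⟩
    rwa [Subsingleton.elim g] at h
  | succ n ih =>
    have h : PTF fun a => ∃ g₀, IsOptFact IC (f 0 a) g₀ ∧
        ∃ g, (∀ i, IsOptFact IC (f (Fin.succ i) a) (g i)) ∧ P a (Fin.cons g₀ g) :=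
      exists_isOptFact_ptf (hf 0) fun g₀ hg₀ =>
        ih (fun i => hf i.succ) fun g hg => hP _ (.finCons hg₀ hg)
    refine h.congr fun a => propext ?_
    rw [Fin.exists_fin_succ_pi]
    simp only [Fin.forall_fin_succ, Fin.cons_zero, Fin.cons_succ, and_assoc, exists_and_left]

theorem keyMatch_ptf (L : Atom S) {f : α → Fact S} (hf : PTF f) {N : α → ℕ → Const}
    (hN : ∀ w, PTF fun a => N a w) : PTF fun a => KeyMatch L (f a) (N a) :=
  .and (.eq (.rel hf) (.const _)) (.forall_finite fun i =>
    .eq (.term_eval hN _) ((PTF.apply i.1).comp (.args L.rel hf)))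

variable {Q : Query S}

theorem localCond_ptf (L : Atom S) {c : α → Fin Q.numFree → Const} (hc : PTF c)
    {N : α → ℕ → Const} (hN : ∀ w, PTF fun a => N a w) :
    PTF fun a => LocalCond Q (c a) L (N a) :=
  .and (.forall_finite fun i => .imp (.const _) (.eq (hN _) ((PTF.apply i).comp hc)))
    (.forall_list fun b _ => .imp (.const _) (.holds b.op (hN _) (.const _)))

/-- The recursion along the join graph has fixed depth. Only the assignment to the variables of the
atom `L` matters, as it determines the keys of the children. -/
theorem good_ptf (hQ : Q.InCTree) (L : Q.Vertex) : PTF fun x : Input Q × Fact S =>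
    Good hQ IC x.1.1.toFinset x.1.2 L x.2 := by
  induction L using hQ.wellFounded_child.induction with
  | _ L ih =>
    have h : PTF fun x : Input Q × Fact S => ∃ g, IsOptFact IC x.2 g ∧
        ¬ Matches x.1.1.toFinset x.1.2 L (fun L' _ => Good hQ IC x.1.1.toFinset x.1.2 L') g := by
      refine exists_isOptFact_ptf (.snd .id) fun g hg => .not (.exists_ground L.1 hg ?_ ?_)
      · rintro a ν ν' hν ⟨h₁, h₂⟩
        refine ⟨h₁.congr hν, fun L' hL' => ?_⟩
        obtain ⟨f, hf, hkey, hgood⟩ := h₂ L' hL'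
        exact ⟨f, hf, hkey.congr fun w hw =>
          hν w (L.1.nonKeyVars_subset (hQ.keyVars_subset hL' hw)), hgood⟩
      · refine fun N hN => .and (localCond_ptf L.1 (PTF.snd (.fst .id)) hN) (.forall_finite ?_)
        intro L'
        by_cases hL' : Q.JoinArc L L'
        · have h₁ : PTF fun y : (Input Q × Fact S) × Fact S => KeyMatch L' y.2 (N y.1) :=
            keyMatch_ptf _ (.snd .id) fun w => (hN w).comp (.fst .id)
          have h₂ : PTF fun y : (Input Q × Fact S) × Fact S =>
              Good hQ IC y.1.1.1.toFinset y.1.1.2 L' y.2 :=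
            (ih L' hL').comp (.prodMk (PTF.fst (.fst .id)) (.snd .id))
          refine (PTF.exists_mem (P := fun x f => KeyMatch L' f (N x) ∧
            Good hQ IC x.1.1.toFinset x.1.2 L' f) (PTF.fst (.fst .id)) (.and h₁ h₂)).congr
              fun a => ?_
          simp only [hL', forall_const, List.mem_toFinset]
        · exact (PTF.const True).congr fun a => by simp [hL']
    refine (PTF.not h).congr fun x => ?_
    rw [good_iff]
    simp only [not_exists, not_and, not_not]

/-- The choice of database tuples for finitely many vertices as a tuple of fixed length. -/
theorem exists_forall_mem_iff {V : Type} {m : ℕ} {v : Fin m → V} (hv : Function.Surjective v)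
    {l : List (Fact S)} {P : V → Fact S → (ℕ → Const) → Prop} :
    (∃ ν, ∀ L, ∃ f ∈ l, P L f ν) ↔
      ∃ F : Fin m → Fact S, (∀ i, F i ∈ l) ∧ ∃ ν, ∀ i, P (v i) (F i) ν := by
  constructor
  · rintro ⟨ν, h⟩
    choose F hF hP using h
    exact ⟨F ∘ v, fun i => hF _, ν, fun i => hP _⟩
  · rintro ⟨F, hF, ν, h⟩
    refine ⟨ν, fun L => ?_⟩
    obtain ⟨i, rfl⟩ := hv L
    exact ⟨F i, hF i, h i⟩

theorem Query.exists_enumeration (Q : Query S) :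
    ∃ (m : ℕ) (v : Fin m → Q.Vertex), Function.Surjective v :=
  ⟨_, _, (Finite.equivFin Q.Vertex).symm.surjective⟩

/-- One database tuple is chosen for each atom of the query; the assignment is then determined by
their keys. -/
theorem exists_good_ptf (hQ : Q.InCTree) : PTF fun p : Input Q => ∃ ν, ∀ L : Q.Vertex,
    ∃ f ∈ p.1.toFinset, Good hQ IC p.1.toFinset p.2 L f ∧ KeyMatch L f ν := by
  obtain ⟨m, v, hv⟩ := Q.exists_enumeration
  simp only [List.mem_toFinset, exists_forall_mem_iff hv]
  refine .exists_tuple_mem (.fst .id) ?_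
  have hF : ∀ i, PTF fun x : Input Q × (Fin m → Fact S) => x.2 i := fun i =>
    (PTF.apply i).comp (.snd .id)
  have h₁ : PTF fun x : Input Q × (Fin m → Fact S) => ∀ i, (x.2 i).1 = (v i).1.rel :=
    .forall_finite fun i => .eq (.rel (hF i)) (.const _)
  have h₂ : PTF fun x : Input Q × (Fin m → Fact S) => ∀ i,
      Good hQ IC x.1.1.toFinset x.1.2 (v i) (x.2 i) :=
    .forall_finite fun i => (good_ptf hQ (v i)).comp (.prodMk (.fst .id) (hF i))
  have h₃ := PTF.exists_assignment (α := Input Q × (Fin m → Fact S))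
    (X := Σ i, {j // j ∈ S.key (v i).1.rel}) (τ := fun x => (v x.1).1.args x.2)
    (v := fun a x => factArgs _ (a.2 x.1) x.2.1) (P := fun _ _ => True)
    (fun x => (PTF.apply x.2.1).comp (.args _ (hF x.1))) (fun _ _ _ _ _ => trivial)
    (fun _ _ => .const _)
  refine (PTF.and h₁ (.and h₂ h₃)).congr fun x => propext ?_
  constructor
  · rintro ⟨ν, h⟩
    exact ⟨fun i => (h i).2.1, fun i => (h i).1, ν, fun x => (h x.1).2.2 x.2, trivial⟩
  · rintro ⟨h₁, h₂, ν, h₃, -⟩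
    exact ⟨ν, fun i => ⟨h₂ i, h₁ i, fun j => h₃ ⟨i, j⟩⟩⟩

/-- One database tuple and one optimal replacement are chosen for each atom of the query; the
assignment is then determined by the replacements. -/
theorem exists_choice_ptf : PTF fun p : Input Q => ∃ ν, ∀ L : Q.Vertex,
    ∃ f ∈ p.1.toFinset, IsOptFact IC f (L.1.ground ν) ∧ LocalCond Q p.2 L ν := by
  obtain ⟨m, v, hv⟩ := Q.exists_enumeration
  simp only [List.mem_toFinset, exists_forall_mem_iff hv]
  refine .exists_tuple_mem (.fst .id) ?_
  have h : PTF fun x : Input Q × (Fin m → Fact S) => ∃ g : Fin m → Fact S,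
      (∀ i, IsOptFact IC (x.2 i) (g i)) ∧ (∀ i, (g i).1 = (v i).1.rel) ∧
        ∃ ν, (∀ y : Σ i, Fin (S.arity (v i).1.rel),
          ((v y.1).1.args y.2).eval ν = factArgs _ (g y.1) y.2) ∧
            ∀ i, LocalCond Q x.1.2 (v i) ν := by
    refine exists_forall_isOptFact_ptf (f := fun i (x : Input Q × (Fin m → Fact S)) => x.2 i)
      (fun i => (PTF.apply i).comp (.snd .id)) fun g hg => ?_
    have hg : ∀ i, PTF fun x => g x i := fun i => (PTF.apply i).comp hg
    have hν : PTF fun x => ∃ ν, (∀ y : Σ i, Fin (S.arity (v i).1.rel),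
        ((v y.1).1.args y.2).eval ν = factArgs _ (g x y.1) y.2) ∧
          ∀ i, LocalCond Q x.1.2 (v i) ν :=
      .exists_assignment (τ := fun y : Σ i, Fin (S.arity (v i).1.rel) => (v y.1).1.args y.2)
        (v := fun x y => factArgs _ (g x y.1) y.2) (P := fun x ν => ∀ i, LocalCond Q x.1.2 (v i) ν)
        (fun y => (PTF.apply y.2).comp (.args _ (hg y.1)))
        (fun a ν ν' hν h i => (h i).congr fun w ⟨j, hj⟩ => hν w ⟨⟨i, j⟩, hj⟩)
        fun N hN => .forall_finite fun i => localCond_ptf _ (PTF.snd (.fst .id)) hN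
    exact .and (.forall_finite fun i => .eq (.rel (hg i)) (.const _)) hν
  refine h.congr fun x => propext ?_
  constructor
  · rintro ⟨ν, h⟩
    have e : ∀ i, (v i).1.ground ν = (v i).1.ground ν := fun _ => rfl
    exact ⟨fun i => (v i).1.ground ν, fun i => (h i).1, fun i => (Atom.ground_eq_iff.1 (e i)).1, ν,
      fun y => (Atom.ground_eq_iff.1 (e y.1)).2 y.2, fun i => (h i).2⟩
  · rintro ⟨g, h₁, h₂, ν, h₃, h₄⟩
    refine ⟨ν, fun i => ⟨?_, h₄ i⟩⟩
    rw [Atom.ground_eq_iff.2 ⟨h₂ i, fun j => h₃ ⟨i, j⟩⟩]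
    exact h₁ i

theorem forall_exists_isOptFact_ptf :
    PTF fun p : Input Q => ∀ f ∈ p.1.toFinset, ∃ g, IsOptFact IC f g := by
  have h : PTF fun x : Input Q × Fact S => ∃ g, IsOptFact IC x.2 g ∧ True :=
    exists_isOptFact_ptf (.snd .id) fun _ _ => .const _
  exact (PTF.forall_mem (P := fun _ f => ∃ g, IsOptFact IC f g ∧ True) (.fst .id) h).congr
    fun p => by simp only [and_true, List.mem_toFinset]

theorem wellTyped_ptf : PTF fun p : Input Q => WellTyped p.1.toFinset := by
  have h : PTF fun x : Input Q × Fact S => ∀ R, x.2.1 = R →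
      ∀ i ∈ S.fixable R, (factArgs R x.2 i).IsNum :=
    .forall_finite fun R => .imp (.eq (.rel (.snd .id)) (.const R)) (.forall_finset fun i _ =>
      .isNum ((PTF.apply i).comp (.args R (.snd .id))))
  refine (PTF.forall_mem (P := fun (_ : Input Q) f => ∀ R, f.1 = R →
    ∀ i ∈ S.fixable R, (factArgs R f i).IsNum) (.fst .id) h).congr fun p => propext ?_
  constructor
  · rintro h ⟨R', t⟩ hf R rfl i hi
    rw [factArgs_mk]
    exact h _ t (mem_tuples.2 (List.mem_toFinset.2 hf)) i hi
  · intro h R t ht i hi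
    have := h ⟨R, t⟩ (List.mem_toFinset.1 (mem_tuples.1 ht)) R rfl i hi
    rwa [factArgs_mk] at this

theorem satisfiesKeys_ptf : PTF fun p : Input Q => SatisfiesKeys p.1.toFinset := by
  let C : Fact S → Fact S → Prop := fun f f' => ∀ R, f.1 = R → f'.1 = R →
    (∀ i ∈ S.key R, factArgs R f i = factArgs R f' i) → f = f'
  have h : PTF fun x : (Input Q × Fact S) × Fact S => C x.1.2 x.2 := by
    have hf : PTF fun x : (Input Q × Fact S) × Fact S => x.1.2 := PTF.snd (.fst .id)
    have hf' : PTF fun x : (Input Q × Fact S) × Fact S => x.2 := .snd .id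
    exact .forall_finite fun R => .imp (.eq (.rel hf) (.const R)) (.imp
      (.eq (.rel hf') (.const R)) (.imp (.forall_finset fun i _ => .eq
        ((PTF.apply i).comp (.args R hf)) ((PTF.apply i).comp (.args R hf'))) (.eq hf hf')))
  have h' := PTF.forall_mem (P := fun (p : Input Q) f => ∀ f' ∈ p.1, C f f') (.fst .id)
    (PTF.forall_mem (P := fun (x : Input Q × Fact S) f' => C x.2 f') (PTF.fst (.fst .id)) h)
  refine h'.congr fun p => propext ?_
  constructor
  · rintro h ⟨R₁, t⟩ hf ⟨R₂, t'⟩ hf' R rfl e hk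
    dsimp only at e
    subst e
    simp only [factArgs_mk] at hk
    exact congrArg _ (h _ t (mem_tuples.2 (List.mem_toFinset.2 hf)) t'
      (mem_tuples.2 (List.mem_toFinset.2 hf')) (funext fun i => hk i i.2))
  · intro h R t ht t' ht' e
    have := h ⟨R, t⟩ (List.mem_toFinset.1 (mem_tuples.1 ht)) ⟨R, t'⟩
      (List.mem_toFinset.1 (mem_tuples.1 ht')) R rfl rfl
    simp only [factArgs_mk] at this
    exact sigma_mk_injective (this fun i hi => congrFun e ⟨i, hi⟩)

end ptf

end LSFix

theorem mainTheorem10 (S : LSFix.Schema) (IC : Finset (LSFix.OneAtomDenial S))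
    (Q : LSFix.Query S) (hQ : Q.InCTree) :
    LSFix.InPTIME (LSFix.encodeInput Q) (LSFix.CQA Q IC .skeptical) ∧
      LSFix.InPTIME (LSFix.encodeInput Q) (LSFix.CQA Q IC .brave) := by
  open LSFix in
  constructor
  · refine inPTIME_of_ptf Q _ ((PTF.and wellTyped_ptf (.and satisfiesKeys_ptf
      (.imp (forall_exists_isOptFact_ptf (IC := IC)) (exists_good_ptf (IC := IC) hQ)))).congr
        fun p => propext ?_)
    exact and_congr_right fun _ => and_congr_right fun hK => skeptical_iff hQ hK
  · refine inPTIME_of_ptf Q _ ((PTF.and wellTyped_ptf (.and satisfiesKeys_ptf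
      (.and (forall_exists_isOptFact_ptf (IC := IC)) (exists_choice_ptf (IC := IC))))).congr
        fun p => propext ?_)
    refine and_congr_right fun _ => and_congr_right fun hK => ?_
    rw [brave_iff hQ hK]
    simp only [Subtype.forall, ← and_assoc, exists_and_right]
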